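/- **Protocol.** Let $\mathcal X,\mathcal Y$ be sets. In each round $t=1,\dots,n$ Nature provides $x_t\in\mathcal X$; the learner selects a distribution $q_t$ on $\mathbb R$ (here: a discrete one, depending on $(x_s,y_s)_{s<t}$ and $x_t$); Nature, which may use $q_t$ and everything that happened before, provides $y_t\in\mathcal Y$; the learner draws $\hat y_t\sim q_t$ and incurs the loss $\ell(\hat y_t,y_t)$. The loss $\ell:\mathbb R\times\mathcal Y\to\mathbb R$ is $L$-Lipschitz in its first argument; it need not be convex. **Classes.** Let $\mathcal H_1,\dots,\mathcal H_N$ be reproducing kernel Hilbert spaces of real functions on $\mathcal X$, where $\mathcal H_k$ has a kernel $\mathbf K_k$ with $\sup_{x\in\mathcal X}\sqrt{\mathbf K_k(x,x)}\le B_k$, and $LB_k\ge 1$. **Sub-algorithms.** Suppose that for each $k$ and each $R>0$ a (possibly randomized) learner $\mathrm{Alg}_{k,R}$ for the norm ball of radius $R$ in $\mathcal H_k$ is available: its predictions lie in $[-B_kR,B_kR]$ and, against every Nature, its expected regret over $n$ rounds to each $f\in\mathcal H_k$ with $\|f\|_{\mathcal H_k}\le R$ is at most $C_0\,L\,B_k\,R\,\sqrt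 n$. **Theorem.** There is an efficient randomized learning algorithm, with bounded predictions, such that against every Nature $$\mathbb E\Big[\sum_{t=1}^n\ell(\hat y_t,y_t)-\sum_{t=1}^n\ell(f(x_t),y_t)\Big]\le C\,L\,B_k\,(\|f\|_{\mathcal H_k}+1)\sqrt{n\,\log\big(LB_k\,k\,n\,(\|f\|_{\mathcal H_k}+1)\big)}\qquad\text{for all }k\in\{1,\dots,N\},\ f\in\mathcal H_k,$$ where $C$ depends only on $C_0$. Efficient means: the algorithm is one program, with a constant $d$, both independent of all the data above, for a machine with exact real arithmetic (including $\sqrt{\cdot},\exp,\log$), coins with computed biases, and oracle access to fresh predictions of the sub-algorithms and to the losses $\ell(\cdot,y_s)$ of past rounds. Given $n$, $N$, $t$, $L$ and $(B_k)_k$, it computes the prediction $\hat y_t$ of round $t$ in at most $(n+N+2)^d\,(T+1)$ steps, if each call of a sub-algorithm takes $T$ steps and every other operation takes one step. -/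

import Mathlib

noncomputable section

namespace OnlineLearning

/-! ### The online supervised learning protocol -/

/-- A randomized learner. `A past x` is the law `q_t ∈ Δ(ℝ)` of the prediction in the current
round, given the pairs `(x_s, y_s)` of the previous rounds (oldest first) and the current
context `x = x_t`. -/
abbrev Strategy (X Y : Type*) := List (X × Y) → X → PMF ℝ

/-- An adaptive Nature. It sees the triples `(x_s, y_s, ŷ_s)` of all previous rounds. It first
provides the context; after the learner has committed to the law `q_t` of its prediction, which
Nature sees, it provides the outcome. -/
structure Nature (X Y : Type*) where
  ctx : List (X × Y × ℝ) → X
  out : List (X × Y × ℝ) → X → PMF ℝ → Y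

/-- Expected regret against the predictor `f`, accumulated over the next `m` rounds of the game
between `A` and `ν`, when the triples `(x_s, y_s, ŷ_s)` in `h` have already been realized:
in each round the learner draws `v = ŷ_t ∼ q_t` and adds `ℓ(ŷ_t, y_t) - ℓ(f(x_t), y_t)`. -/
def regretFrom {X Y : Type*} (ℓ : ℝ → Y → ℝ) (A : Strategy X Y) (ν : Nature X Y) (f : X → ℝ) :
    ℕ → List (X × Y × ℝ) → ℝ
  | 0, _ => 0
  | m + 1, h =>
    let x := ν.ctx h
    let q := A (h.map fun z => (z.1, z.2.1)) x
    let y := ν.out h x q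
    ∑' v : ℝ, (q v).toReal * (ℓ v y - ℓ (f x) y + regretFrom ℓ A ν f m (h ++ [(x, y, v)]))

/-- `E[∑_{t ≤ n} ℓ(ŷ_t, y_t) - ∑_{t ≤ n} ℓ(f(x_t), y_t)]`. -/
def expectedRegret {X Y : Type*} (ℓ : ℝ → Y → ℝ) (A : Strategy X Y) (ν : Nature X Y)
    (f : X → ℝ) (n : ℕ) : ℝ :=
  regretFrom ℓ A ν f n []

/-- In each of the first `n` rounds, on every history, the prediction lies in `[-M, M]`. -/
def PredictsIn {X Y : Type*} (A : Strategy X Y) (n : ℕ) (M : ℝ) : Prop :=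
  ∀ (past : List (X × Y)) (x : X), past.length < n → ∀ v ∈ (A past x).support, |v| ≤ M

/-! ### A randomized real-number machine with oracles and a step count

Finitely many integer variables, finitely many arrays of real numbers, exact arithmetic on real
numbers, coins with computed biases, counted loops. On integers there are only addition and
truncated subtraction. A program is a finite object that mentions no real constant. -/

/-- Expressions with values in `ℕ`. -/
inductive NExpr : Type
  | lit (m : ℕ)
  | var (v : ℕ)
  | plus (a b : NExpr)
  | minus (a b : NExpr)

/-- Expressions with values in `ℝ`; `get a i` reads entry `i` of array `a`. -/
inductive RExpr : Type
  | cast (e : NExpr)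
  | get (a : ℕ) (i : NExpr)
  | plus (a b : RExpr)
  | minus (a b : RExpr)
  | times (a b : RExpr)
  | div (a b : RExpr)
  | sqrt (a : RExpr)
  | exp (a : RExpr)
  | log (a : RExpr)

/-- Comparisons. -/
inductive Test : Type
  | ltNat (a b : NExpr)
  | ltReal (a b : RExpr)

/-- Commands. -/
inductive Cmd : Type
  /-- Do nothing. -/
  | skip
  /-- Assign to an integer variable. -/
  | setNat (v : ℕ) (e : NExpr)
  /-- Assign to entry `i` of the real array `a`. -/
  | setReal (a : ℕ) (i : NExpr) (e : RExpr)
  /-- Set an integer variable to `1` with probability `min 1 (max 0 p)`, and to `0` otherwise,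
  independently of everything before. -/
  | coin (v : ℕ) (p : RExpr)
  /-- Store in entry `i` of array `a` a prediction, freshly drawn, of the sub-algorithm for the
  class number `k` and the radius `R` in round `s`. -/
  | callSub (a : ℕ) (i : NExpr) (k : NExpr) (R : RExpr) (s : NExpr)
  /-- Store in entry `i` of array `a` the loss of the prediction `p` in the past round `s`. -/
  | callLoss (a : ℕ) (i : NExpr) (p : RExpr) (s : NExpr)
  /-- Sequential composition. -/
  | seq (c d : Cmd)
  /-- Conditional. -/
  | ite (b : Test) (c d : Cmd)
  /-- Evaluate `e` once, to `m`; then for `i = 0, …, m - 1` set the integer variable `v` to `i`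
  and run `c`. -/
  | loop (v : ℕ) (e : NExpr) (c : Cmd)

/-- The memory of the machine, and the number of steps made so far. -/
structure State where
  nat : ℕ → ℕ
  arr : ℕ → ℕ → ℝ
  steps : ℕ

/-- What the machine has access to besides its memory: the predictions of the sub-algorithms
(class, radius, round), the losses in past rounds (prediction, round), and the number of steps
that a call of a sub-algorithm takes. -/
structure Oracle where
  sub : ℕ → ℝ → ℕ → PMF ℝ
  loss : ℝ → ℕ → ℝ
  cost : ℕ

def NExpr.eval (σ : State) : NExpr → ℕ
  | lit m => m
  | var v => σ.nat v
  | plus a b => a.eval σ + b.eval σ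
  | minus a b => a.eval σ - b.eval σ

/-- The number of operations in an expression. -/
def NExpr.size : NExpr → ℕ
  | lit _ => 1
  | var _ => 1
  | plus a b => a.size + b.size + 1
  | minus a b => a.size + b.size + 1

def RExpr.eval (σ : State) : RExpr → ℝ
  | cast e => (e.eval σ : ℝ)
  | get a i => σ.arr a (i.eval σ)
  | plus a b => a.eval σ + b.eval σ
  | minus a b => a.eval σ - b.eval σ
  | times a b => a.eval σ * b.eval σ
  | div a b => a.eval σ / b.eval σ
  | sqrt a => Real.sqrt (a.eval σ)
  | exp a => Real.exp (a.eval σ)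
  | log a => Real.log (a.eval σ)

/-- The number of operations in an expression. -/
def RExpr.size : RExpr → ℕ
  | cast e => e.size + 1
  | get _ i => i.size + 1
  | plus a b => a.size + b.size + 1
  | minus a b => a.size + b.size + 1
  | times a b => a.size + b.size + 1
  | div a b => a.size + b.size + 1
  | sqrt a => a.size + 1
  | exp a => a.size + 1
  | log a => a.size + 1

def Test.holds (σ : State) : Test → Prop
  | ltNat a b => a.eval σ < b.eval σ
  | ltReal a b => a.eval σ < b.eval σ

/-- The number of operations in a test. -/
def Test.size : Test → ℕ
  | ltNat a b => a.size + b.size + 1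
  | ltReal a b => a.size + b.size + 1

def State.setNat (σ : State) (v m : ℕ) : State :=
  { σ with nat := Function.update σ.nat v m }

def State.setReal (σ : State) (a i : ℕ) (r : ℝ) : State :=
  { σ with arr := Function.update σ.arr a (Function.update (σ.arr a) i r) }

/-- Count `m` more steps. -/
def State.tick (σ : State) (m : ℕ) : State :=
  { σ with steps := σ.steps + m }

/-- The law of a coin with bias `min 1 (max 0 p)`. -/
def biasedCoin (p : ℝ) : PMF Bool :=
  PMF.ofFintype (fun b => ENNReal.ofReal (if b then min 1 (max 0 p) else 1 - min 1 (max 0 p)))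
    (by
      have h0 : (0 : ℝ) ≤ min 1 (max 0 p) := le_min zero_le_one (le_max_left _ _)
      have h1 : (0 : ℝ) ≤ 1 - min 1 (max 0 p) := sub_nonneg.2 (min_le_left _ _)
      simp only [Fintype.sum_bool, if_true, Bool.false_eq_true, if_false]
      rw [← ENNReal.ofReal_add h0 h1]
      simp)

open Classical in
/-- The law of the state after a run of the program from the state `σ`. -/
def Cmd.run (O : Oracle) : Cmd → State → PMF State
  | skip, σ => PMF.pure σ
  | setNat v e, σ => PMF.pure ((σ.setNat v (e.eval σ)).tick (e.size + 1))
  | setReal a i e, σ =>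
      PMF.pure ((σ.setReal a (i.eval σ) (e.eval σ)).tick (i.size + e.size + 1))
  | coin v p, σ =>
      (biasedCoin (p.eval σ)).map fun b => (σ.setNat v (if b then 1 else 0)).tick (p.size + 1)
  | callSub a i k R s, σ =>
      (O.sub (k.eval σ) (R.eval σ) (s.eval σ)).map fun r =>
        (σ.setReal a (i.eval σ) r).tick (i.size + k.size + R.size + s.size + O.cost + 1)
  | callLoss a i p s, σ =>
      PMF.pure ((σ.setReal a (i.eval σ) (O.loss (p.eval σ) (s.eval σ))).tick
        (i.size + p.size + s.size + 1))
  | seq c d, σ => (c.run O σ).bind (d.run O)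
  | ite b c d, σ =>
      if b.holds σ then c.run O (σ.tick (b.size + 1)) else d.run O (σ.tick (b.size + 1))
  | loop v e c, σ =>
      Nat.rec (motive := fun _ => PMF State) (PMF.pure (σ.tick (e.size + 1)))
        (fun i law => law.bind fun τ => c.run O ((τ.setNat v i).tick 1)) (e.eval σ)

/-! ### The learner computed by a program -/

/-- The oracle in the current round, after the rounds in `past` and given the context `x`.
Rounds are numbered from `0`, so the current one has the number `past.length`. In round `s`, the
sub-algorithm sees the rounds before `s` and the context of round `s`. The loss function
`ℓ(·, y_s)` is available for the past rounds `s` only. -/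
def oracleAt {X Y : Type*} {N : ℕ} (ℓ : ℝ → Y → ℝ) (A : Fin N → ℝ → Strategy X Y) (T : ℕ)
    (past : List (X × Y)) (x : X) : Oracle where
  sub k R s :=
    if hk : k < N then
      if hs : s < past.length then A ⟨k, hk⟩ R (past.take s) (past[s]).1
      else if s = past.length then A ⟨k, hk⟩ R past x
      else PMF.pure 0
    else PMF.pure 0
  loss v s := if hs : s < past.length then ℓ v (past[s]).2 else 0
  cost := T

/-- The memory at the start of round `t`: the horizon `n`, the number `N` of classes and `t` are
in the integer variables `0`, `1`, `2`, the Lipschitz constant is in array `0`, the bounds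
`B_1, …, B_N` are in array `1`, and everything else is zero. -/
def initState {N : ℕ} (n t : ℕ) (L : ℝ) (B : Fin N → ℝ) : State where
  nat v := if v = 0 then n else if v = 1 then N else if v = 2 then t else 0
  arr a i :=
    if a = 0 ∧ i = 0 then L
    else if h : a = 1 ∧ i < N then B ⟨i, h.2⟩
    else 0
  steps := 0

/-- The law of the final state of the program `P` in the round after `past`, with context `x`. -/
def roundRun {X Y : Type*} {N : ℕ} (P : Cmd) (n : ℕ) (L : ℝ) (B : Fin N → ℝ) (ℓ : ℝ → Y → ℝ)
    (A : Fin N → ℝ → Strategy X Y) (T : ℕ) (past : List (X × Y)) (x : X) : PMF State :=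
  P.run (oracleAt ℓ A T past x) (initState n past.length L B)

/-- The learner that runs the program `P` in each round, and predicts the number that the program
leaves in entry `0` of array `2`. -/
def learner {X Y : Type*} {N : ℕ} (P : Cmd) (n : ℕ) (L : ℝ) (B : Fin N → ℝ) (ℓ : ℝ → Y → ℝ)
    (A : Fin N → ℝ → Strategy X Y) (T : ℕ) : Strategy X Y :=
  fun past x => (roundRun P n L B ℓ A T past x).map fun σ => σ.arr 2 0

end OnlineLearning

end

/-!
The learner aggregates experts: for every class `k < N` and every exponent `i ≤ n` there is an expert
that follows the sub-algorithm of class `k` for the radius `2 ^ i`. Relative to the prediction `0`,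
the losses of this expert are bounded by its scale `c = L * B k * 2 ^ i`, and the regret with respect
to an expert has to be proportional to its own scale, not to the largest one.

*Aggregation.* Expert `j` owns a wealth `W j`, initially its prior weight, and stakes the fraction
`β j * W j` of it. If all stakes add up to at most one, they serve as probabilities (the remaining
mass is put on the prediction `0`). Otherwise they are cut off from the smallest scales upwards
(`playProb`). The price of the cut-off is covered by adding the correction `min (c j) y` to the loss
of expert `j`, where `y` is the cut-off scale (`sum_mul_playProb_le`). The corrected losses are still
of the order of the scales, and the wealth is multiplied by one minus `β j` times the corrected
loss. By `-log (1 - z) ≤ z + 2 * z ^ 2`, the potential `∑ j, W j - log (W i * β i) / β i + ...`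
decreases in each round by at least the regret with respect to expert `i`
(`expect_potential_roundStep_le`), and it ends up nonnegative (`potential_zero_nonneg`). With
`β i` of the order `√(Λ / n) / c i`, its initial value is of the order `c i * √(n * Λ)`, where `Λ` is
the complexity of the expert (`neg_log_div_add_le`).

*Randomness.* A program has no memory between the rounds. In each round it replays the past, with
fresh predictions of the sub-algorithms. The law of a sub-algorithm's prediction depends on the past
contexts and outcomes only; hence the law of the wealths, and so that of the prediction, is a function
of the past contexts and outcomes (`learner_eq`), and the wealths used in successive rounds may be
thought of as one Markov chain. The expected potential along this chain bounds the regret along every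
sequence of contexts and outcomes, and therefore against every adaptive Nature
(`expectedRegret_learner_le`). In the same way, the regret bound of a sub-algorithm is applied along
every fixed sequence (`pathSum_le_of_expectedRegret_le`).

*Radii.* If `n ≤ 2 * log Q`, where `Q` is the argument of the logarithm in the theorem, then comparing
with the prediction `0` suffices. Otherwise the norm of `f` is below `2 ^ n`, and the expert whose
radius is the next power of two is good enough (`oracle_inequality`).

*Running time.* The lengths of all loops of the program depend on `n`, `N` and the number of the round
only, and every such program runs in polynomial time (`Cmd.Protected.exists_steps_le`).
-/

noncomputable section

namespace OnlineLearning

/-! ### Expectations of bounded functions under a discrete law -/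

/-- The expectation of `f` under the discrete law `p`. -/
def expect {α : Type*} (p : PMF α) (f : α → ℝ) : ℝ := ∑' a, (p a).toReal * f a

/-- `f` is bounded on the support of `p`, which makes `expect p f` an absolutely convergent sum. -/
def BddOn {α : Type*} (p : PMF α) (f : α → ℝ) : Prop := ∃ M, ∀ a ∈ p.support, |f a| ≤ M

section Expect

variable {α β : Type*} {p : PMF α} {f g : α → ℝ}

theorem summable_toReal (p : PMF α) : Summable fun a => (p a).toReal :=
  ENNReal.summable_toReal (by rw [p.tsum_coe]; exact ENNReal.one_ne_top)

theorem tsum_toReal (p : PMF α) : ∑' a, (p a).toReal = 1 := by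
  rw [← ENNReal.tsum_toReal_eq (fun a => p.apply_ne_top a), p.tsum_coe, ENNReal.toReal_one]

theorem BddOn.summable (h : BddOn p f) : Summable fun a => (p a).toReal * f a := by
  obtain ⟨M, hM⟩ := h
  refine Summable.of_norm_bounded (g := fun a => (p a).toReal * M)
    ((summable_toReal p).mul_right M) fun a => ?_
  rw [norm_mul, Real.norm_eq_abs, Real.norm_eq_abs, abs_of_nonneg ENNReal.toReal_nonneg]
  by_cases ha : a ∈ p.support
  · exact mul_le_mul_of_nonneg_left (hM a ha) ENNReal.toReal_nonneg
  · rw [PMF.mem_support_iff, not_not] at ha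
    simp [ha]

theorem expect_congr (h : ∀ a ∈ p.support, f a = g a) : expect p f = expect p g := by
  refine tsum_congr fun a => ?_
  by_cases ha : a ∈ p.support
  · rw [h a ha]
  · rw [PMF.mem_support_iff, not_not] at ha
    simp [ha]

theorem expect_const (p : PMF α) (c : ℝ) : expect p (fun _ => c) = c := by
  rw [expect, tsum_mul_right, tsum_toReal, one_mul]

theorem expect_const_mul (p : PMF α) (c : ℝ) (f : α → ℝ) :
    expect p (fun a => c * f a) = c * expect p f := by
  rw [expect, expect, ← tsum_mul_left]
  exact tsum_congr fun a => by ring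

theorem BddOn.add (hf : BddOn p f) (hg : BddOn p g) : BddOn p fun a => f a + g a := by
  obtain ⟨M, hM⟩ := hf
  obtain ⟨M', hM'⟩ := hg
  exact ⟨M + M', fun a ha => (abs_add_le _ _).trans (add_le_add (hM a ha) (hM' a ha))⟩

theorem BddOn.const (p : PMF α) (c : ℝ) : BddOn p fun _ => c := ⟨|c|, fun _ _ => le_rfl⟩

theorem BddOn.const_mul (hf : BddOn p f) (c : ℝ) : BddOn p fun a => c * f a := by
  obtain ⟨M, hM⟩ := hf
  refine ⟨|c| * M, fun a ha => ?_⟩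
  rw [abs_mul]
  exact mul_le_mul_of_nonneg_left (hM a ha) (abs_nonneg c)

theorem BddOn.sum {ι : Type*} {s : Finset ι} {F : ι → α → ℝ} (h : ∀ i ∈ s, BddOn p (F i)) :
    BddOn p fun a => ∑ i ∈ s, F i a := by
  classical
  induction s using Finset.induction_on with
  | empty => simpa using BddOn.const p 0
  | insert i s hi ih =>
    simp only [Finset.sum_insert hi]
    exact (h i (Finset.mem_insert_self i s)).add
      (ih fun j hj => h j (Finset.mem_insert_of_mem hj))

theorem expect_add (hf : BddOn p f) (hg : BddOn p g) :
    expect p (fun a => f a + g a) = expect p f + expect p g := by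
  rw [expect, expect, expect, ← hf.summable.tsum_add hg.summable]
  exact tsum_congr fun a => by ring

theorem expect_sum {ι : Type*} {s : Finset ι} {F : ι → α → ℝ} (h : ∀ i ∈ s, BddOn p (F i)) :
    expect p (fun a => ∑ i ∈ s, F i a) = ∑ i ∈ s, expect p (F i) := by
  classical
  induction s using Finset.induction_on with
  | empty => simpa using expect_const p 0
  | insert i s hi ih =>
    have hs : ∀ j ∈ s, BddOn p (F j) := fun j hj => h j (Finset.mem_insert_of_mem hj)
    simp only [Finset.sum_insert hi]
    rw [expect_add (h i (Finset.mem_insert_self i s)) (BddOn.sum hs), ih hs]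

theorem expect_mono (hf : BddOn p f) (hg : BddOn p g) (h : ∀ a ∈ p.support, f a ≤ g a) :
    expect p f ≤ expect p g := by
  refine hf.summable.tsum_le_tsum (fun a => ?_) hg.summable
  by_cases ha : a ∈ p.support
  · exact mul_le_mul_of_nonneg_left (h a ha) ENNReal.toReal_nonneg
  · rw [PMF.mem_support_iff, not_not] at ha
    simp [ha]

theorem abs_expect_le {M : ℝ} (h : ∀ a ∈ p.support, |f a| ≤ M) : |expect p f| ≤ M := by
  have hb : BddOn p f := ⟨M, h⟩
  rw [abs_le]
  constructor
  · rw [← expect_const p (-M)]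
    exact expect_mono (BddOn.const p _) hb fun a ha => (abs_le.1 (h a ha)).1
  · rw [← expect_const p M]
    exact expect_mono hb (BddOn.const p _) fun a ha => (abs_le.1 (h a ha)).2

theorem expect_pure (a : α) (f : α → ℝ) : expect (PMF.pure a) f = f a := by
  classical
  rw [expect, tsum_eq_single a]
  · simp
  · intro b hb
    simp [PMF.pure_apply, hb]

theorem expect_bind {q : α → PMF β} {φ : β → ℝ} (h : BddOn (p.bind q) φ) :
    expect (p.bind q) φ = expect p fun a => expect (q a) φ := by
  obtain ⟨M, hM⟩ := h
  -- the joint law of the two draws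
  have h1 : Summable fun z : α × β => (p z.1 * q z.1 z.2).toReal := by
    refine ENNReal.summable_toReal ?_
    rw [ENNReal.tsum_prod (f := fun a b => p a * q a b)]
    simp only [ENNReal.tsum_mul_left, PMF.tsum_coe, mul_one]
    exact ENNReal.one_ne_top
  have h2 : Summable fun z : α × β => (p z.1 * q z.1 z.2).toReal * φ z.2 := by
    refine Summable.of_norm_bounded (g := fun z => (p z.1 * q z.1 z.2).toReal * M)
      (h1.mul_right M) fun z => ?_
    rw [norm_mul, Real.norm_eq_abs, Real.norm_eq_abs, abs_of_nonneg ENNReal.toReal_nonneg]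
    by_cases hz : p z.1 * q z.1 z.2 = 0
    · simp [hz]
    · refine mul_le_mul_of_nonneg_left (hM _ ?_) ENNReal.toReal_nonneg
      rw [PMF.mem_support_bind_iff]
      exact ⟨z.1, (PMF.mem_support_iff _ _).2 (left_ne_zero_of_mul hz),
        (PMF.mem_support_iff _ _).2 (right_ne_zero_of_mul hz)⟩
  have h3 : ∀ b, ((p.bind q) b).toReal * φ b = ∑' a, (p a * q a b).toReal * φ b := by
    intro b
    rw [PMF.bind_apply, ENNReal.tsum_toReal_eq, tsum_mul_right]
    exact fun a => ENNReal.mul_ne_top (p.apply_ne_top a) ((q a).apply_ne_top b)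
  rw [expect, tsum_congr h3]
  rw [h2.tsum_comm (f := fun a b => (p a * q a b).toReal * φ b), expect]
  refine tsum_congr fun a => ?_
  rw [expect, ← tsum_mul_left]
  exact tsum_congr fun b => by rw [ENNReal.toReal_mul]; ring

theorem BddOn.map {r : α → β} {φ : β → ℝ} (h : BddOn p fun a => φ (r a)) :
    BddOn (p.map r) φ := by
  obtain ⟨M, hM⟩ := h
  refine ⟨M, fun b hb => ?_⟩
  obtain ⟨a, ha, rfl⟩ := (PMF.mem_support_map_iff _ _ _).1 hb
  exact hM a ha

theorem expect_map {r : α → β} {φ : β → ℝ} (h : BddOn p fun a => φ (r a)) :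
    expect (p.map r) φ = expect p fun a => φ (r a) := by
  have h' := h.map
  rw [← PMF.bind_pure_comp] at h' ⊢
  rw [expect_bind h']
  simp only [Function.comp_apply, expect_pure]

theorem BddOn.of_bind {q : α → PMF β} {φ : β → ℝ} (h : BddOn (p.bind q) φ) {a : α}
    (ha : a ∈ p.support) : BddOn (q a) φ := by
  obtain ⟨M, hM⟩ := h
  exact ⟨M, fun b hb => hM b ((PMF.mem_support_bind_iff _ _ _).2 ⟨a, ha, hb⟩)⟩

theorem BddOn.expect_of_bind {q : α → PMF β} {φ : β → ℝ} (h : BddOn (p.bind q) φ) :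
    BddOn p fun a => expect (q a) φ := by
  obtain ⟨M, hM⟩ := h
  exact ⟨M, fun a ha => abs_expect_le fun b hb =>
    hM b ((PMF.mem_support_bind_iff _ _ _).2 ⟨a, ha, hb⟩)⟩

end Expect

theorem expect_biasedCoin {r : ℝ} (h0 : 0 ≤ r) (h1 : r ≤ 1) (f : Bool → ℝ) :
    expect (biasedCoin r) f = r * f true + (1 - r) * f false := by
  rw [expect, tsum_fintype, Fintype.sum_bool]
  simp [biasedCoin, h0, h1]

/-- Two laws that agree on the support of `p` give the same composite law. -/
theorem bind_congr_support {α β : Type*} (p : PMF α) {q r : α → PMF β}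
    (h : ∀ a ∈ p.support, q a = r a) : p.bind q = p.bind r := by
  ext b
  rw [PMF.bind_apply, PMF.bind_apply]
  refine tsum_congr fun a => ?_
  by_cases ha : a ∈ p.support
  · rw [h a ha]
  · rw [PMF.mem_support_iff, not_not] at ha
    simp [ha]

theorem eq_pure_of_support {α : Type*} {p : PMF α} {a : α} (h : ∀ b ∈ p.support, b = a) :
    p = PMF.pure a := by
  have : p = p.bind PMF.pure := (PMF.bind_pure p).symm
  rw [this, bind_congr_support p (r := fun _ => PMF.pure a) fun b hb => by rw [h b hb],
    PMF.bind_const]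

/-! ### Reasoning about programs -/

/-- Every possible final state of `c`, started in `σ`, satisfies `Q`. -/
def Cmd.Ensures (O : Oracle) (c : Cmd) (Q : State → Prop) (σ : State) : Prop :=
  ∀ τ ∈ (c.run O σ).support, Q τ

section Ensures

variable {O : Oracle} {Q : State → Prop} {σ : State}

theorem ensures_skip : Cmd.skip.Ensures O Q σ ↔ Q σ := by
  simp [Cmd.Ensures, Cmd.run]

theorem ensures_setNat {v : ℕ} {e : NExpr} :
    (Cmd.setNat v e).Ensures O Q σ ↔ Q ((σ.setNat v (e.eval σ)).tick (e.size + 1)) := by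
  simp [Cmd.Ensures, Cmd.run]

theorem ensures_setReal {a : ℕ} {i : NExpr} {e : RExpr} :
    (Cmd.setReal a i e).Ensures O Q σ ↔
      Q ((σ.setReal a (i.eval σ) (e.eval σ)).tick (i.size + e.size + 1)) := by
  simp [Cmd.Ensures, Cmd.run]

theorem ensures_coin {v : ℕ} {p : RExpr}
    (h : ∀ m, Q ((σ.setNat v m).tick (p.size + 1))) : (Cmd.coin v p).Ensures O Q σ := by
  intro τ hτ
  simp only [Cmd.run, PMF.mem_support_map_iff] at hτ
  obtain ⟨b, -, rfl⟩ := hτ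
  exact h _

theorem ensures_callSub {a : ℕ} {i k : NExpr} {R : RExpr} {s : NExpr} :
    (Cmd.callSub a i k R s).Ensures O Q σ ↔
      ∀ r ∈ (O.sub (k.eval σ) (R.eval σ) (s.eval σ)).support,
        Q ((σ.setReal a (i.eval σ) r).tick
          (i.size + k.size + R.size + s.size + O.cost + 1)) := by
  simp [Cmd.Ensures, Cmd.run]

theorem ensures_callLoss {a : ℕ} {i : NExpr} {p : RExpr} {s : NExpr} :
    (Cmd.callLoss a i p s).Ensures O Q σ ↔
      Q ((σ.setReal a (i.eval σ) (O.loss (p.eval σ) (s.eval σ))).tick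
        (i.size + p.size + s.size + 1)) := by
  simp [Cmd.Ensures, Cmd.run]

theorem ensures_seq {c d : Cmd} :
    (Cmd.seq c d).Ensures O Q σ ↔ c.Ensures O (d.Ensures O Q) σ := by
  simp only [Cmd.Ensures, Cmd.run, PMF.mem_support_bind_iff]
  exact ⟨fun h τ hτ ρ hρ => h ρ ⟨τ, hτ, hρ⟩, fun h ρ ⟨τ, hτ, hρ⟩ => h τ hτ ρ hρ⟩

theorem ensures_ite {b : Test} {c d : Cmd} :
    (Cmd.ite b c d).Ensures O Q σ ↔
      (b.holds σ → c.Ensures O Q (σ.tick (b.size + 1))) ∧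
        (¬ b.holds σ → d.Ensures O Q (σ.tick (b.size + 1))) := by
  by_cases h : b.holds σ <;> simp [Cmd.Ensures, Cmd.run, h]

theorem Cmd.Ensures.mono {c : Cmd} {Q' : State → Prop} (h : c.Ensures O Q σ)
    (h' : ∀ τ, Q τ → Q' τ) : c.Ensures O Q' σ := fun τ hτ => h' τ (h τ hτ)

theorem Cmd.Ensures.and {c : Cmd} {Q' : State → Prop} (h : c.Ensures O Q σ)
    (h' : c.Ensures O Q' σ) : c.Ensures O (fun τ => Q τ ∧ Q' τ) σ :=
  fun τ hτ => ⟨h τ hτ, h' τ hτ⟩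

theorem ensures_loop {v : ℕ} {e : NExpr} {c : Cmd} (I : ℕ → State → Prop)
    (h0 : I 0 (σ.tick (e.size + 1)))
    (hstep : ∀ i < e.eval σ, ∀ τ, I i τ → c.Ensures O (I (i + 1)) ((τ.setNat v i).tick 1)) :
    (Cmd.loop v e c).Ensures O (I (e.eval σ)) σ := by
  simp only [Cmd.Ensures, Cmd.run]
  have key : ∀ m ≤ e.eval σ, ∀ τ ∈ (Nat.rec (motive := fun _ => PMF State)
      (PMF.pure (σ.tick (e.size + 1)))
      (fun i law => law.bind fun τ => c.run O ((τ.setNat v i).tick 1)) m : PMF State).support,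
      I m τ := by
    intro m
    induction m with
    | zero => intro _ τ hτ; simp at hτ; exact hτ ▸ h0
    | succ m ih =>
      intro hm τ hτ
      simp only [PMF.mem_support_bind_iff] at hτ
      obtain ⟨ρ, hρ, hτ⟩ := hτ
      exact hstep m hm ρ (ih (by omega) ρ hρ) τ hτ
  exact key _ le_rfl

end Ensures

/-- The law of a chain that starts with the law `p` and makes the random moves `step 0`, `step 1`,
and so on. -/
def iterLaw {S : Type*} (step : ℕ → S → PMF S) (p : PMF S) : ℕ → PMF S
  | 0 => p
  | m + 1 => (iterLaw step p m).bind (step m)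

theorem iterLaw_add {S : Type*} (step : ℕ → S → PMF S) (p : PMF S) (a b : ℕ) :
    iterLaw step p (a + b) = iterLaw (fun i => step (a + i)) (iterLaw step p a) b := by
  induction b with
  | zero => rfl
  | succ b ih => rw [← add_assoc, iterLaw, iterLaw, ih]

theorem iterLaw_eq_bind {S : Type*} (step : ℕ → S → PMF S) (p : PMF S) (m : ℕ) :
    iterLaw step p m = p.bind fun s => iterLaw step (PMF.pure s) m := by
  induction m with
  | zero => exact (PMF.bind_pure p).symm
  | succ m ih => rw [iterLaw, ih, PMF.bind_bind]; rfl

theorem iterLaw_congr {S : Type*} {step step' : ℕ → S → PMF S} (p : PMF S) {m : ℕ}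
    (h : ∀ i < m, step i = step' i) : iterLaw step p m = iterLaw step' p m := by
  induction m with
  | zero => rfl
  | succ m ih => rw [iterLaw, iterLaw, ih fun i hi => h i (by omega), h m (by omega)]

/-- A loop whose body keeps the invariant `I`, and acts on the `view` of the memory by a random move,
keeps the invariant and induces a chain of such moves. -/
theorem loop_spec {S : Type*} {O : Oracle} {σ : State} {v : ℕ} {e : NExpr} {c : Cmd}
    (view : State → S) (step : ℕ → S → PMF S) (I : ℕ → State → Prop)
    (h0 : I 0 (σ.tick (e.size + 1)))
    (hstep : ∀ i < e.eval σ, ∀ τ, I i τ → c.Ensures O (I (i + 1)) ((τ.setNat v i).tick 1) ∧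
      (c.run O ((τ.setNat v i).tick 1)).map view = step i (view τ)) :
    (Cmd.loop v e c).Ensures O (I (e.eval σ)) σ ∧ ((Cmd.loop v e c).run O σ).map view =
      iterLaw step (PMF.pure (view (σ.tick (e.size + 1)))) (e.eval σ) := by
  refine ⟨ensures_loop I h0 fun i hi τ hτ => (hstep i hi τ hτ).1, ?_⟩
  simp only [Cmd.run]
  have key : ∀ m ≤ e.eval σ, ∀ law : PMF State, law = (Nat.rec (motive := fun _ => PMF State)
      (PMF.pure (σ.tick (e.size + 1)))
      (fun i law => law.bind fun τ => c.run O ((τ.setNat v i).tick 1)) m : PMF State) →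
      (∀ τ ∈ law.support, I m τ) ∧
      law.map view = iterLaw step (PMF.pure (view (σ.tick (e.size + 1)))) m := by
    intro m
    induction m with
    | zero =>
      rintro _ law rfl
      refine ⟨fun τ hτ => ?_, PMF.pure_map _ _⟩
      simp at hτ
      exact hτ ▸ h0
    | succ m ih =>
      rintro hm law rfl
      obtain ⟨ih1, ih2⟩ := ih (by omega) _ rfl
      constructor
      · intro τ hτ
        simp only [PMF.mem_support_bind_iff] at hτ
        obtain ⟨ρ, hρ, hτ⟩ := hτ
        exact (hstep m hm ρ (ih1 ρ hρ)).1 τ hτ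
      · simp only [PMF.map_bind]
        rw [iterLaw, ← ih2, PMF.bind_map]
        exact bind_congr_support _ fun ρ hρ => (hstep m hm ρ (ih1 ρ hρ)).2
  exact (key _ le_rfl _ rfl).2

/-- The program does not assign to the integer variable `v`. -/
def Cmd.KeepsNat (v : ℕ) : Cmd → Prop
  | skip => True
  | setNat w _ => v ≠ w
  | setReal _ _ _ => True
  | coin w _ => v ≠ w
  | callSub _ _ _ _ _ => True
  | callLoss _ _ _ _ => True
  | seq c d => c.KeepsNat v ∧ d.KeepsNat v
  | ite _ c d => c.KeepsNat v ∧ d.KeepsNat v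
  | loop w _ c => v ≠ w ∧ c.KeepsNat v

/-- The program does not write into the array `a`. -/
def Cmd.KeepsArr (a : ℕ) : Cmd → Prop
  | skip => True
  | setNat _ _ => True
  | setReal b _ _ => a ≠ b
  | coin _ _ => True
  | callSub b _ _ _ _ => a ≠ b
  | callLoss b _ _ _ => a ≠ b
  | seq c d => c.KeepsArr a ∧ d.KeepsArr a
  | ite _ c d => c.KeepsArr a ∧ d.KeepsArr a
  | loop _ _ c => c.KeepsArr a

theorem ensures_nat_eq {O : Oracle} {v : ℕ} (c : Cmd) (h : c.KeepsNat v) (σ : State) :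
    c.Ensures O (fun τ => τ.nat v = σ.nat v) σ := by
  induction c generalizing σ with
  | skip => simp [ensures_skip]
  | setNat w e =>
    have h : v ≠ w := h
    simp [ensures_setNat, State.setNat, State.tick, h]
  | setReal b i e => simp [ensures_setReal, State.setReal, State.tick]
  | coin w p =>
    have h : v ≠ w := h
    exact ensures_coin fun m => by simp [State.setNat, State.tick, h]
  | callSub b i k R s => simp [ensures_callSub, State.setReal, State.tick]
  | callLoss b i p s => simp [ensures_callLoss, State.setReal, State.tick]
  | seq c d ihc ihd =>
    rw [ensures_seq]
    exact (ihc h.1 σ).mono fun τ hτ => (ihd h.2 τ).mono fun ρ hρ => hρ.trans hτ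
  | ite b c d ihc ihd =>
    rw [ensures_ite]
    exact ⟨fun _ => ihc h.1 _, fun _ => ihd h.2 _⟩
  | loop w e c ih =>
    refine ensures_loop (fun _ τ => τ.nat v = σ.nat v) rfl fun i _ τ hτ => ?_
    refine (ih h.2 _).mono fun ρ hρ => hρ.trans ?_
    have h : v ≠ w := h.1
    simp [State.setNat, State.tick, h, hτ]

theorem ensures_arr_eq {O : Oracle} {a : ℕ} (c : Cmd) (h : c.KeepsArr a) (σ : State) :
    c.Ensures O (fun τ => τ.arr a = σ.arr a) σ := by
  induction c generalizing σ with
  | skip => simp [ensures_skip]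
  | setNat w e => simp [ensures_setNat, State.setNat, State.tick]
  | setReal b i e =>
    have h : a ≠ b := h
    simp [ensures_setReal, State.setReal, State.tick, h]
  | coin w p => exact ensures_coin fun m => by simp [State.setNat, State.tick]
  | callSub b i k R s =>
    have h : a ≠ b := h
    simp [ensures_callSub, State.setReal, State.tick, h]
  | callLoss b i p s =>
    have h : a ≠ b := h
    simp [ensures_callLoss, State.setReal, State.tick, h]
  | seq c d ihc ihd =>
    rw [ensures_seq]
    exact (ihc h.1 σ).mono fun τ hτ => (ihd h.2 τ).mono fun ρ hρ => hρ.trans hτ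
  | ite b c d ihc ihd =>
    rw [ensures_ite]
    exact ⟨fun _ => ihc h.1 _, fun _ => ihd h.2 _⟩
  | loop w e c ih =>
    refine ensures_loop (fun _ τ => τ.arr a = σ.arr a) rfl fun i _ τ hτ => ?_
    exact (ih h _).mono fun ρ hρ => hρ.trans hτ

/-! ### Programs with protected loop bounds run in polynomial time -/

/-- The expression mentions only the integer variables `0`, `1`, `2`. -/
def NExpr.Protected : NExpr → Prop
  | lit _ => True
  | var v => v < 3
  | plus a b => a.Protected ∧ b.Protected
  | minus a b => a.Protected ∧ b.Protected

/-- The program never assigns to the integer variables `0`, `1`, `2`, and the lengths of its loops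
depend on them alone. -/
def Cmd.Protected : Cmd → Prop
  | skip => True
  | setNat v _ => 3 ≤ v
  | setReal _ _ _ => True
  | coin v _ => 3 ≤ v
  | callSub _ _ _ _ _ => True
  | callLoss _ _ _ _ => True
  | seq c d => c.Protected ∧ d.Protected
  | ite _ c d => c.Protected ∧ d.Protected
  | loop v e c => 3 ≤ v ∧ e.Protected ∧ c.Protected

theorem Cmd.Protected.keepsNat {c : Cmd} (h : c.Protected) {v : ℕ} (hv : v < 3) :
    c.KeepsNat v := by
  induction c with
  | skip | setReal | callSub | callLoss => trivial
  | setNat w e => have : 3 ≤ w := h; exact (by omega : v ≠ w)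
  | coin w p => have : 3 ≤ w := h; exact (by omega : v ≠ w)
  | seq c d ihc ihd => exact ⟨ihc h.1, ihd h.2⟩
  | ite b c d ihc ihd => exact ⟨ihc h.1, ihd h.2⟩
  | loop w e c ih => have : 3 ≤ w := h.1; exact ⟨by omega, ih h.2.2⟩

/-- The size of the input as far as it bounds the lengths of loops. -/
def State.inputSize (σ : State) : ℕ := σ.nat 0 + σ.nat 1 + σ.nat 2 + 2

theorem State.two_le_inputSize (σ : State) : 2 ≤ σ.inputSize := by
  unfold State.inputSize; omega

theorem exists_le_two_pow (m : ℕ) : ∃ d, ∀ S : ℕ, 2 ≤ S → m ≤ S ^ d :=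
  ⟨m, fun _ hS => (Nat.lt_two_pow_self).le.trans (Nat.pow_le_pow_left hS m)⟩

theorem pow_add_pow_le {S a b : ℕ} (hS : 2 ≤ S) : S ^ a + S ^ b ≤ S ^ (a + b + 1) := by
  have h1 : S ^ a ≤ S ^ (a + b) := Nat.pow_le_pow_right (by omega) (by omega)
  have h2 : S ^ b ≤ S ^ (a + b) := Nat.pow_le_pow_right (by omega) (by omega)
  have h3 := Nat.mul_le_mul_left (S ^ (a + b)) hS
  rw [pow_succ]
  omega

theorem NExpr.Protected.exists_eval_le {e : NExpr} (h : e.Protected) :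
    ∃ d, ∀ σ : State, e.eval σ ≤ σ.inputSize ^ d := by
  induction e with
  | lit m =>
    obtain ⟨d, hd⟩ := exists_le_two_pow m
    exact ⟨d, fun σ => hd _ σ.two_le_inputSize⟩
  | var v =>
    have h : v < 3 := h
    refine ⟨1, fun σ => ?_⟩
    simp only [NExpr.eval, State.inputSize, pow_one]
    interval_cases v <;> omega
  | plus a b iha ihb =>
    obtain ⟨d1, h1⟩ := iha h.1
    obtain ⟨d2, h2⟩ := ihb h.2
    exact ⟨d1 + d2 + 1, fun σ =>
      (add_le_add (h1 σ) (h2 σ)).trans (pow_add_pow_le σ.two_le_inputSize)⟩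
  | minus a b iha ihb =>
    obtain ⟨d1, h1⟩ := iha h.1
    exact ⟨d1, fun σ => (Nat.sub_le _ _).trans (h1 σ)⟩

/-- A single command whose cost is at most `m`, not counting the time of an oracle call, fits into
a power of the input size. -/
theorem exists_cost_le (m : ℕ) :
    ∃ d, ∀ S T : ℕ, 2 ≤ S → m + T ≤ S ^ d * (T + 1) := by
  obtain ⟨d, hd⟩ := exists_le_two_pow (m + 1)
  refine ⟨d, fun S T hS => ?_⟩
  have := hd S hS
  nlinarith

theorem Cmd.Protected.exists_steps_le {c : Cmd} (h : c.Protected) :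
    ∃ d, ∀ (O : Oracle) (σ : State),
      c.Ensures O (fun τ => τ.steps ≤ σ.steps + σ.inputSize ^ d * (O.cost + 1)) σ := by
  have hsize : ∀ {c : Cmd}, c.Protected → ∀ (O : Oracle) (σ : State),
      c.Ensures O (fun τ => τ.inputSize = σ.inputSize) σ := by
    intro c hc O σ
    refine (((ensures_nat_eq c (hc.keepsNat (v := 0) (by omega)) σ).and
      (ensures_nat_eq c (hc.keepsNat (v := 1) (by omega)) σ)).and
      (ensures_nat_eq c (hc.keepsNat (v := 2) (by omega)) σ)).mono ?_
    rintro τ ⟨⟨h0, h1⟩, h2⟩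
    simp only [State.inputSize, h0, h1, h2]
  have hatom : ∀ m : ℕ, ∃ d, ∀ (O : Oracle) (σ : State),
      σ.steps + m + O.cost ≤ σ.steps + σ.inputSize ^ d * (O.cost + 1) := by
    intro m
    obtain ⟨d, hd⟩ := exists_cost_le m
    refine ⟨d, fun O σ => ?_⟩
    have := hd σ.inputSize O.cost σ.two_le_inputSize
    omega
  induction c with
  | skip => exact ⟨0, fun O σ => ensures_skip.2 (by omega)⟩
  | setNat v e =>
    obtain ⟨d, hd⟩ := hatom (e.size + 1)
    refine ⟨d, fun O σ => ensures_setNat.2 ?_⟩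
    have := hd O σ
    simp only [State.setNat, State.tick]
    omega
  | setReal a i e =>
    obtain ⟨d, hd⟩ := hatom (i.size + e.size + 1)
    refine ⟨d, fun O σ => ensures_setReal.2 ?_⟩
    have := hd O σ
    simp only [State.setReal, State.tick]
    omega
  | coin v p =>
    obtain ⟨d, hd⟩ := hatom (p.size + 1)
    refine ⟨d, fun O σ => ensures_coin fun m => ?_⟩
    have := hd O σ
    simp only [State.setNat, State.tick]
    omega
  | callSub a i k R s =>
    obtain ⟨d, hd⟩ := hatom (i.size + k.size + R.size + s.size + 1)
    refine ⟨d, fun O σ => ensures_callSub.2 fun r _ => ?_⟩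
    have := hd O σ
    simp only [State.setReal, State.tick]
    omega
  | callLoss a i p s =>
    obtain ⟨d, hd⟩ := hatom (i.size + p.size + s.size + 1)
    refine ⟨d, fun O σ => ensures_callLoss.2 ?_⟩
    have := hd O σ
    simp only [State.setReal, State.tick]
    omega
  | seq c d ihc ihd =>
    obtain ⟨d1, h1⟩ := ihc h.1
    obtain ⟨d2, h2⟩ := ihd h.2
    refine ⟨d1 + d2 + 1, fun O σ => ensures_seq.2 ?_⟩
    refine ((h1 O σ).and (hsize h.1 O σ)).mono fun τ hτ => (h2 O τ).mono fun ρ hρ => ?_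
    rw [hτ.2] at hρ
    have h3 := Nat.mul_le_mul_right (O.cost + 1)
      (pow_add_pow_le (a := d1) (b := d2) σ.two_le_inputSize)
    have := hτ.1
    rw [add_mul] at h3
    omega
  | ite b c d ihc ihd =>
    obtain ⟨d1, h1⟩ := ihc h.1
    obtain ⟨d2, h2⟩ := ihd h.2
    obtain ⟨d0, h0⟩ := hatom (b.size + 1)
    refine ⟨d0 + (d1 + d2) + 1, fun O σ => ensures_ite.2 ?_⟩
    have hS := σ.two_le_inputSize
    have h3 := Nat.mul_le_mul_right (O.cost + 1)
      (pow_add_pow_le (a := d0) (b := d1 + d2) hS)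
    have h4 := Nat.mul_le_mul_right (O.cost + 1)
      (Nat.pow_le_pow_right (n := σ.inputSize) (by omega) (by omega : d1 ≤ d1 + d2))
    have h5 := Nat.mul_le_mul_right (O.cost + 1)
      (Nat.pow_le_pow_right (n := σ.inputSize) (by omega) (by omega : d2 ≤ d1 + d2))
    have h6 := h0 O σ
    rw [add_mul] at h3
    refine ⟨fun _ => (h1 O _).mono fun τ hτ => ?_, fun _ => (h2 O _).mono fun τ hτ => ?_⟩ <;>
    · simp only [State.tick, State.inputSize] at hτ h3 h4 h5 h6 ⊢
      omega
  | loop v e c ih =>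
    obtain ⟨d1, h1⟩ := ih h.2.2
    obtain ⟨d2, h2⟩ := h.2.1.exists_eval_le
    obtain ⟨d0, h0⟩ := hatom (e.size + 1)
    refine ⟨d0 + (d2 + (d1 + 1)) + 1, fun O σ => ?_⟩
    have hv : 3 ≤ v := h.1
    refine (ensures_loop (fun i τ => τ.inputSize = σ.inputSize ∧ τ.steps ≤
      σ.steps + (e.size + 1) + i * (1 + σ.inputSize ^ d1 * (O.cost + 1))) ⟨rfl, ?_⟩ ?_).mono ?_
    · simp [State.tick]
    · rintro i - τ ⟨hτ1, hτ2⟩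
      have hin : ((τ.setNat v i).tick 1).inputSize = σ.inputSize := by
        rw [← hτ1]
        simp only [State.inputSize, State.setNat, State.tick]
        simp only [Function.update_of_ne (show (0 : ℕ) ≠ v by omega),
          Function.update_of_ne (show (1 : ℕ) ≠ v by omega),
          Function.update_of_ne (show (2 : ℕ) ≠ v by omega)]
      refine ((h1 O _).and (hsize h.2.2 O _)).mono fun ρ hρ => ?_
      rw [hin] at hρ
      refine ⟨hρ.2, ?_⟩
      have := hρ.1
      simp only [State.setNat, State.tick] at this
      rw [add_mul]
      omega
    · rintro τ ⟨-, hτ⟩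
      refine hτ.trans ?_
      have hS := σ.two_le_inputSize
      have h3 := Nat.mul_le_mul_right (O.cost + 1)
        (pow_add_pow_le (a := d0) (b := d2 + (d1 + 1)) hS)
      have h4 := h0 O σ
      have h5 : 1 + σ.inputSize ^ d1 * (O.cost + 1) ≤ σ.inputSize ^ (d1 + 1) * (O.cost + 1) := by
        have h6 : 1 ≤ σ.inputSize ^ d1 * (O.cost + 1) :=
          Nat.mul_pos (Nat.pow_pos (by omega)) (by omega)
        have h7 := Nat.mul_le_mul_left (σ.inputSize ^ d1 * (O.cost + 1)) hS
        rw [pow_succ, mul_right_comm]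
        omega
      have h6 : e.eval σ * (1 + σ.inputSize ^ d1 * (O.cost + 1)) ≤
          σ.inputSize ^ (d2 + (d1 + 1)) * (O.cost + 1) := by
        rw [pow_add, mul_assoc]
        exact Nat.mul_le_mul (h2 σ) h5
      rw [add_mul] at h3
      omega

/-! ### Sequential composition and loops over the experts -/

theorem run_seq_map {S S' : Type*} {O : Oracle} {σ : State} {c d : Cmd} {Q : State → Prop}
    (view : State → S) (view' : State → S') (f : S → PMF S') (hc : c.Ensures O Q σ)
    (hd : ∀ τ, Q τ → (d.run O τ).map view' = f (view τ)) :
    ((Cmd.seq c d).run O σ).map view' = ((c.run O σ).map view).bind f := by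
  simp only [Cmd.run, PMF.map_bind]
  rw [PMF.bind_map]
  exact bind_congr_support _ fun τ hτ => hd τ (hc τ hτ)

theorem run_seq_map_const {S' : Type*} {O : Oracle} {σ : State} {c d : Cmd} {Q : State → Prop}
    (view' : State → S') (p : PMF S') (hc : c.Ensures O Q σ)
    (hd : ∀ τ, Q τ → (d.run O τ).map view' = p) :
    ((Cmd.seq c d).run O σ).map view' = p := by
  rw [run_seq_map (fun _ => ()) view' (fun _ => p) hc hd, PMF.bind_const]

/-- Run `body` for all pairs of a class number `k < N` and an exponent `i ≤ n`, which are kept in the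
integer variables `vk` and `vi`; the variable `vj` holds the number `k * (n + 1) + i` of the
pair. -/
def forExperts (vk vi vj : ℕ) (body : Cmd) : Cmd :=
  .seq (.setNat vj (.lit 0))
    (.loop vk (.var 1) (.loop vi (.plus (.var 0) (.lit 1))
      (.seq body (.setNat vj (.plus (.var vj) (.lit 1))))))

theorem iterLaw_block {S : Type*} (step : ℕ → S → PMF S) (p : PMF S) (b m : ℕ) :
    iterLaw (fun k s => iterLaw (fun i => step (k * b + i)) (PMF.pure s) b) p m =
      iterLaw step p (m * b) := by
  induction m with
  | zero => rw [zero_mul]; rfl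
  | succ m ih => rw [iterLaw, ih, Nat.succ_mul, iterLaw_add, ← iterLaw_eq_bind]

/-- The rule for loops over the experts. The invariant `I` refers to the arrays only; variables and
arrays that the body does not write to are known to keep their values. -/
theorem forExperts_spec {S : Type*} {O : Oracle} {σ : State} {n N vk vi vj : ℕ} {body : Cmd}
    (hn : σ.nat 0 = n) (hN : σ.nat 1 = N)
    (hv : vk ≠ vi ∧ vk ≠ vj ∧ vi ≠ vj ∧ 2 < vk ∧ 2 < vi ∧ 2 < vj)
    (hb : body.KeepsNat 0 ∧ body.KeepsNat 1 ∧ body.KeepsNat vk ∧ body.KeepsNat vi ∧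
      body.KeepsNat vj)
    (view : (ℕ → ℕ → ℝ) → S) (step : ℕ → S → PMF S) (I : ℕ → (ℕ → ℕ → ℝ) → Prop)
    (h0 : I 0 σ.arr)
    (hstep : ∀ k < N, ∀ i < n + 1, ∀ τ : State, τ.nat vk = k → τ.nat vi = i →
      τ.nat vj = k * (n + 1) + i →
      (∀ v, v ≠ vk → v ≠ vi → v ≠ vj → body.KeepsNat v → τ.nat v = σ.nat v) →
      (∀ a, body.KeepsArr a → τ.arr a = σ.arr a) → I (k * (n + 1) + i) τ.arr →
      body.Ensures O (fun ρ => I (k * (n + 1) + i + 1) ρ.arr) τ ∧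
        (body.run O τ).map (fun ρ => view ρ.arr) = step (k * (n + 1) + i) (view τ.arr)) :
    (forExperts vk vi vj body).Ensures O (fun τ => I (N * (n + 1)) τ.arr) σ ∧
      ((forExperts vk vi vj body).run O σ).map (fun ρ => view ρ.arr) =
        iterLaw step (PMF.pure (view σ.arr)) (N * (n + 1)) := by
  obtain ⟨hki, hkj, hij, hk2, hi2, hj2⟩ := hv
  obtain ⟨hb0, hb1, hbk, hbi, hbj⟩ := hb
  let J : ℕ → State → Prop := fun j τ => I j τ.arr ∧ τ.nat vj = j ∧
    (∀ v, v ≠ vk → v ≠ vi → v ≠ vj → body.KeepsNat v → τ.nat v = σ.nat v) ∧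
    (∀ a, body.KeepsArr a → τ.arr a = σ.arr a)
  -- one run of the body, followed by the increment of the counter
  have hbody : ∀ k < N, ∀ i < n + 1, ∀ τ : State, J (k * (n + 1) + i) τ → τ.nat vk = k →
      (Cmd.seq body (.setNat vj (.plus (.var vj) (.lit 1)))).Ensures O
        (fun ρ => J (k * (n + 1) + i + 1) ρ ∧ ρ.nat vk = k) ((τ.setNat vi i).tick 1) ∧
      ((Cmd.seq body (.setNat vj (.plus (.var vj) (.lit 1)))).run O
        ((τ.setNat vi i).tick 1)).map (fun ρ => view ρ.arr) =
        step (k * (n + 1) + i) (view τ.arr) := by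
    rintro k hk i hi τ ⟨hI, hj, hnat, harr⟩ hτk
    set τ' := (τ.setNat vi i).tick 1 with hτ'
    have e1 : τ'.nat vk = k := by simp [hτ', State.setNat, State.tick, hki, hτk]
    have e2 : τ'.nat vi = i := by simp [hτ', State.setNat, State.tick]
    have e3 : τ'.nat vj = k * (n + 1) + i := by
      simp [hτ', State.setNat, State.tick, hij.symm, hj]
    have e4 : ∀ v, v ≠ vk → v ≠ vi → v ≠ vj → body.KeepsNat v → τ'.nat v = σ.nat v := by
      intro v h1 h2 h3 h4
      rw [← hnat v h1 h2 h3 h4]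
      simp [hτ', State.setNat, State.tick, h2]
    obtain ⟨s1, s2⟩ := hstep k hk i hi τ' e1 e2 e3 e4 harr hI
    constructor
    · rw [ensures_seq]
      refine (fun ρ hρ => ?_ : body.Ensures O _ τ')
      have f1 := s1 ρ hρ
      have fk := ensures_nat_eq body hbk τ' ρ hρ
      have fj := ensures_nat_eq body hbj τ' ρ hρ
      rw [ensures_setNat]
      refine ⟨⟨f1, ?_, ?_, ?_⟩, ?_⟩
      · simp [State.setNat, State.tick, NExpr.eval, fj, e3]
      · intro v h1 h2 h3 h4
        rw [← e4 v h1 h2 h3 h4, ← ensures_nat_eq body h4 τ' ρ hρ]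
        simp [State.setNat, State.tick, h3]
      · intro a ha
        exact (ensures_arr_eq body ha τ' ρ hρ).trans (harr a ha)
      · simp [State.setNat, State.tick, hkj, fk, e1]
    · have : (Cmd.seq body (.setNat vj (.plus (.var vj) (.lit 1)))).run O τ' =
          (body.run O τ').map fun ρ =>
            (ρ.setNat vj (NExpr.eval ρ (.plus (.var vj) (.lit 1)))).tick
              (NExpr.size (.plus (.var vj) (.lit 1)) + 1) := by
        simp only [Cmd.run]
        rw [← PMF.bind_pure_comp]
        rfl
      rw [this, PMF.map_comp]
      exact s2
  -- the loop over the exponents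
  have hinner : ∀ k < N, ∀ τ : State, J (k * (n + 1)) τ →
      (Cmd.loop vi (.plus (.var 0) (.lit 1))
        (.seq body (.setNat vj (.plus (.var vj) (.lit 1))))).Ensures O
        (J ((k + 1) * (n + 1))) ((τ.setNat vk k).tick 1) ∧
      ((Cmd.loop vi (.plus (.var 0) (.lit 1))
        (.seq body (.setNat vj (.plus (.var vj) (.lit 1))))).run O
        ((τ.setNat vk k).tick 1)).map (fun ρ => view ρ.arr) =
        iterLaw (fun i => step (k * (n + 1) + i)) (PMF.pure (view τ.arr)) (n + 1) := by
    rintro k hk τ ⟨hI, hj, hnat, harr⟩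
    have ev : NExpr.eval ((τ.setNat vk k).tick 1) (.plus (.var 0) (.lit 1)) = n + 1 := by
      have := hnat 0 (by omega) (by omega) (by omega) hb0
      simp [NExpr.eval, State.setNat, State.tick, show (0 : ℕ) ≠ vk by omega, this, hn]
    have := loop_spec (O := O) (σ := (τ.setNat vk k).tick 1) (v := vi)
      (e := .plus (.var 0) (.lit 1)) (c := .seq body (.setNat vj (.plus (.var vj) (.lit 1))))
      (fun ρ => view ρ.arr) (fun i => step (k * (n + 1) + i))
      (fun i ρ => J (k * (n + 1) + i) ρ ∧ ρ.nat vk = k) ?_ ?_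
    · rw [ev] at this
      refine ⟨this.1.mono fun ρ hρ => ?_, this.2⟩
      rw [Nat.succ_mul]
      exact hρ.1
    · refine ⟨⟨hI, ?_, ?_, harr⟩, ?_⟩
      · simp [State.setNat, State.tick, hkj.symm, hj]
      · intro v h1 h2 h3 h4
        rw [← hnat v h1 h2 h3 h4]
        simp [State.setNat, State.tick, h1]
      · simp [State.setNat, State.tick]
    · rintro i hi ρ ⟨hJ, hρk⟩
      rw [ev] at hi
      exact hbody k hk i hi ρ hJ hρk
  have houter := loop_spec (O := O)
    (σ := (σ.setNat vj 0).tick 2) (v := vk) (e := .var 1)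
    (c := .loop vi (.plus (.var 0) (.lit 1)) (.seq body (.setNat vj (.plus (.var vj) (.lit 1)))))
    (fun ρ => view ρ.arr)
    (fun k s => iterLaw (fun i => step (k * (n + 1) + i)) (PMF.pure s) (n + 1))
    (fun k => J (k * (n + 1))) ?_ ?_
  · have ev : NExpr.eval ((σ.setNat vj 0).tick 2) (.var 1) = N := by
      simp [NExpr.eval, State.setNat, State.tick, show (1 : ℕ) ≠ vj by omega, hN]
    rw [ev, iterLaw_block] at houter
    constructor
    · rw [forExperts, ensures_seq, ensures_setNat]
      exact houter.1.mono fun τ hτ => hτ.1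
    · rw [forExperts, Cmd.run, Cmd.run, PMF.pure_bind]
      exact houter.2
  · refine ⟨by simpa [State.setNat, State.tick] using h0, ?_, ?_, fun a _ => rfl⟩
    · simp [State.setNat, State.tick]
    · intro v h1 h2 h3 h4
      simp [State.setNat, State.tick, h3]
  · intro k hk τ hJ
    have ev : NExpr.eval ((σ.setNat vj 0).tick 2) (.var 1) = N := by
      simp [NExpr.eval, State.setNat, State.tick, show (1 : ℕ) ≠ vj by omega, hN]
    rw [ev] at hk
    exact hinner k hk τ hJ

theorem forExperts_ensures {O : Oracle} {σ : State} {n N vk vi vj : ℕ} {body : Cmd}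
    (hn : σ.nat 0 = n) (hN : σ.nat 1 = N)
    (hv : vk ≠ vi ∧ vk ≠ vj ∧ vi ≠ vj ∧ 2 < vk ∧ 2 < vi ∧ 2 < vj)
    (hb : body.KeepsNat 0 ∧ body.KeepsNat 1 ∧ body.KeepsNat vk ∧ body.KeepsNat vi ∧
      body.KeepsNat vj)
    (I : ℕ → (ℕ → ℕ → ℝ) → Prop) (h0 : I 0 σ.arr)
    (hstep : ∀ k < N, ∀ i < n + 1, ∀ τ : State, τ.nat vk = k → τ.nat vi = i →
      τ.nat vj = k * (n + 1) + i →
      (∀ v, v ≠ vk → v ≠ vi → v ≠ vj → body.KeepsNat v → τ.nat v = σ.nat v) →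
      (∀ a, body.KeepsArr a → τ.arr a = σ.arr a) → I (k * (n + 1) + i) τ.arr →
      body.Ensures O (fun ρ => I (k * (n + 1) + i + 1) ρ.arr) τ) :
    (forExperts vk vi vj body).Ensures O (fun τ => I (N * (n + 1)) τ.arr) σ :=
  (forExperts_spec hn hN hv hb (fun _ => ()) (fun _ _ => PMF.pure ()) I h0
    fun k hk i hi τ h1 h2 h3 h4 h5 h6 =>
      ⟨hstep k hk i hi τ h1 h2 h3 h4 h5 h6, PMF.map_const _ _⟩).1

open Finset

/-! ### The multi-scale algorithm -/

/-- The total stake on the experts of scale at least `y`. -/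
def massFrom (K : ℕ) (c w : ℕ → ℝ) (y : ℝ) : ℝ := ∑ j ∈ range K, if c j < y then 0 else w j

/-- The largest of the scales `y` of the first `m` experts for which the stakes on the scales from
`y` upwards exceed `1`, and `0` if there is none. -/
def thresholdUpTo (K : ℕ) (c w : ℕ → ℝ) : ℕ → ℝ
  | 0 => 0
  | m + 1 =>
    if 1 < massFrom K c w (c m) then
      if thresholdUpTo K c w m < c m then c m else thresholdUpTo K c w m
    else thresholdUpTo K c w m

/-- The scale at which the stakes `w` are cut off so that they sum up to at most `1`. -/
def threshold (K : ℕ) (c w : ℕ → ℝ) : ℝ := thresholdUpTo K c w K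

/-- The total stake above the cut-off scale. -/
def massAbove (K : ℕ) (c w : ℕ → ℝ) (y : ℝ) : ℝ := ∑ j ∈ range K, if y < c j then w j else 0

/-- The total stake at the cut-off scale. -/
def massAt (K : ℕ) (c w : ℕ → ℝ) (y : ℝ) : ℝ :=
  ∑ j ∈ range K, if y < c j then 0 else if c j < y then 0 else w j

/-- The probability of expert `j`: the stakes above the cut-off scale are kept, those below it
are dropped, and those at this scale share the remaining mass. -/
def playProb (K : ℕ) (c w : ℕ → ℝ) (j : ℕ) : ℝ :=
  if threshold K c w < c j then w j
  else if c j < threshold K c w then 0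
  else w j * (1 - massAbove K c w (threshold K c w)) / massAt K c w (threshold K c w)

/-- The update of the wealth of expert `j`, whose prediction has the law `D`, under the loss
`loss` and with the cut-off scale `y`. -/
def wealthStep (c β : ℕ → ℝ) (D : ℕ → PMF ℝ) (loss : ℝ → ℝ) (y : ℝ) (j : ℕ) (V : ℕ → ℝ) :
    PMF (ℕ → ℝ) :=
  (D j).map fun v => Function.update V j (V j * (1 - β j * (loss v - loss 0 + min (c j) y)))

/-- The stakes of the experts with wealth `W`. -/
def stake (β W : ℕ → ℝ) (j : ℕ) : ℝ := β j * W j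

/-- The law of the wealth after a round that starts with the wealth `W`. -/
def roundStep (K : ℕ) (c β : ℕ → ℝ) (D : ℕ → PMF ℝ) (loss : ℝ → ℝ) (W : ℕ → ℝ) : PMF (ℕ → ℝ) :=
  iterLaw (wealthStep c β D loss (threshold K c (stake β W))) (PMF.pure W) K

/-- The law of the prediction of an expert drawn with the probabilities `x`, and of `0` with the
remaining probability. The draw is done by reservoir sampling: the choice made among the first
experts is replaced by expert `j` with the conditional probability of `j`. -/
def mixture (K : ℕ) (D : ℕ → PMF ℝ) (x : ℕ → ℝ) : PMF ℝ :=
  iterLaw (fun j o =>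
    (biasedCoin (x j / (1 - ∑ l ∈ range K, x l + ∑ l ∈ range (j + 1), x l))).bind fun b =>
      if b then D j else PMF.pure o) (PMF.pure 0) K

/-- The radius of expert `j`. -/
def radius (n j : ℕ) : ℝ := 2 ^ (j % (n + 1))

/-- The scale of expert `j`, which bounds its losses relative to the prediction `0`. -/
def scale (n : ℕ) (L : ℝ) (b : ℕ → ℝ) (j : ℕ) : ℝ := L * (b (j / (n + 1)) * radius n j)

/-- The complexity of expert `j`. -/
def complexity (n : ℕ) (L : ℝ) (b : ℕ → ℝ) (j : ℕ) : ℝ :=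
  Real.log (scale n L b j * ((j / (n + 1) : ℕ) + 1) * n)

/-- The fraction of its wealth that expert `j` stakes in each round. -/
def rate (n : ℕ) (L : ℝ) (b : ℕ → ℝ) (j : ℕ) : ℝ :=
  √(complexity n L b j / (n + complexity n L b j)) / (4 * scale n L b j)

/-- The initial wealth of expert `j`. -/
def prior (n j : ℕ) : ℝ :=
  1 / ((((j / (n + 1) : ℕ) + 1) * ((j / (n + 1) : ℕ) + 2)) * radius n j)

/-- The laws of the predictions of the experts in round `s`. -/
def expertLaw (O : Oracle) (n s j : ℕ) : PMF ℝ := O.sub (j / (n + 1)) (radius n j) s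

/-- The law of the wealth before round `t`. -/
def wealthLaw (n N : ℕ) (L : ℝ) (b : ℕ → ℝ) (O : Oracle) (t : ℕ) : PMF (ℕ → ℝ) :=
  iterLaw (fun s => roundStep (N * (n + 1)) (scale n L b) (rate n L b) (expertLaw O n s)
    (fun v => O.loss v s))
    (PMF.pure fun j => if j < N * (n + 1) then prior n j else 0) t

/-- The law of the prediction in round `t`. -/
def predictionLaw (n N : ℕ) (L : ℝ) (b : ℕ → ℝ) (O : Oracle) (t : ℕ) : PMF ℝ :=
  (wealthLaw n N L b O t).bind fun W => mixture (N * (n + 1)) (expertLaw O n t)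
    (playProb (N * (n + 1)) (scale n L b) (stake (rate n L b) W))

/-! ### The program

The integer variables `3, 4, 5` and `6, 7, 8` run over the experts, `9` over the past rounds, and
`10` holds the result of a coin. The arrays `3`, `4`, `5` hold wealths, scales and rates, and `10`
the probabilities of the experts; the other arrays hold scalars in their entry `0`: the prediction
(`2`), the cut-off scale (`6`), partial sums (`7`, `8`, `9`, `11`), a prediction of an expert (`12`),
its loss (`13`), the loss of `0` (`14`), the minimum of a scale and the cut-off scale (`15`). -/

/-- The number `r` as an expression. -/
def RExpr.num (r : ℕ) : RExpr := .cast (.lit r)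

/-- The scalar kept in the array `a`. -/
def RExpr.scalar (a : ℕ) : RExpr := .get a (.lit 0)

/-- The radius `2 ^ i`, with `i` in the integer variable `vi`. -/
def RExpr.radius (vi : ℕ) : RExpr := .exp (.times (.cast (.var vi)) (.log (.num 2)))

/-- The stake on the expert whose number is in the integer variable `vj`. -/
def RExpr.stake (vj : ℕ) : RExpr := .times (.get 5 (.var vj)) (.get 3 (.var vj))

/-- The product of a scale, a class number counted from one, and the horizon, whose logarithm is
the complexity of an expert. -/
def RExpr.complexity : RExpr :=
  .log (.times (.times (.get 4 (.var 5)) (.plus (.cast (.var 3)) (.num 1))) (.cast (.var 0)))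

/-- Write into the scalar kept in the array `a`. -/
def Cmd.setScalar (a : ℕ) (e : RExpr) : Cmd := .setReal a (.lit 0) e

/-- Compute the scales, rates and initial wealths. -/
def setup : Cmd :=
  forExperts 3 4 5
    (.seq (.setReal 4 (.var 5) (.times (.scalar 0) (.times (.get 1 (.var 3)) (.radius 4))))
    (.seq (.setReal 5 (.var 5)
      (.div (.sqrt (.div .complexity (.plus (.cast (.var 0)) .complexity)))
        (.times (.num 4) (.get 4 (.var 5)))))
    (.setReal 3 (.var 5) (.div (.num 1)
      (.times (.times (.plus (.cast (.var 3)) (.num 1)) (.plus (.cast (.var 3)) (.num 2)))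
        (.radius 4))))))

/-- Add up the stakes on all experts whose scale is at least that of the current one. -/
def computeMass : Cmd :=
  .seq (.setScalar 7 (.num 0))
    (forExperts 6 7 8 (.ite (.ltReal (.get 4 (.var 8)) (.get 4 (.var 5))) .skip
      (.setScalar 7 (.plus (.scalar 7) (.stake 8)))))

/-- Compute the cut-off scale. -/
def computeThreshold : Cmd :=
  .seq (.setScalar 6 (.num 0))
    (forExperts 3 4 5 (.seq computeMass
      (.ite (.ltReal (.num 1) (.scalar 7))
        (.ite (.ltReal (.scalar 6) (.get 4 (.var 5))) (.setScalar 6 (.get 4 (.var 5))) .skip)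
        .skip)))

/-- Play round `9` with the current expert, and update its wealth. -/
def updateWealth : Cmd :=
  .seq (.callSub 12 (.lit 0) (.var 3) (.radius 4) (.var 9))
    (.seq (.callLoss 13 (.lit 0) (.scalar 12) (.var 9))
    (.seq (.callLoss 14 (.lit 0) (.num 0) (.var 9))
    (.seq (.ite (.ltReal (.scalar 6) (.get 4 (.var 5))) (.setScalar 15 (.scalar 6))
      (.setScalar 15 (.get 4 (.var 5))))
    (.setReal 3 (.var 5) (.times (.get 3 (.var 5)) (.minus (.num 1) (.times (.get 5 (.var 5))
      (.plus (.minus (.scalar 13) (.scalar 14)) (.scalar 15)))))))))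

/-- Replay round `9`. -/
def replayRound : Cmd := .seq computeThreshold (forExperts 3 4 5 updateWealth)

/-- Add up the stakes above and at the cut-off scale. -/
def computeMasses : Cmd :=
  .seq (.setScalar 8 (.num 0)) (.seq (.setScalar 9 (.num 0))
    (forExperts 3 4 5 (.ite (.ltReal (.scalar 6) (.get 4 (.var 5)))
      (.setScalar 8 (.plus (.scalar 8) (.stake 5)))
      (.ite (.ltReal (.get 4 (.var 5)) (.scalar 6)) .skip
        (.setScalar 9 (.plus (.scalar 9) (.stake 5)))))))

/-- Compute the probabilities of the experts, and the remaining probability. -/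
def computeProbs : Cmd :=
  .seq (.setScalar 11 (.num 1))
    (forExperts 3 4 5 (.seq
      (.ite (.ltReal (.scalar 6) (.get 4 (.var 5))) (.setReal 10 (.var 5) (.stake 5))
        (.ite (.ltReal (.get 4 (.var 5)) (.scalar 6)) (.setReal 10 (.var 5) (.num 0))
          (.setReal 10 (.var 5)
            (.div (.times (.stake 5) (.minus (.num 1) (.scalar 8))) (.scalar 9)))))
      (.setScalar 11 (.minus (.scalar 11) (.get 10 (.var 5))))))

/-- Draw the prediction. -/
def drawPrediction : Cmd :=
  forExperts 3 4 5
    (.seq (.setScalar 11 (.plus (.scalar 11) (.get 10 (.var 5))))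
    (.seq (.coin 10 (.div (.get 10 (.var 5)) (.scalar 11)))
    (.ite (.ltNat (.lit 0) (.var 10)) (.callSub 2 (.lit 0) (.var 3) (.radius 4) (.var 2))
      .skip)))

/-- The learner: replay all past rounds with fresh predictions of the sub-algorithms, then predict.
If there is only one round, predict `0`. -/
def program : Cmd :=
  .ite (.ltNat (.var 0) (.lit 2)) .skip
    (.seq setup (.seq (.loop 9 (.var 2) replayRound)
      (.seq computeThreshold (.seq computeMasses (.seq computeProbs drawPrediction)))))

theorem program_protected : program.Protected := by
  simp [program, setup, replayRound, computeThreshold, computeMass, updateWealth, computeMasses,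
    computeProbs, drawPrediction, forExperts, Cmd.setScalar, Cmd.Protected, NExpr.Protected]

/-! ### What the program computes -/

section Semantics

variable {O : Oracle} {σ : State} {n N : ℕ}

theorem index_lt {k i : ℕ} (hk : k < N) (hi : i < n + 1) : k * (n + 1) + i < N * (n + 1) := by
  calc k * (n + 1) + i < (k + 1) * (n + 1) := by rw [Nat.succ_mul]; omega
    _ ≤ N * (n + 1) := Nat.mul_le_mul_right _ hk

theorem index_div {k i : ℕ} (hi : i < n + 1) : (k * (n + 1) + i) / (n + 1) = k := by
  rw [mul_comm, Nat.mul_add_div (by omega), Nat.div_eq_of_lt hi, add_zero]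

theorem index_mod {k i : ℕ} (hi : i < n + 1) : (k * (n + 1) + i) % (n + 1) = i := by
  rw [mul_comm, Nat.mul_add_mod, Nat.mod_eq_of_lt hi]

theorem eval_radius (τ : State) (vi : ℕ) : (RExpr.radius vi).eval τ = 2 ^ τ.nat vi := by
  simp only [RExpr.radius, RExpr.num, RExpr.eval, NExpr.eval, Nat.cast_ofNat]
  rw [mul_comm, Real.exp_mul, Real.exp_log two_pos, Real.rpow_natCast]

theorem setup_ensures {L : ℝ} {b : ℕ → ℝ} (hn : σ.nat 0 = n) (hN : σ.nat 1 = N)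
    (hL : σ.arr 0 0 = L) (hB : σ.arr 1 = b) (hW : σ.arr 3 = fun _ => 0) :
    setup.Ensures O (fun τ =>
      (∀ j < N * (n + 1), τ.arr 4 j = scale n L b j ∧ τ.arr 5 j = rate n L b j) ∧
      τ.arr 3 = fun j => if j < N * (n + 1) then prior n j else 0) σ := by
  unfold setup
  refine forExperts_ensures (n := n) (N := N) ?_ ?_ ?_ ?_
    (fun m A => (∀ j < m, A 4 j = scale n L b j ∧ A 5 j = rate n L b j) ∧
      A 3 = fun j => if j < m then prior n j else 0) ?_ ?_
  · exact hn
  · exact hN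
  · decide
  · simp [Cmd.KeepsNat]
  · simp [hW]
  · rintro k hk i hi τ h1 h2 h3 h4 h5 ⟨h6, h7⟩
    have g0 := h5 0 (by simp [Cmd.KeepsArr])
    have g1 := h5 1 (by simp [Cmd.KeepsArr])
    have gn := h4 0 (by simp) (by simp) (by simp) (by simp [Cmd.KeepsNat])
    rw [hn] at gn
    rw [hB] at g1
    have g00 : τ.arr 0 0 = L := by rw [g0, hL]
    set m := k * (n + 1) + i with hm
    have d1 : m / (n + 1) = k := index_div hi
    have d2 : m % (n + 1) = i := index_mod hi
    have r2 : radius n m = 2 ^ i := by rw [radius, d2]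
    simp only [ensures_seq, ensures_setReal]
    simp only [State.setReal, State.tick, RExpr.complexity, RExpr.eval, NExpr.eval, eval_radius,
      RExpr.scalar, RExpr.num, Function.update_apply, h1, h2, h3, gn, g1, g00]
    refine ⟨fun j hj => ?_, ?_⟩
    · rcases Nat.lt_succ_iff_lt_or_eq.1 hj with hj | rfl
      · have : j ≠ m := hj.ne
        simpa [this] using h6 j hj
      · simp [scale, rate, complexity, d1, r2]
    · funext j
      simp only [h7]
      by_cases hj : j = m
      · subst hj
        simp [prior, d1, r2]
      · have : j < m + 1 ↔ j < m := by omega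
        simp [hj, this]

theorem computeMass_ensures {c w : ℕ → ℝ} {j : ℕ} (hn : σ.nat 0 = n) (hN : σ.nat 1 = N)
    (hj : σ.nat 5 = j) (hjN : j < N * (n + 1))
    (hc : ∀ l < N * (n + 1), σ.arr 4 l = c l)
    (hw : ∀ l < N * (n + 1), σ.arr 5 l * σ.arr 3 l = w l) :
    computeMass.Ensures O (fun τ => τ.arr 7 0 = massFrom (N * (n + 1)) c w (c j)) σ := by
  rw [computeMass, ensures_seq, Cmd.setScalar, ensures_setReal]
  refine forExperts_ensures (n := n) (N := N) ?_ ?_ ?_ ?_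
    (fun m A => A 7 0 = ∑ l ∈ range m, if c l < c j then 0 else w l) ?_ ?_
  · exact hn
  · exact hN
  · decide
  · simp [Cmd.KeepsNat, Cmd.setScalar]
  · simp [State.setReal, State.tick, RExpr.eval, NExpr.eval, RExpr.num]
  · intro k hk i hi τ h1 h2 h3 h4 h5 h6
    have g3 := h5 3 (by simp [Cmd.KeepsArr, Cmd.setScalar])
    have g4 := h5 4 (by simp [Cmd.KeepsArr, Cmd.setScalar])
    have g5 := h5 5 (by simp [Cmd.KeepsArr, Cmd.setScalar])
    have gj := h4 5 (by simp) (by simp) (by simp) (by simp [Cmd.KeepsNat, Cmd.setScalar])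
    have hlt := index_lt hk hi
    set m := k * (n + 1) + i
    simp only [State.setReal, State.tick, Function.update_apply, hj] at g3 g4 g5 gj
    norm_num at g3 g4 g5
    rw [ensures_ite]
    simp only [Test.holds, RExpr.eval, NExpr.eval, h3, gj, g4, hc _ hlt, hc _ hjN, Finset.sum_range_succ]
    refine ⟨fun h => ?_, fun h => ?_⟩
    · rw [ensures_skip]
      simpa [State.tick, h] using h6
    · rw [Cmd.setScalar, ensures_setReal]
      simp [State.setReal, State.tick, RExpr.eval, NExpr.eval, RExpr.scalar, RExpr.stake, h, h6, h3,
        g3, g5, hw _ hlt]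

theorem computeThreshold_ensures {c w : ℕ → ℝ} (hn : σ.nat 0 = n) (hN : σ.nat 1 = N)
    (hc : ∀ l < N * (n + 1), σ.arr 4 l = c l)
    (hw : ∀ l < N * (n + 1), σ.arr 5 l * σ.arr 3 l = w l) :
    computeThreshold.Ensures O (fun τ => τ.arr 6 0 = threshold (N * (n + 1)) c w) σ := by
  rw [computeThreshold, ensures_seq, Cmd.setScalar, ensures_setReal]
  refine forExperts_ensures (n := n) (N := N) ?_ ?_ ?_ ?_
    (fun m A => A 6 0 = thresholdUpTo (N * (n + 1)) c w m) ?_ ?_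
  · exact hn
  · exact hN
  · decide
  · simp [Cmd.KeepsNat, Cmd.setScalar, computeMass, forExperts]
  · simp [State.setReal, State.tick, RExpr.eval, NExpr.eval, RExpr.num, thresholdUpTo]
  · intro k hk i hi τ h1 h2 h3 h4 h5 h6
    have g3 := h5 3 (by simp [Cmd.KeepsArr, Cmd.setScalar, computeMass, forExperts])
    have g4 := h5 4 (by simp [Cmd.KeepsArr, Cmd.setScalar, computeMass, forExperts])
    have g5 := h5 5 (by simp [Cmd.KeepsArr, Cmd.setScalar, computeMass, forExperts])
    have gn := h4 0 (by simp) (by simp) (by simp)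
      (by simp [Cmd.KeepsNat, Cmd.setScalar, computeMass, forExperts])
    have gN := h4 1 (by simp) (by simp) (by simp)
      (by simp [Cmd.KeepsNat, Cmd.setScalar, computeMass, forExperts])
    have hlt := index_lt hk hi
    set m := k * (n + 1) + i
    simp only [State.setReal, State.tick, Function.update_apply, hn, hN] at g3 g4 g5 gn gN
    norm_num at g3 g4 g5
    rw [ensures_seq]
    refine ((computeMass_ensures (c := c) (w := w) gn gN h3 hlt (by rw [g4]; exact hc)
      (by rw [g3, g5]; exact hw)).and ((ensures_arr_eq (a := 6) _
      (by simp [Cmd.KeepsArr, Cmd.setScalar, computeMass, forExperts]) τ).and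
      ((ensures_arr_eq (a := 4) _
      (by simp [Cmd.KeepsArr, Cmd.setScalar, computeMass, forExperts]) τ).and
      (ensures_nat_eq (v := 5) _
      (by simp [Cmd.KeepsNat, Cmd.setScalar, computeMass, forExperts]) τ)))).mono ?_
    rintro ρ ⟨k1, k2, k3, k4⟩
    simp only [ensures_ite, ensures_skip, Cmd.setScalar, ensures_setReal, Test.holds, RExpr.eval,
      NExpr.eval, RExpr.num, RExpr.scalar, State.tick, State.setReal, k1, k2, k3, k4, h3, g4,
      hc _ hlt, h6, thresholdUpTo, Nat.cast_one, Function.update_apply]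
    refine ⟨fun h => ⟨fun h' => ?_, fun h' => ?_⟩, fun h => ?_⟩
    · simp [h, h']
    · simp [h, h']
    · simp [h]

theorem computeMasses_ensures {c w : ℕ → ℝ} {y : ℝ} (hn : σ.nat 0 = n) (hN : σ.nat 1 = N)
    (hc : ∀ l < N * (n + 1), σ.arr 4 l = c l)
    (hw : ∀ l < N * (n + 1), σ.arr 5 l * σ.arr 3 l = w l) (hy : σ.arr 6 0 = y) :
    computeMasses.Ensures O (fun τ => τ.arr 8 0 = massAbove (N * (n + 1)) c w y ∧
      τ.arr 9 0 = massAt (N * (n + 1)) c w y) σ := by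
  simp only [computeMasses, ensures_seq, Cmd.setScalar, ensures_setReal]
  refine forExperts_ensures (n := n) (N := N) ?_ ?_ ?_ ?_
    (fun m A => A 8 0 = (∑ l ∈ range m, if y < c l then w l else 0) ∧
      A 9 0 = ∑ l ∈ range m, if y < c l then 0 else if c l < y then 0 else w l) ?_ ?_
  · exact hn
  · exact hN
  · decide
  · simp [Cmd.KeepsNat]
  · simp [State.setReal, State.tick, RExpr.eval, NExpr.eval, RExpr.num]
  · rintro k hk i hi τ h1 h2 h3 h4 h5 ⟨h6, h7⟩
    have g3 := h5 3 (by simp [Cmd.KeepsArr])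
    have g4 := h5 4 (by simp [Cmd.KeepsArr])
    have g5 := h5 5 (by simp [Cmd.KeepsArr])
    have g6 := h5 6 (by simp [Cmd.KeepsArr])
    have hlt := index_lt hk hi
    set m := k * (n + 1) + i
    simp only [State.setReal, State.tick, Function.update_apply] at g3 g4 g5 g6
    norm_num at g3 g4 g5 g6
    simp only [ensures_ite, ensures_skip, ensures_setReal, Test.holds, RExpr.eval,
      NExpr.eval, RExpr.stake, RExpr.scalar, State.tick, State.setReal, h3, g3, g4, g5, g6, hy,
      hc _ hlt, hw _ hlt, h6, h7, Function.update_apply, Finset.sum_range_succ]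
    refine ⟨fun h => ?_, fun h => ⟨fun h' => ?_, fun h' => ?_⟩⟩
    · simp [h, h7]
    · simp [h, h']
    · simp [h, h', h6]

theorem computeProbs_ensures {c w : ℕ → ℝ} (hn : σ.nat 0 = n) (hN : σ.nat 1 = N)
    (hc : ∀ l < N * (n + 1), σ.arr 4 l = c l)
    (hw : ∀ l < N * (n + 1), σ.arr 5 l * σ.arr 3 l = w l)
    (hy : σ.arr 6 0 = threshold (N * (n + 1)) c w)
    (ha : σ.arr 8 0 = massAbove (N * (n + 1)) c w (threshold (N * (n + 1)) c w))
    (hb : σ.arr 9 0 = massAt (N * (n + 1)) c w (threshold (N * (n + 1)) c w)) :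
    computeProbs.Ensures O (fun τ =>
      (∀ l < N * (n + 1), τ.arr 10 l = playProb (N * (n + 1)) c w l) ∧
      τ.arr 11 0 = 1 - ∑ l ∈ range (N * (n + 1)), playProb (N * (n + 1)) c w l) σ := by
  simp only [computeProbs, ensures_seq, Cmd.setScalar, ensures_setReal]
  refine forExperts_ensures (n := n) (N := N) ?_ ?_ ?_ ?_
    (fun m A => (∀ l < m, A 10 l = playProb (N * (n + 1)) c w l) ∧
      A 11 0 = 1 - ∑ l ∈ range m, playProb (N * (n + 1)) c w l) ?_ ?_
  · exact hn
  · exact hN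
  · decide
  · simp [Cmd.KeepsNat]
  · simp [State.setReal, State.tick, RExpr.eval, NExpr.eval, RExpr.num]
  · rintro k hk i hi τ h1 h2 h3 h4 h5 ⟨h6, h7⟩
    have g3 := h5 3 (by simp [Cmd.KeepsArr])
    have g4 := h5 4 (by simp [Cmd.KeepsArr])
    have g5 := h5 5 (by simp [Cmd.KeepsArr])
    have g6 := h5 6 (by simp [Cmd.KeepsArr])
    have g8 := h5 8 (by simp [Cmd.KeepsArr])
    have g9 := h5 9 (by simp [Cmd.KeepsArr])
    have hlt := index_lt hk hi
    set m := k * (n + 1) + i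
    simp only [State.setReal, State.tick, Function.update_apply] at g3 g4 g5 g6 g8 g9
    norm_num at g3 g4 g5 g6 g8 g9
    have key : ∀ ρ : State, ρ.nat 5 = m → ρ.arr 11 = τ.arr 11 →
        ρ.arr 10 = Function.update (τ.arr 10) m (playProb (N * (n + 1)) c w m) →
        (Cmd.setReal 11 (.lit 0) (.minus (.scalar 11) (.get 10 (.var 5)))).Ensures O
          (fun ρ => (∀ l < m + 1, ρ.arr 10 l = playProb (N * (n + 1)) c w l) ∧
            ρ.arr 11 0 = 1 - ∑ l ∈ range (m + 1), playProb (N * (n + 1)) c w l) ρ := by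
      intro ρ e1 e2 e3
      rw [ensures_setReal]
      refine ⟨fun l hl => ?_, ?_⟩
      · simp only [State.setReal, State.tick, Function.update_apply]
        norm_num [e3, Function.update_apply]
        rcases Nat.lt_succ_iff_lt_or_eq.1 hl with hl | rfl
        · simpa [hl.ne] using h6 l hl
        · simp
      · simp [State.setReal, State.tick, RExpr.eval, NExpr.eval, RExpr.scalar, e1, e2, e3, h7,
          Finset.sum_range_succ]
        ring
    rw [ensures_seq]
    refine Cmd.Ensures.mono (Q := fun ρ => ρ.nat 5 = m ∧ ρ.arr 11 = τ.arr 11 ∧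
      ρ.arr 10 = Function.update (τ.arr 10) m (playProb (N * (n + 1)) c w m)) ?_
      fun ρ h => key ρ h.1 h.2.1 h.2.2
    simp only [ensures_ite, ensures_setReal, Test.holds, RExpr.scalar, RExpr.stake, RExpr.num,
      RExpr.eval, NExpr.eval, State.tick, State.setReal, h3, g3, g4, g5, g6, g8, g9, hy, ha, hb,
      hc _ hlt, hw _ hlt, Function.update_self, playProb]
    refine ⟨fun h => ?_, fun h => ⟨fun h' => ?_, fun h' => ?_⟩⟩
    · simp [h]
    · simp [h, h']
    · simp [h, h']

end Semantics

section Semantics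

variable {O : Oracle} {σ : State} {n N : ℕ}

theorem map_eq_pure_of_ensures {S : Type*} {c : Cmd} {view : State → S} {a : S}
    (h : c.Ensures O (fun ρ => view ρ = a) σ) : (c.run O σ).map view = PMF.pure a := by
  refine eq_pure_of_support fun b hb => ?_
  obtain ⟨ρ, hρ, rfl⟩ := (PMF.mem_support_map_iff _ _ _).1 hb
  exact h ρ hρ

theorem run_ite_pos {b : Test} {c d : Cmd} (h : b.holds σ) :
    (Cmd.ite b c d).run O σ = c.run O (σ.tick (b.size + 1)) := by
  simp [Cmd.run, h]

theorem run_ite_neg {b : Test} {c d : Cmd} (h : ¬ b.holds σ) :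
    (Cmd.ite b c d).run O σ = d.run O (σ.tick (b.size + 1)) := by
  simp [Cmd.run, h]

theorem updateWealth_map {c β : ℕ → ℝ} {D : ℕ → PMF ℝ} {y : ℝ} {m s : ℕ}
    (hm : σ.nat 5 = m) (hs : σ.nat 9 = s) (hc : σ.arr 4 m = c m) (hβ : σ.arr 5 m = β m)
    (hy : σ.arr 6 0 = y) (hD : O.sub (σ.nat 3) (2 ^ σ.nat 4) s = D m) :
    (updateWealth.run O σ).map (fun ρ => ρ.arr 3) =
      wealthStep c β D (fun v => O.loss v s) y m (σ.arr 3) := by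
  rw [updateWealth, Cmd.run, PMF.map_bind, Cmd.run, PMF.bind_map, wealthStep,
    ← PMF.bind_pure_comp]
  simp only [NExpr.eval, eval_radius, hs, hD]
  congr 1
  funext v
  refine map_eq_pure_of_ensures ?_
  simp only [ensures_seq, ensures_callLoss, ensures_ite, Cmd.setScalar, ensures_setReal]
  constructor
  · intro h
    simp [Test.holds, RExpr.scalar, RExpr.num, RExpr.eval, NExpr.eval, State.setReal, State.tick,
      hm, hc, hy] at h
    simp [RExpr.scalar, RExpr.num, RExpr.eval, NExpr.eval, State.setReal, State.tick, hm, hs, hβ,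
      hy, min_eq_right h.le]
  · intro h
    simp [Test.holds, RExpr.scalar, RExpr.num, RExpr.eval, NExpr.eval, State.setReal, State.tick,
      hm, hc, hy] at h
    simp [RExpr.scalar, RExpr.num, RExpr.eval, NExpr.eval, State.setReal, State.tick, hm, hs, hβ,
      hc, min_eq_left h]

theorem replayRound_map {c β : ℕ → ℝ} {s : ℕ} (hn : σ.nat 0 = n) (hN : σ.nat 1 = N)
    (hs : σ.nat 9 = s)
    (hc : ∀ l < N * (n + 1), σ.arr 4 l = c l) (hβ : ∀ l < N * (n + 1), σ.arr 5 l = β l) :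
    (replayRound.run O σ).map (fun ρ => ρ.arr 3) =
      roundStep (N * (n + 1)) c β (expertLaw O n s) (fun v => O.loss v s) (σ.arr 3) := by
  have hthr := computeThreshold_ensures (O := O) (c := c) (w := stake β (σ.arr 3)) hn hN hc
    fun l hl => by rw [hβ l hl, stake]
  refine run_seq_map_const _ _ (hthr.and ((ensures_arr_eq (a := 3) _
      (by simp [Cmd.KeepsArr, Cmd.setScalar, computeThreshold, computeMass, forExperts]) σ).and
    ((ensures_arr_eq (a := 4) _
      (by simp [Cmd.KeepsArr, Cmd.setScalar, computeThreshold, computeMass, forExperts]) σ).and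
    ((ensures_arr_eq (a := 5) _
      (by simp [Cmd.KeepsArr, Cmd.setScalar, computeThreshold, computeMass, forExperts]) σ).and
    ((ensures_nat_eq (v := 0) _
      (by simp [Cmd.KeepsNat, Cmd.setScalar, computeThreshold, computeMass, forExperts]) σ).and
    ((ensures_nat_eq (v := 1) _
      (by simp [Cmd.KeepsNat, Cmd.setScalar, computeThreshold, computeMass, forExperts]) σ).and
    (ensures_nat_eq (v := 9) _
      (by simp [Cmd.KeepsNat, Cmd.setScalar, computeThreshold, computeMass, forExperts])
      σ))))))) ?_
  rintro τ ⟨q6, q3, q4, q5, q0, q1, q9⟩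
  rw [← q3] at q6 ⊢
  refine (forExperts_spec (n := n) (N := N) (q0.trans hn) (q1.trans hN) (by decide)
    (by simp [updateWealth, Cmd.KeepsNat, Cmd.setScalar]) (fun A => A 3) _ (fun _ _ => True)
    trivial ?_).2
  intro k hk i hi ρ h1 h2 h3 h4 h5 _
  refine ⟨fun _ _ => trivial, ?_⟩
  have hlt := index_lt hk hi
  have d1 := index_div (n := n) (k := k) hi
  have d2 := index_mod (n := n) (k := k) hi
  have g4 := h5 4 (by simp [updateWealth, Cmd.KeepsArr, Cmd.setScalar])
  have g5 := h5 5 (by simp [updateWealth, Cmd.KeepsArr, Cmd.setScalar])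
  have g6 := h5 6 (by simp [updateWealth, Cmd.KeepsArr, Cmd.setScalar])
  have g9 := h4 9 (by simp) (by simp) (by simp) (by simp [updateWealth, Cmd.KeepsNat,
    Cmd.setScalar])
  exact updateWealth_map h3 (by rw [g9, q9, hs]) (by rw [g4, q4, hc _ hlt])
    (by rw [g5, q5, hβ _ hlt]) (by rw [g6, q6]) (by rw [h1, h2, expertLaw, radius, d1, d2])

theorem drawPrediction_map {x : ℕ → ℝ} {t : ℕ} (hn : σ.nat 0 = n) (hN : σ.nat 1 = N)
    (ht : σ.nat 2 = t) (hx : ∀ l < N * (n + 1), σ.arr 10 l = x l)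
    (hm : σ.arr 11 0 = 1 - ∑ l ∈ range (N * (n + 1)), x l) (ho : σ.arr 2 0 = 0) :
    (drawPrediction.run O σ).map (fun ρ => ρ.arr 2 0) =
      mixture (N * (n + 1)) (expertLaw O n t) x := by
  have := (forExperts_spec (O := O) (σ := σ) (n := n) (N := N) (vk := 3) (vi := 4) (vj := 5)
    (body := (.seq (.setScalar 11 (.plus (.scalar 11) (.get 10 (.var 5))))
    (.seq (.coin 10 (.div (.get 10 (.var 5)) (.scalar 11)))
    (.ite (.ltNat (.lit 0) (.var 10)) (.callSub 2 (.lit 0) (.var 3) (.radius 4) (.var 2))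
      .skip)))) hn hN (by decide)
    (by simp [Cmd.KeepsNat, Cmd.setScalar]) (fun A => A 2 0)
    (fun j o => (biasedCoin (x j / (1 - ∑ l ∈ range (N * (n + 1)), x l +
      ∑ l ∈ range (j + 1), x l))).bind fun b =>
      if b then expertLaw O n t j else PMF.pure o)
    (fun m A => A 11 0 = 1 - ∑ l ∈ range (N * (n + 1)), x l + ∑ l ∈ range m, x l)
    (by simp [hm]) ?_).2
  · rw [mixture, ← ho]
    exact this
  · intro k hk i hi τ h1 h2 h3 h4 h5 h6
    have hlt := index_lt hk hi
    have d1 := index_div (n := n) (k := k) hi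
    have d2 := index_mod (n := n) (k := k) hi
    have g10 := h5 10 (by simp [Cmd.KeepsArr, Cmd.setScalar])
    have gt := h4 2 (by simp) (by simp) (by simp) (by simp [Cmd.KeepsNat, Cmd.setScalar])
    rw [ht] at gt
    set m := k * (n + 1) + i
    constructor
    · rw [ensures_seq, Cmd.setScalar, ensures_setReal, ensures_seq]
      refine ensures_coin fun z => ?_
      simp only [ensures_ite, ensures_skip, ensures_callSub]
      simp [State.setReal, State.setNat, State.tick, RExpr.eval, NExpr.eval, RExpr.scalar, h3, h6,
        g10, hx _ hlt, Finset.sum_range_succ, add_assoc]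
    · rw [Cmd.run, Cmd.setScalar, Cmd.run, PMF.pure_bind, Cmd.run, Cmd.run, PMF.bind_map,
        PMF.map_bind]
      have hp : RExpr.eval ((τ.setReal 11 (NExpr.eval τ (.lit 0)) (RExpr.eval τ
          (.plus (.scalar 11) (.get 10 (.var 5))))).tick (NExpr.size (.lit 0) +
          RExpr.size (.plus (.scalar 11) (.get 10 (.var 5))) + 1))
          (.div (.get 10 (.var 5)) (.scalar 11)) =
          x m / (1 - ∑ l ∈ range (N * (n + 1)), x l + ∑ l ∈ range (m + 1), x l) := by
        simp [State.setReal, State.tick, RExpr.eval, NExpr.eval, RExpr.scalar, h3, h6,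
          g10, hx _ hlt, Finset.sum_range_succ, add_assoc]
      rw [hp]
      congr 1
      funext b
      cases b
      · simp [Cmd.run, Test.holds, NExpr.eval, State.setNat, State.setReal, State.tick,
          PMF.pure_map]
      · simp only [Function.comp_apply, Cmd.run, Test.holds, NExpr.eval, State.setNat,
          State.tick, State.setReal, eval_radius]
        simp only [if_true, Function.update_self, zero_lt_one, PMF.map_comp]
        have e1 : (Function.update τ.nat 10 1) 3 = k := by simp [h1]
        have e2 : (Function.update τ.nat 10 1) 4 = i := by simp [h2]
        have e3 : (Function.update τ.nat 10 1) 2 = t := by simp [gt]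
        have e4 : O.sub k (2 ^ i) t = expertLaw O n t m := by rw [expertLaw, radius, d1, d2]
        rw [e1, e2, e3, e4]
        convert PMF.map_id _ using 2
        funext r
        simp

/-- The program started in round `t` of the game draws its prediction from `predictionLaw`. -/
theorem program_map {L : ℝ} {b : ℕ → ℝ} {t : ℕ} (hn2 : 2 ≤ n) (hn : σ.nat 0 = n)
    (hN : σ.nat 1 = N) (ht : σ.nat 2 = t) (hL : σ.arr 0 0 = L) (hB : σ.arr 1 = b)
    (ho : σ.arr 2 0 = 0) (hW : σ.arr 3 = fun _ => 0) :
    (program.run O σ).map (fun ρ => ρ.arr 2 0) = predictionLaw n N L b O t := by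
  have hrun : (program.run O σ).map (fun ρ => ρ.arr 2 0) =
      ((Cmd.seq setup (.seq (.loop 9 (.var 2) replayRound)
        (.seq computeThreshold (.seq computeMasses (.seq computeProbs drawPrediction))))).run O
        (σ.tick (Test.size (.ltNat (.var 0) (.lit 2)) + 1))).map (fun ρ => ρ.arr 2 0) := by
    rw [program, run_ite_neg]
    simp only [Test.holds, NExpr.eval, hn]
    omega
  rw [hrun]
  set σ₁ := σ.tick (Test.size (.ltNat (.var 0) (.lit 2)) + 1)
  have hsetup := setup_ensures (O := O) (σ := σ₁) (n := n) (N := N) hn hN hL hB hW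
  refine run_seq_map_const _ _ (hsetup.and ((ensures_arr_eq (a := 2) _
    (by simp [Cmd.KeepsArr, setup, forExperts]) σ₁).and
    ((ensures_nat_eq (v := 0) _ (by simp [Cmd.KeepsNat, setup, forExperts]) σ₁).and
    ((ensures_nat_eq (v := 1) _ (by simp [Cmd.KeepsNat, setup, forExperts]) σ₁).and
    (ensures_nat_eq (v := 2) _ (by simp [Cmd.KeepsNat, setup, forExperts]) σ₁))))) ?_
  rintro σ₂ ⟨⟨hcb, hW₂⟩, q2, r0, r1, r2⟩
  have r0 : σ₂.nat 0 = n := r0.trans hn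
  have r1 : σ₂.nat 1 = N := r1.trans hN
  have r2 : σ₂.nat 2 = t := r2.trans ht
  have q2 : σ₂.arr 2 0 = 0 := by rw [q2]; exact ho
  -- what the replay of a round does not change
  let I : State → Prop := fun τ => τ.nat 0 = n ∧ τ.nat 1 = N ∧ τ.nat 2 = t ∧ τ.arr 2 0 = 0 ∧
    ∀ j < N * (n + 1), τ.arr 4 j = scale n L b j ∧ τ.arr 5 j = rate n L b j
  have hframe : ∀ τ : State, I τ → replayRound.Ensures O I τ := by
    rintro τ ⟨i0, i1, i2, i3, i4⟩
    refine ((ensures_arr_eq (a := 2) _ (by simp [Cmd.KeepsArr, replayRound, updateWealth,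
        computeThreshold, computeMass, Cmd.setScalar, forExperts]) τ).and
      ((ensures_arr_eq (a := 4) _ (by simp [Cmd.KeepsArr, replayRound, updateWealth,
        computeThreshold, computeMass, Cmd.setScalar, forExperts]) τ).and
      ((ensures_arr_eq (a := 5) _ (by simp [Cmd.KeepsArr, replayRound, updateWealth,
        computeThreshold, computeMass, Cmd.setScalar, forExperts]) τ).and
      ((ensures_nat_eq (v := 0) _ (by simp [Cmd.KeepsNat, replayRound, updateWealth,
        computeThreshold, computeMass, Cmd.setScalar, forExperts]) τ).and
      ((ensures_nat_eq (v := 1) _ (by simp [Cmd.KeepsNat, replayRound, updateWealth,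
        computeThreshold, computeMass, Cmd.setScalar, forExperts]) τ).and
      (ensures_nat_eq (v := 2) _ (by simp [Cmd.KeepsNat, replayRound, updateWealth,
        computeThreshold, computeMass, Cmd.setScalar, forExperts]) τ)))))).mono ?_
    rintro ρ ⟨a2, a4, a5, n0, n1, n2⟩
    exact ⟨n0.trans i0, n1.trans i1, n2.trans i2, by rw [a2, i3], by rw [a4, a5]; exact i4⟩
  have hloop := loop_spec (O := O) (σ := σ₂) (v := 9) (e := .var 2) (c := replayRound)
    (fun ρ => ρ.arr 3) (fun s => roundStep (N * (n + 1)) (scale n L b) (rate n L b)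
      (expertLaw O n s) (fun v => O.loss v s)) (fun _ => I)
    ⟨r0, r1, r2, q2, hcb⟩ (by
      rintro s - τ ⟨i0, i1, i2, i3, i4⟩
      have hI : I ((τ.setNat 9 s).tick 1) :=
        ⟨by simpa [State.setNat, State.tick] using i0, by simpa [State.setNat, State.tick] using i1,
          by simpa [State.setNat, State.tick] using i2, i3, i4⟩
      exact ⟨hframe _ hI, replayRound_map hI.1 hI.2.1 (by simp [State.setNat, State.tick])
        (fun l hl => (i4 l hl).1) fun l hl => (i4 l hl).2⟩)
  rw [predictionLaw, wealthLaw]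
  have hlaw : ((Cmd.loop 9 (.var 2) replayRound).run O σ₂).map (fun ρ => ρ.arr 3) =
      iterLaw (fun s => roundStep (N * (n + 1)) (scale n L b) (rate n L b)
      (expertLaw O n s) (fun v => O.loss v s))
      (PMF.pure fun j => if j < N * (n + 1) then prior n j else 0) t := by
    rw [hloop.2]
    simp only [NExpr.eval, r2, State.tick, hW₂]
  rw [← hlaw]
  refine run_seq_map (fun ρ => ρ.arr 3) _ _ hloop.1 ?_
  rintro σ₃ ⟨i0, i1, i2, i3, i4⟩
  set w := stake (rate n L b) (σ₃.arr 3) with hw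
  have hw' : ∀ l < N * (n + 1), σ₃.arr 5 l * σ₃.arr 3 l = w l := fun l hl => by
    rw [(i4 l hl).2, hw, stake]
  refine run_seq_map_const _ _ ((computeThreshold_ensures (O := O) (c := scale n L b) i0 i1
    (fun l hl => (i4 l hl).1) hw').and ((ensures_arr_eq (a := 2) _ (by simp [Cmd.KeepsArr,
        computeThreshold, computeMass, Cmd.setScalar, forExperts]) σ₃).and
      ((ensures_arr_eq (a := 3) _ (by simp [Cmd.KeepsArr,
        computeThreshold, computeMass, Cmd.setScalar, forExperts]) σ₃).and
      ((ensures_arr_eq (a := 4) _ (by simp [Cmd.KeepsArr,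
        computeThreshold, computeMass, Cmd.setScalar, forExperts]) σ₃).and
      ((ensures_arr_eq (a := 5) _ (by simp [Cmd.KeepsArr,
        computeThreshold, computeMass, Cmd.setScalar, forExperts]) σ₃).and
      ((ensures_nat_eq (v := 0) _ (by simp [Cmd.KeepsNat,
        computeThreshold, computeMass, Cmd.setScalar, forExperts]) σ₃).and
      ((ensures_nat_eq (v := 1) _ (by simp [Cmd.KeepsNat,
        computeThreshold, computeMass, Cmd.setScalar, forExperts]) σ₃).and
      (ensures_nat_eq (v := 2) _ (by simp [Cmd.KeepsNat,
        computeThreshold, computeMass, Cmd.setScalar, forExperts]) σ₃)))))))) ?_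
  rintro σ₄ ⟨h6, h2, h3, h4, h5, n0, n1, n2⟩
  have n0 : σ₄.nat 0 = n := n0.trans i0
  have n1 : σ₄.nat 1 = N := n1.trans i1
  have n2 : σ₄.nat 2 = t := n2.trans i2
  have hc₄ : ∀ l < N * (n + 1), σ₄.arr 4 l = scale n L b l := fun l hl => by
    rw [h4, (i4 l hl).1]
  have hw₄ : ∀ l < N * (n + 1), σ₄.arr 5 l * σ₄.arr 3 l = w l := by rw [h5, h3]; exact hw'
  refine run_seq_map_const _ _ ((computeMasses_ensures (O := O) n0 n1 hc₄ hw₄ h6).and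
    ((ensures_arr_eq (a := 2) _ (by simp [Cmd.KeepsArr, computeMasses, Cmd.setScalar,
      forExperts]) σ₄).and
    ((ensures_arr_eq (a := 3) _ (by simp [Cmd.KeepsArr, computeMasses, Cmd.setScalar,
      forExperts]) σ₄).and
    ((ensures_arr_eq (a := 4) _ (by simp [Cmd.KeepsArr, computeMasses, Cmd.setScalar,
      forExperts]) σ₄).and
    ((ensures_arr_eq (a := 5) _ (by simp [Cmd.KeepsArr, computeMasses, Cmd.setScalar,
      forExperts]) σ₄).and
    ((ensures_arr_eq (a := 6) _ (by simp [Cmd.KeepsArr, computeMasses, Cmd.setScalar,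
      forExperts]) σ₄).and
    ((ensures_nat_eq (v := 0) _ (by simp [Cmd.KeepsNat, computeMasses, Cmd.setScalar,
      forExperts]) σ₄).and
    ((ensures_nat_eq (v := 1) _ (by simp [Cmd.KeepsNat, computeMasses, Cmd.setScalar,
      forExperts]) σ₄).and
    (ensures_nat_eq (v := 2) _ (by simp [Cmd.KeepsNat, computeMasses, Cmd.setScalar,
      forExperts]) σ₄))))))))) ?_
  rintro σ₅ ⟨⟨h8, h9⟩, g2, g3, g4, g5, g6, m0, m1, m2⟩
  have m0 : σ₅.nat 0 = n := m0.trans n0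
  have m1 : σ₅.nat 1 = N := m1.trans n1
  have m2 : σ₅.nat 2 = t := m2.trans n2
  refine run_seq_map_const _ _ ((computeProbs_ensures (O := O) (c := scale n L b) (w := w) m0 m1
    (by rw [g4]; exact hc₄) (by rw [g5, g3]; exact hw₄) (by rw [g6, h6]) h8 h9).and
    ((ensures_arr_eq (a := 2) _ (by simp [Cmd.KeepsArr, computeProbs, Cmd.setScalar,
      forExperts]) σ₅).and
    ((ensures_nat_eq (v := 0) _ (by simp [Cmd.KeepsNat, computeProbs, Cmd.setScalar,
      forExperts]) σ₅).and
    ((ensures_nat_eq (v := 1) _ (by simp [Cmd.KeepsNat, computeProbs, Cmd.setScalar,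
      forExperts]) σ₅).and
    (ensures_nat_eq (v := 2) _ (by simp [Cmd.KeepsNat, computeProbs, Cmd.setScalar,
      forExperts]) σ₅))))) ?_
  rintro σ₆ ⟨⟨h10, h11⟩, f2, f0, f1, ft⟩
  exact drawPrediction_map (f0.trans m0) (f1.trans m1) (ft.trans m2) h10 h11
    (by rw [f2, g2, h2, i3])

end Semantics

/-! ### Cutting off the stakes -/

section Cutoff

variable {K : ℕ} {c w : ℕ → ℝ}

theorem le_thresholdUpTo {m l : ℕ} (hl : l < m) (h : 1 < massFrom K c w (c l)) :
    c l ≤ thresholdUpTo K c w m := by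
  induction m with
  | zero => omega
  | succ m ih =>
    rw [thresholdUpTo]
    rcases Nat.lt_succ_iff_lt_or_eq.1 hl with hl | rfl
    · have := ih hl
      split_ifs with h1 h2
      · exact this.trans h2.le
      · exact this
      · exact this
    · rw [if_pos h]
      split_ifs with h2
      · exact le_rfl
      · exact not_lt.1 h2

theorem thresholdUpTo_eq (m : ℕ) : thresholdUpTo K c w m = 0 ∨
    ∃ l < m, 1 < massFrom K c w (c l) ∧ thresholdUpTo K c w m = c l := by
  induction m with
  | zero => exact Or.inl rfl
  | succ m ih =>
    rw [thresholdUpTo]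
    have h' : thresholdUpTo K c w m = 0 ∨
        ∃ l < m + 1, 1 < massFrom K c w (c l) ∧ thresholdUpTo K c w m = c l := by
      rcases ih with h | ⟨l, hl, h⟩
      · exact Or.inl h
      · exact Or.inr ⟨l, by omega, h⟩
    split_ifs with h1 h2
    · exact Or.inr ⟨m, by omega, h1, rfl⟩
    · exact h'
    · exact h'

theorem threshold_nonneg (hc : ∀ j < K, 0 < c j) : 0 ≤ threshold K c w := by
  rcases thresholdUpTo_eq (K := K) (c := c) (w := w) K with h | ⟨l, hl, -, h⟩
  · exact h.ge
  · rw [threshold, h]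
    exact (hc l hl).le

theorem massAbove_le_one : massAbove K c w (threshold K c w) ≤ 1 := by
  set y := threshold K c w with hy
  by_cases hS : ((range K).filter fun j => y < c j).Nonempty
  · obtain ⟨m, hm, hmin⟩ := exists_min_image _ c hS
    rw [mem_filter, mem_range] at hm
    have h1 : massAbove K c w y = massFrom K c w (c m) := by
      refine sum_congr rfl fun j hj => ?_
      by_cases hyj : y < c j
      · rw [if_pos hyj, if_neg (not_lt.2 (hmin j (mem_filter.2 ⟨hj, hyj⟩)))]
      · rw [if_neg hyj, if_pos ((not_lt.1 hyj).trans_lt hm.2)]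
    rw [h1]
    by_contra h
    exact absurd (le_thresholdUpTo hm.1 (not_le.1 h)) (not_le.2 hm.2)
  · rw [not_nonempty_iff_eq_empty, filter_eq_empty_iff] at hS
    rw [massAbove, sum_eq_zero fun j hj => if_neg (hS hj)]
    exact zero_le_one

theorem massAbove_add_massAt (y : ℝ) :
    massAbove K c w y + massAt K c w y = massFrom K c w y := by
  rw [massAbove, massAt, massFrom, ← sum_add_distrib]
  refine sum_congr rfl fun j _ => ?_
  rcases lt_trichotomy y (c j) with h | h | h
  · simp [h, not_lt.2 h.le]
  · simp [h]
  · simp [h, not_lt.2 h.le]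

theorem one_sub_massAbove_lt_massAt (h : threshold K c w ≠ 0) :
    1 - massAbove K c w (threshold K c w) < massAt K c w (threshold K c w) := by
  rcases thresholdUpTo_eq (K := K) (c := c) (w := w) K with h0 | ⟨l, -, h1, h2⟩
  · exact absurd h0 h
  · have := massAbove_add_massAt (K := K) (c := c) (w := w) (threshold K c w)
    rw [← h2] at h1
    change 1 < massFrom K c w (threshold K c w) at h1
    linarith

theorem playProb_nonneg (hc : ∀ j < K, 0 < c j) (hw : ∀ j < K, 0 ≤ w j) {j : ℕ} (hj : j < K) :
    0 ≤ playProb K c w j := by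
  rw [playProb]
  split_ifs with h1 h2
  · exact hw j hj
  · exact le_rfl
  · have hy : threshold K c w ≠ 0 := fun h => h1 (h ▸ hc j hj)
    have h3 := massAbove_le_one (K := K) (c := c) (w := w)
    have h4 := one_sub_massAbove_lt_massAt hy
    exact div_nonneg (mul_nonneg (hw j hj) (by linarith)) (by linarith)

theorem playProb_le (hc : ∀ j < K, 0 < c j) (hw : ∀ j < K, 0 ≤ w j) {j : ℕ} (hj : j < K) :
    playProb K c w j ≤ w j := by
  rw [playProb]
  split_ifs with h1 h2
  · exact le_rfl
  · exact hw j hj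
  · have hy : threshold K c w ≠ 0 := fun h => h1 (h ▸ hc j hj)
    have h3 := massAbove_le_one (K := K) (c := c) (w := w)
    have h4 := one_sub_massAbove_lt_massAt hy
    rw [div_le_iff₀ (by linarith)]
    exact mul_le_mul_of_nonneg_left h4.le (hw j hj)

theorem sum_playProb_eq_one (h : threshold K c w ≠ 0) :
    ∑ j ∈ range K, playProb K c w j = 1 := by
  have h3 := massAbove_le_one (K := K) (c := c) (w := w)
  have h4 := one_sub_massAbove_lt_massAt h
  set y := threshold K c w with hy
  have h5 : ∀ j ∈ range K, playProb K c w j = (if y < c j then w j else 0) +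
      (if y < c j then 0 else if c j < y then 0 else w j) *
        ((1 - massAbove K c w y) / massAt K c w y) := by
    intro j _
    rw [playProb, ← hy]
    split_ifs <;> ring
  rw [sum_congr rfl h5, sum_add_distrib, ← sum_mul]
  change massAbove K c w y + massAt K c w y * _ = 1
  rw [mul_div_cancel₀ _ (by linarith)]
  ring

theorem sum_playProb_le_one (hc : ∀ j < K, 0 < c j) :
    ∑ j ∈ range K, playProb K c w j ≤ 1 := by
  by_cases h : threshold K c w = 0
  · refine le_trans (le_of_eq (sum_congr rfl fun j hj => ?_))
      (massAbove_le_one (K := K) (c := c) (w := w))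
    have := hc j (mem_range.1 hj)
    rw [playProb, h, if_pos this, if_pos this]
  · exact (sum_playProb_eq_one h).le

/-- The cut-off costs nothing when the loss of expert `j` is raised by the minimum of its scale and
the cut-off scale: these corrections are a subgradient of the distance, weighted by the scales, of
the stakes from the set of subprobability vectors. -/
theorem sum_mul_playProb_le (hc : ∀ j < K, 0 < c j) (hw : ∀ j < K, 0 ≤ w j) {g : ℕ → ℝ}
    (hg : ∀ j < K, |g j| ≤ c j) :
    ∑ j ∈ range K, g j * playProb K c w j ≤
      ∑ j ∈ range K, (g j + min (c j) (threshold K c w)) * w j - threshold K c w := by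
  set y := threshold K c w with hy
  have h1 : ∀ j ∈ range K, g j * playProb K c w j ≤
      (g j + min (c j) y) * w j - y * playProb K c w j := by
    intro j hj
    rw [mem_range] at hj
    have h2 : (-g j) * (w j - playProb K c w j) ≤ c j * (w j - playProb K c w j) :=
      mul_le_mul_of_nonneg_right ((neg_le_abs _).trans (hg j hj))
        (sub_nonneg.2 (playProb_le hc hw hj))
    have h3 : c j * (w j - playProb K c w j) = min (c j) y * w j - y * playProb K c w j := by
      rcases lt_trichotomy y (c j) with h | h | h
      · rw [playProb, ← hy, if_pos h, min_eq_right h.le]; ring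
      · rw [h, min_self]; ring
      · rw [playProb, ← hy, if_neg (not_lt.2 h.le), if_pos h, min_eq_left h.le]; ring
    linarith
  refine (sum_le_sum h1).trans (le_of_eq ?_)
  rw [sum_sub_distrib, ← mul_sum]
  congr 1
  by_cases h : y = 0
  · rw [h, zero_mul]
  · rw [sum_playProb_eq_one h, mul_one]

end Cutoff

/-! ### The law of the prediction and of the wealth -/

theorem iterLaw_support {S : Type*} {step : ℕ → S → PMF S} {p : PMF S} {m : ℕ}
    (I : ℕ → S → Prop) (h0 : ∀ s ∈ p.support, I 0 s)
    (hstep : ∀ i < m, ∀ s, I i s → ∀ s' ∈ (step i s).support, I (i + 1) s') :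
    ∀ s ∈ (iterLaw step p m).support, I m s := by
  induction m with
  | zero => exact h0
  | succ m ih =>
    intro s hs
    rw [iterLaw, PMF.mem_support_bind_iff] at hs
    obtain ⟨r, hr, hs⟩ := hs
    exact hstep m (by omega) r (ih (fun i hi => hstep i (by omega)) r hr) s hs

theorem mixture_support {K : ℕ} {D : ℕ → PMF ℝ} (x : ℕ → ℝ) {Q : ℝ → Prop} (h0 : Q 0)
    (hD : ∀ j < K, ∀ v ∈ (D j).support, Q v) : ∀ v ∈ (mixture K D x).support, Q v := by
  refine iterLaw_support (fun _ => Q) (by simpa using h0) fun j hj o ho v hv => ?_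
  rw [PMF.mem_support_bind_iff] at hv
  obtain ⟨b, -, hv⟩ := hv
  cases b
  · simp at hv
    exact hv ▸ ho
  · exact hD j hj v (by simpa using hv)

theorem expect_mixture {K : ℕ} {D : ℕ → PMF ℝ} {x : ℕ → ℝ} (hx : ∀ j < K, 0 ≤ x j)
    (hx1 : ∑ j ∈ range K, x j ≤ 1) {φ : ℝ → ℝ} {M : ℝ} (h0 : |φ 0| ≤ M)
    (hD : ∀ j < K, ∀ v ∈ (D j).support, |φ v| ≤ M) :
    expect (mixture K D x) φ =
      ∑ j ∈ range K, x j * expect (D j) φ + (1 - ∑ j ∈ range K, x j) * φ 0 := by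
  set X := ∑ j ∈ range K, x j with hX
  let step : ℕ → ℝ → PMF ℝ := fun j o =>
    (biasedCoin (x j / (1 - X + ∑ l ∈ range (j + 1), x l))).bind fun b =>
      if b then D j else PMF.pure o
  have hsupp : ∀ m ≤ K, ∀ v ∈ (iterLaw step (PMF.pure 0) m).support, |φ v| ≤ M := by
    intro m hm
    refine iterLaw_support (fun _ v => |φ v| ≤ M) (by simpa using h0) fun j hj o ho v hv => ?_
    rw [PMF.mem_support_bind_iff] at hv
    obtain ⟨b, -, hv⟩ := hv
    cases b
    · simp at hv
      exact hv ▸ ho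
    · exact hD j (by omega) v (by simpa using hv)
  have key : ∀ m ≤ K, (1 - X + ∑ l ∈ range m, x l) * expect (iterLaw step (PMF.pure 0) m) φ =
      ∑ j ∈ range m, x j * expect (D j) φ + (1 - X) * φ 0 := by
    intro m
    induction m with
    | zero => intro _; simp [iterLaw, expect_pure]
    | succ m ih =>
      intro hm
      have ih := ih (by omega)
      have hb : BddOn ((iterLaw step (PMF.pure 0) m).bind (step m)) φ := ⟨M, hsupp (m + 1) hm⟩
      have hnn : 0 ≤ ∑ l ∈ range m, x l :=
        sum_nonneg fun l hl => hx l (by rw [mem_range] at hl; omega)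
      have hxm := hx m (by omega)
      rw [iterLaw, expect_bind hb]
      set P := 1 - X + ∑ l ∈ range (m + 1), x l with hP
      have hPs : P = (1 - X + ∑ l ∈ range m, x l) + x m := by rw [hP, sum_range_succ]; ring
      have hP0 : 0 ≤ P := by rw [hPs]; linarith
      have hr0 : 0 ≤ x m / P := div_nonneg hxm hP0
      have hr1 : x m / P ≤ 1 := div_le_one_of_le₀ (by rw [hPs]; linarith) hP0
      have hstep : ∀ o ∈ (iterLaw step (PMF.pure 0) m).support, expect (step m o) φ =
          x m / P * expect (D m) φ + (1 - x m / P) * φ o := by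
        intro o ho
        rw [expect_bind (hb.of_bind ho), expect_biasedCoin hr0 hr1]
        simp [expect_pure]
      have hφ : BddOn (iterLaw step (PMF.pure 0) m) φ := ⟨M, hsupp m (by omega)⟩
      rw [expect_congr hstep, expect_add (BddOn.const _ _) (hφ.const_mul _), expect_const,
        expect_const_mul, sum_range_succ]
      by_cases hPz : P = 0
      · -- no mass so far: expert `m` has probability `0`, and so have the experts before it
        have e1 : x m = 0 := by linarith
        have e2 : 1 - X + ∑ l ∈ range m, x l = 0 := by linarith
        rw [e2, zero_mul] at ih
        rw [hPz, e1]
        linarith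
      · have e1 : P * (x m / P) = x m := mul_div_cancel₀ _ hPz
        have e2 : P * (1 - x m / P) = 1 - X + ∑ l ∈ range m, x l := by
          rw [mul_sub, mul_one, e1, hPs]; ring
        calc P * (x m / P * expect (D m) φ + (1 - x m / P) *
              expect (iterLaw step (PMF.pure 0) m) φ)
            = P * (x m / P) * expect (D m) φ + P * (1 - x m / P) *
              expect (iterLaw step (PMF.pure 0) m) φ := by ring
          _ = _ := by rw [e1, e2, ih]; ring
  have := key K le_rfl
  rw [← hX, sub_add_cancel, one_mul] at this
  exact this

section Wealth

variable {K : ℕ} {c β : ℕ → ℝ} {D : ℕ → PMF ℝ} {loss : ℝ → ℝ} {W : ℕ → ℝ}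

/-- The wealths of the experts after a round are updated independently of each other. -/
theorem roundStep_map {j : ℕ} (hj : j < K) :
    (roundStep K c β D loss W).map (fun V => V j) = (D j).map fun v =>
      W j * (1 - β j * (loss v - loss 0 + min (c j) (threshold K c (stake β W)))) := by
  set y := threshold K c (stake β W) with hy
  have key : ∀ m, (iterLaw (wealthStep c β D loss y) (PMF.pure W) m).map (fun V => V j) =
      if j < m then (D j).map fun v => W j * (1 - β j * (loss v - loss 0 + min (c j) y))
      else PMF.pure (W j) := by
    intro m
    induction m with
    | zero => simp [iterLaw, PMF.pure_map]
    | succ m ih =>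
      rw [iterLaw, PMF.map_bind]
      by_cases hjm : j = m
      · subst hjm
        rw [if_neg (lt_irrefl j)] at ih
        rw [if_pos (Nat.lt_succ_self j)]
        have : (fun V => (wealthStep c β D loss y j V).map fun V => V j) =
            (fun u => (D j).map fun v => u * (1 - β j * (loss v - loss 0 + min (c j) y))) ∘
              fun V => V j := by
          funext V
          rw [wealthStep, PMF.map_comp]
          congr 1
          funext v
          simp
        rw [this, ← PMF.bind_map, ih, PMF.pure_bind]
      · have : (fun V => (wealthStep c β D loss y m V).map fun V => V j) =
            PMF.pure ∘ fun V => V j := by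
          funext V
          change _ = PMF.pure (V j)
          rw [wealthStep, PMF.map_comp]
          convert PMF.map_const (D m) (V j) using 2
          funext v
          simp [hjm]
        rw [this, PMF.bind_pure_comp, ih]
        have : j < m + 1 ↔ j < m := by omega
        simp only [this]
  have := key K
  rw [if_pos hj] at this
  exact this

theorem abs_rate_mul_le (hc : ∀ j < K, 0 < c j) (hβ : ∀ j < K, 0 < β j)
    (hβc : ∀ j < K, 4 * (β j * c j) ≤ 1) {j : ℕ} (hj : j < K) {y g : ℝ} (hy : 0 ≤ y)
    (hg : |g| ≤ c j) :
    |g + min (c j) y| ≤ 2 * c j ∧ |β j * (g + min (c j) y)| ≤ 1 / 2 := by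
  have h1 : |g + min (c j) y| ≤ 2 * c j := by
    have h2 : |min (c j) y| ≤ c j := by
      rw [abs_of_nonneg (le_min (hc j hj).le hy)]
      exact min_le_left _ _
    linarith [abs_add_le g (min (c j) y)]
  refine ⟨h1, ?_⟩
  rw [abs_mul, abs_of_pos (hβ j hj)]
  have := mul_le_mul_of_nonneg_left h1 (hβ j hj).le
  linarith [hβc j hj]

theorem roundStep_support (hc : ∀ j < K, 0 < c j) (hβ : ∀ j < K, 0 < β j)
    (hβc : ∀ j < K, 4 * (β j * c j) ≤ 1)
    (hD : ∀ j < K, ∀ v ∈ (D j).support, |loss v - loss 0| ≤ c j) {V : ℕ → ℝ}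
    (hV : V ∈ (roundStep K c β D loss W).support) {j : ℕ} (hj : j < K) (hW : 0 < W j) :
    W j / 2 ≤ V j ∧ V j ≤ 2 * W j := by
  have h1 : V j ∈ ((roundStep K c β D loss W).map fun V => V j).support :=
    (PMF.mem_support_map_iff _ _ _).2 ⟨V, hV, rfl⟩
  rw [roundStep_map hj, PMF.mem_support_map_iff] at h1
  obtain ⟨v, hv, h1⟩ := h1
  have h2 := (abs_rate_mul_le hc hβ hβc hj (threshold_nonneg (w := stake β W) hc)
    (hD j hj v hv)).2
  rw [abs_le] at h2
  rw [← h1]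
  constructor <;> nlinarith

theorem neg_log_one_sub_le {z : ℝ} (hz : |z| ≤ 1 / 2) : -Real.log (1 - z) ≤ z + 2 * z ^ 2 := by
  have h := Real.abs_log_sub_add_sum_range_le (x := z) (by linarith) 1
  simp only [sum_range_one, zero_add, pow_one, Nat.cast_zero, div_one] at h
  have h2 : |z| ^ (1 + 1) / (1 - |z|) ≤ 2 * z ^ 2 := by
    rw [div_le_iff₀ (by linarith), one_add_one_eq_two, sq_abs]
    nlinarith [sq_nonneg z]
  have h3 := (abs_le.1 (h.trans h2)).1
  linarith

/-- The potential with `m` rounds to go. The regret with respect to expert `i` that can still be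
accumulated is at most its value for `a = 1`; with respect to the prediction `0`, for `a = 0`. -/
def potential (K : ℕ) (c β : ℕ → ℝ) (i : ℕ) (a : ℝ) (m : ℕ) (W : ℕ → ℝ) : ℝ :=
  ∑ j ∈ range K, W j + a * (-Real.log (W i * β i) / β i - 1 / β i + m * (8 * β i * c i ^ 2))

theorem potential_zero_nonneg {i : ℕ} (hi : i < K) (hβ : 0 < β i) {a : ℝ} (ha0 : 0 ≤ a)
    (ha1 : a ≤ 1) (hW : ∀ j < K, 0 < W j) : 0 ≤ potential K c β i a 0 W := by
  have h1 : W i ≤ ∑ j ∈ range K, W j :=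
    single_le_sum (fun j hj => (hW j (mem_range.1 hj)).le) (mem_range.2 hi)
  have h2 := Real.log_le_sub_one_of_pos (mul_pos (hW i hi) hβ)
  have h3 : -W i ≤ -Real.log (W i * β i) / β i - 1 / β i := by
    rw [← sub_div, le_div_iff₀ hβ]
    linarith
  have h4 := mul_le_mul_of_nonneg_left h3 ha0
  have h5 := mul_le_mul_of_nonneg_right ha1 (hW i hi).le
  rw [potential, Nat.cast_zero, zero_mul, add_zero]
  linarith

theorem bddOn_potential {p : PMF (ℕ → ℝ)} {lo hi : ℕ → ℝ} (hlo : ∀ j < K, 0 < lo j)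
    (hp : ∀ W ∈ p.support, ∀ j < K, lo j ≤ W j ∧ W j ≤ hi j) {i : ℕ} (hiK : i < K)
    (hβ : 0 < β i) (a : ℝ) (m : ℕ) : BddOn p (potential K c β i a m) := by
  refine BddOn.add (BddOn.sum fun j hj => ?_) (BddOn.const_mul ?_ a)
  · refine ⟨hi j, fun W hW => ?_⟩
    have := hp W hW j (mem_range.1 hj)
    rw [abs_of_nonneg ((hlo j (mem_range.1 hj)).le.trans this.1)]
    exact this.2
  · have h1 : BddOn p fun W => Real.log (W i * β i) := by
      refine ⟨max |Real.log (lo i * β i)| |Real.log (hi i * β i)|, fun W hW => ?_⟩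
      have h2 := hp W hW i hiK
      have h3 := hlo i hiK
      refine abs_le_max_abs_abs ?_ ?_
      · exact Real.log_le_log (mul_pos h3 hβ) (mul_le_mul_of_nonneg_right h2.1 hβ.le)
      · exact Real.log_le_log (mul_pos (h3.trans_le h2.1) hβ)
          (mul_le_mul_of_nonneg_right h2.2 hβ.le)
    obtain ⟨M, hM⟩ := (h1.const_mul (-1 / β i)).add
      (BddOn.const p (-(1 / β i) + m * (8 * β i * c i ^ 2)))
    refine ⟨M, fun W hW => ?_⟩
    convert hM W hW using 2
    ring

/-- In each round, the expected potential decreases at least by the expected regret. -/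
theorem expect_potential_roundStep_le (hc : ∀ j < K, 0 < c j) (hβ : ∀ j < K, 0 < β j)
    (hβc : ∀ j < K, 4 * (β j * c j) ≤ 1)
    (hD : ∀ j < K, ∀ v ∈ (D j).support, |loss v - loss 0| ≤ c j) (hW : ∀ j < K, 0 < W j)
    {i : ℕ} (hi : i < K) {a : ℝ} (ha0 : 0 ≤ a) (ha1 : a ≤ 1) (m : ℕ) :
    ∑ j ∈ range K, playProb K c (stake β W) j * expect (D j) (fun v => loss v - loss 0) -
        a * expect (D i) (fun v => loss v - loss 0) +
        expect (roundStep K c β D loss W) (potential K c β i a m) ≤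
      potential K c β i a (m + 1) W := by
  set y := threshold K c (stake β W) with hy
  have hy0 : 0 ≤ y := threshold_nonneg hc
  set e : ℕ → ℝ := fun j => expect (D j) fun v => loss v - loss 0 with he
  have hDb : ∀ j < K, BddOn (D j) fun v => loss v - loss 0 := fun j hj => ⟨c j, hD j hj⟩
  have he_abs : ∀ j < K, |e j| ≤ c j := fun j hj => abs_expect_le (hD j hj)
  have hsupp : ∀ V ∈ (roundStep K c β D loss W).support, ∀ j < K,
      W j / 2 ≤ V j ∧ V j ≤ 2 * W j := fun V hV j hj =>
    roundStep_support hc hβ hβc hD hV hj (hW j hj)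
  -- the expected wealth of each expert
  have hV : ∀ j < K, BddOn (roundStep K c β D loss W) fun V => V j := fun j hj =>
    ⟨2 * W j, fun V hV => by
      have := hsupp V hV j hj
      have h0 := hW j hj
      rw [abs_of_nonneg (by linarith)]
      exact this.2⟩
  have hEV : ∀ j < K, expect (roundStep K c β D loss W) (fun V => V j) =
      W j - (e j + min (c j) y) * stake β W j := by
    intro j hj
    rw [← expect_map (r := fun V : ℕ → ℝ => V j) (φ := fun u => u) (hV j hj), roundStep_map hj,
      expect_map (φ := fun u => u)]
    · have h1 : ∀ v, W j * (1 - β j * (loss v - loss 0 + min (c j) y)) =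
          (W j - W j * β j * min (c j) y) + (-(W j * β j)) * (loss v - loss 0) := fun v => by ring
      simp only [← hy, h1]
      rw [expect_add (BddOn.const _ _) ((hDb j hj).const_mul _), expect_const, expect_const_mul,
        stake]
      ring
    · obtain ⟨M, hM⟩ := (BddOn.const (D j) (W j - W j * β j * min (c j) y)).add
        ((hDb j hj).const_mul (-(W j * β j)))
      refine ⟨M, fun v hv => ?_⟩
      convert hM v hv using 2
      ring
  -- the expected logarithm of the wealth of expert `i`
  have hlogb : BddOn (roundStep K c β D loss W) fun V => -Real.log (V i * β i) / β i - 1 / β i +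
      m * (8 * β i * c i ^ 2) := by
    obtain ⟨M, hM⟩ := bddOn_potential (c := c) (β := β) (lo := fun j => W j / 2)
      (hi := fun j => 2 * W j) (fun j hj => half_pos (hW j hj)) hsupp hi (hβ i hi) 1 m
    obtain ⟨M', hM'⟩ := BddOn.sum (s := range K) (F := fun j (V : ℕ → ℝ) => V j) fun j hj =>
      hV j (mem_range.1 hj)
    refine ⟨M + M', fun V hV => ?_⟩
    have h1 := hM V hV
    have h2 := hM' V hV
    rw [potential, one_mul] at h1
    rw [abs_le] at h1 h2 ⊢
    constructor <;> linarith [h1.1, h1.2, h2.1, h2.2]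
  have hlog : expect (roundStep K c β D loss W) (fun V => -Real.log (V i * β i) / β i - 1 / β i +
      m * (8 * β i * c i ^ 2)) ≤ -Real.log (W i * β i) / β i - 1 / β i +
      (m + 1 : ℕ) * (8 * β i * c i ^ 2) + (e i + min (c i) y) := by
    rw [← expect_map (r := fun V : ℕ → ℝ => V i)
      (φ := fun u => -Real.log (u * β i) / β i - 1 / β i + m * (8 * β i * c i ^ 2)) hlogb,
      roundStep_map hi]
    have hlogb' := hlogb
    obtain ⟨M, hM⟩ := hlogb'
    have hb : BddOn (D i) fun v => -Real.log (W i * (1 - β i * (loss v - loss 0 +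
        min (c i) y)) * β i) / β i - 1 / β i + m * (8 * β i * c i ^ 2) := by
      refine ⟨M, fun v hv => ?_⟩
      have h1 : W i * (1 - β i * (loss v - loss 0 + min (c i) y)) ∈
          ((roundStep K c β D loss W).map fun V => V i).support := by
        rw [roundStep_map hi, PMF.mem_support_map_iff]
        exact ⟨v, hv, rfl⟩
      obtain ⟨V, hV, h2⟩ := (PMF.mem_support_map_iff _ _ _).1 h1
      have := hM V hV
      beta_reduce at this
      rw [h2] at this
      exact this
    rw [expect_map hb]
    have hb2 : BddOn (D i) fun v => (-Real.log (W i * β i) / β i - 1 / β i +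
        (m + 1 : ℕ) * (8 * β i * c i ^ 2) + min (c i) y) + (loss v - loss 0) :=
      (BddOn.const _ _).add (hDb i hi)
    refine (expect_mono hb hb2 fun v hv => ?_).trans (le_of_eq ?_)
    · obtain ⟨h1, h2⟩ := abs_rate_mul_le hc hβ hβc hi hy0 (hD i hi v hv)
      set g := loss v - loss 0 + min (c i) y with hg
      have h3 := neg_log_one_sub_le h2
      have hβi := hβ i hi
      have h4 : 0 < 1 - β i * g := by linarith [(abs_le.1 h2).2]
      have h5 : Real.log (W i * (1 - β i * g) * β i) =
          Real.log (W i * β i) + Real.log (1 - β i * g) := by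
        rw [← Real.log_mul (mul_pos (hW i hi) hβi).ne' h4.ne']
        congr 1
        ring
      have h6 : g ^ 2 ≤ 4 * c i ^ 2 := by
        have := sq_le_sq' (by linarith [(abs_le.1 h1).1]) (abs_le.1 h1).2
        linarith
      have h7 : -Real.log (1 - β i * g) / β i ≤ g + 8 * β i * c i ^ 2 := by
        rw [div_le_iff₀ hβi]
        have := mul_le_mul_of_nonneg_left h6 (mul_pos hβi hβi).le
        nlinarith
      have h8 : -Real.log (W i * (1 - β i * g) * β i) / β i =
          -Real.log (W i * β i) / β i + -Real.log (1 - β i * g) / β i := by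
        rw [h5]; ring
      rw [h8]
      push_cast
      linarith
    · rw [expect_add (BddOn.const _ _) (hDb i hi), expect_const]
      ring
  have hpot : expect (roundStep K c β D loss W) (potential K c β i a m) =
      ∑ j ∈ range K, (W j - (e j + min (c j) y) * stake β W j) +
      a * expect (roundStep K c β D loss W) (fun V => -Real.log (V i * β i) / β i - 1 / β i +
        m * (8 * β i * c i ^ 2)) := by
    rw [show potential K c β i a m = fun V => ∑ j ∈ range K, V j + a * (-Real.log (V i * β i) /
      β i - 1 / β i + m * (8 * β i * c i ^ 2)) from rfl,
      expect_add (BddOn.sum fun j hj => hV j (mem_range.1 hj)) (hlogb.const_mul a),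
      expect_const_mul, expect_sum fun j hj => hV j (mem_range.1 hj)]
    congr 1
    exact sum_congr rfl fun j hj => hEV j (mem_range.1 hj)
  have hcut := sum_mul_playProb_le (w := stake β W) hc
    (fun j hj => (mul_pos (hβ j hj) (hW j hj)).le) he_abs
  rw [← hy] at hcut
  have hcomm : ∑ j ∈ range K, playProb K c (stake β W) j * e j =
      ∑ j ∈ range K, e j * playProb K c (stake β W) j := sum_congr rfl fun j _ => mul_comm _ _
  have h1 := mul_le_mul_of_nonneg_left hlog ha0
  have h2 : a * min (c i) y ≤ y := by
    have := mul_le_mul_of_nonneg_right ha1 (le_min (hc i hi).le hy0)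
    linarith [min_le_right (c i) y]
  change ∑ j ∈ range K, playProb K c (stake β W) j * e j - a * e i + _ ≤ _
  rw [hpot, hcomm, sum_sub_distrib, potential]
  push_cast at h1 ⊢
  linarith

end Wealth

/-! ### The scales, rates and initial wealths of the experts -/

section Parameters

variable {n N : ℕ} {L : ℝ} {b : ℕ → ℝ}

theorem div_lt_of_lt_mul {j : ℕ} (hj : j < N * (n + 1)) : j / (n + 1) < N :=
  Nat.div_lt_of_lt_mul (by rwa [mul_comm])

theorem one_le_radius (n j : ℕ) : 1 ≤ radius n j := one_le_pow₀ one_le_two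

theorem radius_le_scale (hb : ∀ k < N, 1 ≤ L * b k) {j : ℕ} (hj : j < N * (n + 1)) :
    radius n j ≤ scale n L b j := by
  have h1 := hb _ (div_lt_of_lt_mul hj)
  have h2 := one_le_radius n j
  rw [scale, ← mul_assoc]
  nlinarith

theorem scale_pos (hb : ∀ k < N, 1 ≤ L * b k) {j : ℕ} (hj : j < N * (n + 1)) :
    0 < scale n L b j := by
  linarith [radius_le_scale hb hj, one_le_radius n j]

theorem two_le_complexity_arg (hn : 2 ≤ n) (hb : ∀ k < N, 1 ≤ L * b k) {j : ℕ}
    (hj : j < N * (n + 1)) : 2 ≤ scale n L b j * ((j / (n + 1) : ℕ) + 1) * n := by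
  have h1 : 1 ≤ scale n L b j := (one_le_radius n j).trans (radius_le_scale hb hj)
  have h2 : (1 : ℝ) ≤ ((j / (n + 1) : ℕ) : ℝ) + 1 := by
    have : (0 : ℝ) ≤ ((j / (n + 1) : ℕ) : ℝ) := Nat.cast_nonneg _
    linarith
  have h3 : (2 : ℝ) ≤ n := by exact_mod_cast hn
  have h4 : 1 ≤ scale n L b j * (((j / (n + 1) : ℕ) : ℝ) + 1) := one_le_mul_of_one_le_of_one_le h1 h2
  nlinarith

theorem half_lt_complexity (hn : 2 ≤ n) (hb : ∀ k < N, 1 ≤ L * b k) {j : ℕ}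
    (hj : j < N * (n + 1)) : 1 / 2 < complexity n L b j := by
  have h1 := Real.log_le_log two_pos (two_le_complexity_arg hn hb hj)
  have h2 := Real.log_two_gt_d9
  rw [complexity]
  linarith

theorem rate_pos (hn : 2 ≤ n) (hb : ∀ k < N, 1 ≤ L * b k) {j : ℕ} (hj : j < N * (n + 1)) :
    0 < rate n L b j := by
  have h1 := half_lt_complexity hn hb hj
  have h2 := scale_pos hb hj
  have h3 : (0 : ℝ) ≤ n := Nat.cast_nonneg n
  exact div_pos (Real.sqrt_pos.2 (div_pos (by linarith) (by linarith))) (by linarith)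

theorem four_mul_rate_mul_scale (hb : ∀ k < N, 1 ≤ L * b k) {j : ℕ}
    (hj : j < N * (n + 1)) : 4 * (rate n L b j * scale n L b j) =
      √(complexity n L b j / (n + complexity n L b j)) := by
  have h2 := scale_pos hb hj
  rw [rate]
  field_simp

theorem four_mul_rate_mul_scale_le (hn : 2 ≤ n) (hb : ∀ k < N, 1 ≤ L * b k) {j : ℕ}
    (hj : j < N * (n + 1)) : 4 * (rate n L b j * scale n L b j) ≤ 1 := by
  have h1 := half_lt_complexity hn hb hj
  have h3 : (0 : ℝ) ≤ n := Nat.cast_nonneg n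
  rw [four_mul_rate_mul_scale hb hj]
  exact Real.sqrt_le_one.2 (div_le_one_of_le₀ (by linarith) (by linarith))

theorem prior_pos (n j : ℕ) : 0 < prior n j := by
  have h1 := one_le_radius n j
  have h2 : (0 : ℝ) ≤ ((j / (n + 1) : ℕ) : ℝ) := Nat.cast_nonneg _
  rw [prior]
  positivity

theorem sum_prior_le (n N : ℕ) : ∑ j ∈ range (N * (n + 1)), prior n j ≤ 2 * (1 - 1 / (N + 1)) := by
  induction N with
  | zero => simp
  | succ N ih =>
    rw [Nat.succ_mul, sum_range_add]
    have h1 : ∑ i ∈ range (n + 1), prior n (N * (n + 1) + i) =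
        1 / (((N : ℝ) + 1) * (N + 2)) * ∑ i ∈ range (n + 1), (1 / 2 : ℝ) ^ i := by
      rw [mul_sum]
      refine sum_congr rfl fun i hi => ?_
      rw [mem_range] at hi
      rw [prior, radius, index_div hi, index_mod hi, one_div_pow]
      field_simp
    have h2 : ∑ i ∈ range (n + 1), (1 / 2 : ℝ) ^ i ≤ 2 := by
      rw [geom_sum_eq (by norm_num)]
      have e1 : (0 : ℝ) < (1 / 2) ^ (n + 1) := by positivity
      have e2 : ((1 / 2 : ℝ) ^ (n + 1) - 1) / (1 / 2 - 1) = 2 - 2 * (1 / 2) ^ (n + 1) := by ring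
      linarith
    have h3 : (0 : ℝ) ≤ N := Nat.cast_nonneg N
    have h4 : 1 / (((N : ℝ) + 1) * (N + 2)) = 1 / (N + 1) - 1 / (N + 2) := by
      field_simp
      ring
    have h5 : (0 : ℝ) ≤ 1 / (((N : ℝ) + 1) * (N + 2)) := by positivity
    rw [h1]
    have h6 := mul_le_mul_of_nonneg_left h2 h5
    push_cast
    rw [show (N : ℝ) + 1 + 1 = N + 2 by ring]
    linarith

end Parameters

/-! ### One round of the game -/

section Round

variable {n N : ℕ} {L : ℝ} {b : ℕ → ℝ} {O O' : Oracle} {t : ℕ}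

theorem wealthLaw_congr (hs : ∀ s < t, ∀ k R, O.sub k R s = O'.sub k R s)
    (hl : ∀ s < t, ∀ v, O.loss v s = O'.loss v s) :
    wealthLaw n N L b O t = wealthLaw n N L b O' t := by
  refine iterLaw_congr _ fun s hst => ?_
  have h1 : expertLaw O n s = expertLaw O' n s := funext fun j => hs s hst _ _
  have h2 : (fun v => O.loss v s) = fun v => O'.loss v s := funext fun v => hl s hst v
  rw [h1, h2]

theorem predictionLaw_congr (hs : ∀ s ≤ t, ∀ k R, O.sub k R s = O'.sub k R s)
    (hl : ∀ s < t, ∀ v, O.loss v s = O'.loss v s) :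
    predictionLaw n N L b O t = predictionLaw n N L b O' t := by
  have h1 : expertLaw O n t = expertLaw O' n t := funext fun j => hs t le_rfl _ _
  rw [predictionLaw, predictionLaw, wealthLaw_congr (fun s hst => hs s hst.le) hl, h1]

variable (n N L b O) in
/-- In round `s`, the losses of the experts relative to the prediction `0` are bounded by their
scales. -/
def LossesBounded (s : ℕ) : Prop :=
  ∀ j < N * (n + 1), ∀ v ∈ (expertLaw O n s j).support, |O.loss v s - O.loss 0 s| ≤ scale n L b j

theorem wealthLaw_support (hn : 2 ≤ n) (hb : ∀ k < N, 1 ≤ L * b k)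
    (hO : ∀ s < t, LossesBounded n N L b O s) {W : ℕ → ℝ}
    (hW : W ∈ (wealthLaw n N L b O t).support) {j : ℕ} (hj : j < N * (n + 1)) :
    prior n j / 2 ^ t ≤ W j ∧ W j ≤ prior n j * 2 ^ t := by
  refine iterLaw_support (fun s W => ∀ j < N * (n + 1), prior n j / 2 ^ s ≤ W j ∧
    W j ≤ prior n j * 2 ^ s) ?_ ?_ W hW j hj
  · intro W hW j hj
    simp only [PMF.support_pure, Set.mem_singleton_iff] at hW
    simp [hW, hj]
  · intro s hs W hW V hV j hj
    have h1 : 0 < W j := lt_of_lt_of_le (div_pos (prior_pos n j) (by positivity)) (hW j hj).1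
    have h2 := roundStep_support (fun j hj => scale_pos hb hj) (fun j hj => rate_pos hn hb hj)
      (fun j hj => four_mul_rate_mul_scale_le hn hb hj) (hO s hs) hV hj h1
    have h3 := hW j hj
    rw [pow_succ, ← div_div, ← mul_assoc]
    constructor <;> linarith [h3.1, h3.2, h2.1, h2.2]

theorem wealthLaw_pos (hn : 2 ≤ n) (hb : ∀ k < N, 1 ≤ L * b k)
    (hO : ∀ s < t, LossesBounded n N L b O s) {W : ℕ → ℝ}
    (hW : W ∈ (wealthLaw n N L b O t).support) {j : ℕ} (hj : j < N * (n + 1)) : 0 < W j :=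
  lt_of_lt_of_le (div_pos (prior_pos n j) (by positivity)) (wealthLaw_support hn hb hO hW hj).1

theorem bddOn_wealthLaw_potential (hn : 2 ≤ n) (hb : ∀ k < N, 1 ≤ L * b k)
    (hO : ∀ s < t, LossesBounded n N L b O s) {i : ℕ} (hi : i < N * (n + 1)) (a : ℝ) (m : ℕ) :
    BddOn (wealthLaw n N L b O t)
      (potential (N * (n + 1)) (scale n L b) (rate n L b) i a m) :=
  bddOn_potential (lo := fun j => prior n j / 2 ^ t) (hi := fun j => prior n j * 2 ^ t)
    (fun j _ => div_pos (prior_pos n j) (by positivity))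
    (fun _ hW _ hj => wealthLaw_support hn hb hO hW hj) hi (rate_pos hn hb hi) a m

/-- One round of the game: the expected regret of the learner is at most the decrease of the
expected potential. -/
theorem expect_predictionLaw_add_le (hn : 2 ≤ n) (hb : ∀ k < N, 1 ≤ L * b k)
    (hO : ∀ s < t + 1, LossesBounded n N L b O s) {i : ℕ} (hi : i < N * (n + 1)) {a : ℝ}
    (ha0 : 0 ≤ a) (ha1 : a ≤ 1) (m : ℕ) :
    expect (predictionLaw n N L b O t) (fun v => O.loss v t - O.loss 0 t) -
        a * expect (expertLaw O n t i) (fun v => O.loss v t - O.loss 0 t) +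
        expect (wealthLaw n N L b O (t + 1))
          (potential (N * (n + 1)) (scale n L b) (rate n L b) i a m) ≤
      expect (wealthLaw n N L b O t)
        (potential (N * (n + 1)) (scale n L b) (rate n L b) i a (m + 1)) := by
  set K := N * (n + 1) with hK
  set c := scale n L b with hc
  set β := rate n L b with hβ
  set φ : ℝ → ℝ := fun v => O.loss v t - O.loss 0 t with hφ
  have hcp : ∀ j < K, 0 < c j := fun j hj => scale_pos hb hj
  have hβp : ∀ j < K, 0 < β j := fun j hj => rate_pos hn hb hj
  have hβc : ∀ j < K, 4 * (β j * c j) ≤ 1 := fun j hj => four_mul_rate_mul_scale_le hn hb hj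
  have hO' : ∀ s < t, LossesBounded n N L b O s := fun s hs => hO s (by omega)
  have hOt := hO t (by omega)
  have hWp : ∀ W ∈ (wealthLaw n N L b O t).support, ∀ j < K, 0 < W j := fun W hW j hj =>
    wealthLaw_pos hn hb hO' hW hj
  -- a common bound for the losses of the experts
  have hM : ∀ j < K, ∀ v ∈ (expertLaw O n t j).support, |φ v| ≤ ∑ l ∈ range K, c l :=
    fun j hj v hv => (hOt j hj v hv).trans
      (single_le_sum (fun l hl => (hcp l (mem_range.1 hl)).le) (mem_range.2 hj))
  have hM0 : |φ 0| ≤ ∑ l ∈ range K, c l := by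
    simp only [hφ, sub_self, abs_zero]
    exact sum_nonneg fun l hl => (hcp l (mem_range.1 hl)).le
  have hmix : ∀ W ∈ (wealthLaw n N L b O t).support,
      expect (mixture K (expertLaw O n t) (playProb K c (stake β W))) φ =
        ∑ j ∈ range K, playProb K c (stake β W) j * expect (expertLaw O n t j) φ := by
    intro W hW
    have hw : ∀ j < K, 0 ≤ stake β W j := fun j hj => (mul_pos (hβp j hj) (hWp W hW j hj)).le
    rw [expect_mixture (fun j hj => playProb_nonneg hcp hw hj) (sum_playProb_le_one hcp) hM0 hM]
    simp [hφ]
  have hb1 : BddOn (predictionLaw n N L b O t) φ := by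
    refine ⟨∑ l ∈ range K, c l, fun v hv => ?_⟩
    rw [predictionLaw, PMF.mem_support_bind_iff] at hv
    obtain ⟨W, -, hv⟩ := hv
    exact mixture_support _ (Q := fun v => |φ v| ≤ ∑ l ∈ range K, c l) hM0 hM v hv
  have hb2 := bddOn_wealthLaw_potential hn hb hO hi a m
  have h1 : expect (predictionLaw n N L b O t) φ = expect (wealthLaw n N L b O t) fun W =>
      expect (mixture K (expertLaw O n t) (playProb K c (stake β W))) φ := expect_bind hb1
  have h2 : expect (wealthLaw n N L b O (t + 1)) (potential K c β i a m) =
      expect (wealthLaw n N L b O t) fun W =>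
        expect (roundStep K c β (expertLaw O n t) (fun v => O.loss v t) W)
          (potential K c β i a m) := expect_bind hb2
  have hb1' : BddOn (wealthLaw n N L b O t) fun W =>
      expect (mixture K (expertLaw O n t) (playProb K c (stake β W))) φ :=
    BddOn.expect_of_bind hb1
  have hb2' : BddOn (wealthLaw n N L b O t) fun W =>
      expect (roundStep K c β (expertLaw O n t) (fun v => O.loss v t) W)
        (potential K c β i a m) := BddOn.expect_of_bind hb2
  have h3 := expect_mono ((hb1'.add (BddOn.const _ (-(a * expect (expertLaw O n t i) φ)))).add hb2')
    (bddOn_wealthLaw_potential hn hb hO' hi a (m + 1)) (fun W hW => ?_)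
  · rw [expect_add (hb1'.add (BddOn.const _ _)) hb2', expect_add hb1' (BddOn.const _ _),
      expect_const, ← h1, ← h2] at h3
    linarith
  · rw [hmix W hW]
    have := expect_potential_roundStep_le (loss := fun v => O.loss v t) hcp hβp hβc hOt
      (hWp W hW) hi ha0 ha1 m
    linarith

end Round

/-! ### The regret over all rounds -/

section Regret

variable {X Y : Type*} {ℓ : ℝ → Y → ℝ}

/-- The sum of `G past z` along the list `rest`, where `past` consists of `acc` and the entries of
`rest` before `z`. -/
def pathSum (G : List (X × Y) → X × Y → ℝ) : List (X × Y) → List (X × Y) → ℝ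
  | _, [] => 0
  | acc, z :: rest => G acc z + pathSum G (acc ++ [z]) rest

theorem pathSum_append (G : List (X × Y) → X × Y → ℝ) (acc rest : List (X × Y)) (z : X × Y) :
    pathSum G acc (rest ++ [z]) = pathSum G acc rest + G (acc ++ rest) z := by
  induction rest generalizing acc with
  | nil => simp [pathSum]
  | cons y rest ih => simp [pathSum, ih, add_assoc]

theorem regretFrom_succ (A : Strategy X Y) (ν : Nature X Y) (f : X → ℝ) (m : ℕ)
    (h : List (X × Y × ℝ)) : regretFrom ℓ A ν f (m + 1) h =
      expect (A (h.map fun z => (z.1, z.2.1)) (ν.ctx h)) fun v =>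
        ℓ v (ν.out h (ν.ctx h) (A (h.map fun z => (z.1, z.2.1)) (ν.ctx h))) -
        ℓ (f (ν.ctx h)) (ν.out h (ν.ctx h) (A (h.map fun z => (z.1, z.2.1)) (ν.ctx h))) +
        regretFrom ℓ A ν f m (h ++ [(ν.ctx h, ν.out h (ν.ctx h)
          (A (h.map fun z => (z.1, z.2.1)) (ν.ctx h)), v)]) := rfl

/-- Nature that plays the pairs of `path`, whatever the learner does. -/
def obliviousNature (d : X × Y) (path : List (X × Y)) : Nature X Y where
  ctx h := (path.getD h.length d).1
  out h _ _ := (path.getD h.length d).2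

theorem bddOn_loss {L M : ℝ} (hL : 0 ≤ L) (hℓ : ∀ y u v, |ℓ u y - ℓ v y| ≤ L * |u - v|)
    {p : PMF ℝ} (hp : ∀ v ∈ p.support, |v| ≤ M) (y : Y) : BddOn p fun v => ℓ v y - ℓ 0 y := by
  refine ⟨L * M, fun v hv => (hℓ y v 0).trans ?_⟩
  rw [sub_zero]
  exact mul_le_mul_of_nonneg_left (hp v hv) hL

/-- Against an oblivious Nature, the expected regret of a learner that does not see its own
predictions is a sum over the rounds. -/
theorem regretFrom_obliviousNature {L M : ℝ} (hL : 0 ≤ L)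
    (hℓ : ∀ y u v, |ℓ u y - ℓ v y| ≤ L * |u - v|) {A : Strategy X Y} {n : ℕ}
    (hA : PredictsIn A n M) (d : X × Y) (f : X → ℝ) (path rest : List (X × Y))
    (h : List (X × Y × ℝ)) (hpath : path = h.map (fun z => (z.1, z.2.1)) ++ rest)
    (hlen : path.length ≤ n) :
    regretFrom ℓ A (obliviousNature d path) f rest.length h =
      pathSum (fun past z => expect (A past z.1) (fun v => ℓ v z.2 - ℓ 0 z.2) -
        (ℓ (f z.1) z.2 - ℓ 0 z.2)) (h.map fun z => (z.1, z.2.1)) rest := by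
  induction rest generalizing h with
  | nil => rfl
  | cons z rest ih =>
    have hget : path.getD h.length d = z := by
      rw [hpath, List.getD_append_right _ _ _ _ (by simp)]
      simp
    rw [List.length_cons, regretFrom_succ, pathSum]
    have hctx : (obliviousNature d path).ctx h = z.1 := congrArg Prod.fst hget
    have hout : ∀ x q, (obliviousNature d path).out h x q = z.2 := fun x q =>
      congrArg Prod.snd hget
    rw [hctx]
    simp only [hout]
    have hih : ∀ v, regretFrom ℓ A (obliviousNature d path) f rest.length
        (h ++ [(z.1, z.2, v)]) = pathSum (fun past z => expect (A past z.1)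
        (fun v => ℓ v z.2 - ℓ 0 z.2) - (ℓ (f z.1) z.2 - ℓ 0 z.2))
        (h.map (fun z => (z.1, z.2.1)) ++ [z]) rest := by
      intro v
      rw [ih (h ++ [(z.1, z.2, v)]) (by simp [hpath])]
      simp
    simp only [hih]
    have hb := bddOn_loss hL hℓ (hA (h.map fun z => (z.1, z.2.1)) z.1
      (by rw [hpath] at hlen; simp at hlen ⊢; omega)) z.2
    set S := pathSum (fun past z => expect (A past z.1)
        (fun v => ℓ v z.2 - ℓ 0 z.2) - (ℓ (f z.1) z.2 - ℓ 0 z.2))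
        (h.map (fun z => (z.1, z.2.1)) ++ [z]) rest
    have : ∀ v, ℓ v z.2 - ℓ (f z.1) z.2 + S =
        (ℓ v z.2 - ℓ 0 z.2) + (-(ℓ (f z.1) z.2 - ℓ 0 z.2) + S) := fun v => by ring
    simp only [this]
    rw [expect_add hb (BddOn.const _ _), expect_const]
    ring

theorem pathSum_le_of_expectedRegret_le {L M : ℝ} (hL : 0 ≤ L)
    (hℓ : ∀ y u v, |ℓ u y - ℓ v y| ≤ L * |u - v|) {A : Strategy X Y} {n : ℕ}
    (hA : PredictsIn A n M) (d : X × Y) (f : X → ℝ) {R : ℝ}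
    (hR : ∀ ν : Nature X Y, expectedRegret ℓ A ν f n ≤ R) (path : List (X × Y))
    (hlen : path.length = n) :
    pathSum (fun past z => expect (A past z.1) (fun v => ℓ v z.2 - ℓ 0 z.2) -
        (ℓ (f z.1) z.2 - ℓ 0 z.2)) [] path ≤ R := by
  have h1 := regretFrom_obliviousNature hL hℓ hA d f path path [] rfl hlen.le
  have h2 := hR (obliviousNature d path)
  rw [expectedRegret, ← hlen, h1] at h2
  exact h2

theorem pathSum_le_length_mul (G : List (X × Y) → X × Y → ℝ) {r : ℝ} (hG : ∀ past z, G past z ≤ r)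
    (acc rest : List (X × Y)) : pathSum G acc rest ≤ rest.length * r := by
  induction rest generalizing acc with
  | nil => simp [pathSum]
  | cons z rest ih =>
    have h1 := hG acc z
    have h2 := ih (acc ++ [z])
    rw [pathSum, List.length_cons]
    push_cast
    linarith

theorem abs_regretFrom_le {L M F : ℝ} (hL : 0 ≤ L)
    (hℓ : ∀ y u v, |ℓ u y - ℓ v y| ≤ L * |u - v|) {A : Strategy X Y} {n : ℕ}
    (hA : PredictsIn A n M) (ν : Nature X Y) {f : X → ℝ} (hf : ∀ x, |f x| ≤ F) (m : ℕ)
    (h : List (X × Y × ℝ)) (hlen : h.length + m ≤ n) :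
    |regretFrom ℓ A ν f m h| ≤ m * (L * (M + F)) := by
  induction m generalizing h with
  | zero => simp [regretFrom]
  | succ m ih =>
    rw [regretFrom_succ]
    refine abs_expect_le fun v hv => ?_
    have hv : |v| ≤ M := hA _ _ (by simp; omega) v hv
    refine (abs_add_le _ _).trans ?_
    refine (add_le_add (hℓ _ _ _) (ih _ (by simp; omega))).trans ?_
    have h1 : |v - f (ν.ctx h)| ≤ M + F := (abs_sub _ _).trans (add_le_add hv (hf _))
    have h2 := mul_le_mul_of_nonneg_left h1 hL
    push_cast
    linarith

variable {n N T : ℕ} {L : ℝ} {B : Fin N → ℝ} {A : Fin N → ℝ → Strategy X Y}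

/-- The bounds on the kernels, extended by zero. -/
def extendZero {N : ℕ} (B : Fin N → ℝ) (k : ℕ) : ℝ := if h : k < N then B ⟨k, h⟩ else 0

theorem extendZero_fin (k : Fin N) : extendZero B k = B k := by
  simp [extendZero]

/-- The learner predicts according to the multi-scale algorithm. -/
theorem learner_eq (hn : 2 ≤ n) (past : List (X × Y)) (x : X) :
    learner program n L B ℓ A T past x =
      predictionLaw n N L (extendZero B) (oracleAt ℓ A T past x) past.length := by
  refine program_map hn (by simp [initState]) (by simp [initState]) (by simp [initState])
    (by simp [initState]) ?_ (by simp [initState]) ?_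
  · funext i
    simp [initState, extendZero]
  · funext i
    simp [initState]

theorem learner_eq_of_lt_two (hn : n < 2) (past : List (X × Y)) (x : X) :
    learner program n L B ℓ A T past x = PMF.pure 0 := by
  rw [learner, roundRun, program, run_ite_pos]
  · simp [Cmd.run, PMF.pure_map, State.tick, initState]
  · simpa [Test.holds, NExpr.eval, initState] using hn

theorem oracleAt_sub_append {past : List (X × Y)} {x x' : X} {z : X × Y} (hz : z.1 = x) {s : ℕ}
    (hs : s ≤ past.length) (k : ℕ) (R : ℝ) :
    (oracleAt ℓ A T past x).sub k R s = (oracleAt ℓ A T (past ++ [z]) x').sub k R s := by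
  have h1 : s < (past ++ [z]).length := by simp; omega
  simp only [oracleAt, dif_pos h1]
  rcases hs.lt_or_eq with h2 | rfl
  · simp only [dif_pos h2]
    rw [List.take_append_of_le_length hs, List.getElem_append_left h2]
  · simp [hz]

theorem oracleAt_loss_append {past : List (X × Y)} {x x' : X} {z : X × Y} {s : ℕ}
    (hs : s < past.length) (v : ℝ) :
    (oracleAt ℓ A T past x).loss v s = (oracleAt ℓ A T (past ++ [z]) x').loss v s := by
  have h : s < (past ++ [z]).length := by simp; omega
  simp only [oracleAt]
  rw [dif_pos hs, dif_pos h, List.getElem_append_left hs]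

theorem oracleAt_sub_self {past : List (X × Y)} {x : X} (k : Fin N) (R : ℝ) :
    (oracleAt ℓ A T past x).sub k R past.length = A k R past x := by
  simp [oracleAt]

theorem oracleAt_loss_last {past : List (X × Y)} {x : X} {z : X × Y} (v : ℝ) :
    (oracleAt ℓ A T (past ++ [z]) x).loss v past.length = ℓ v z.2 := by
  simp [oracleAt]

theorem expertLaw_oracleAt_support (hA : ∀ k R, 0 < R → PredictsIn (A k R) n (B k * R))
    {past : List (X × Y)} {x : X} {s : ℕ} (hs : s ≤ past.length) (hsn : s < n) {j : ℕ}
    (hj : j < N * (n + 1)) {v : ℝ}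
    (hv : v ∈ (expertLaw (oracleAt ℓ A T past x) n s j).support) :
    |v| ≤ extendZero B (j / (n + 1)) * radius n j := by
  have hk := div_lt_of_lt_mul hj
  have hR : 0 < radius n j := by linarith [one_le_radius n j]
  rw [extendZero, dif_pos hk]
  simp only [expertLaw, oracleAt, dif_pos hk] at hv
  split_ifs at hv with h1 h2
  · exact hA _ _ hR _ _ (by simp; omega) v hv
  · exact hA _ _ hR _ _ (by omega) v hv
  · omega

theorem lossesBounded_oracleAt (hL : 0 < L) (hℓ : ∀ y u v, |ℓ u y - ℓ v y| ≤ L * |u - v|)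
    (hA : ∀ k R, 0 < R → PredictsIn (A k R) n (B k * R)) {past : List (X × Y)} {x : X} {s : ℕ}
    (hs : s < past.length) (hsn : s < n) :
    LossesBounded n N L (extendZero B) (oracleAt ℓ A T past x) s := by
  intro j hj v hv
  have h1 := expertLaw_oracleAt_support hA hs.le hsn hj hv
  have h2 : |(oracleAt ℓ A T past x).loss v s - (oracleAt ℓ A T past x).loss 0 s| ≤ L * |v| := by
    simp only [oracleAt, dif_pos hs]
    simpa using hℓ (past[s]).2 v 0
  exact h2.trans (mul_le_mul_of_nonneg_left h1 hL.le)

theorem learner_predictsIn (hB : ∀ k, 0 ≤ B k)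
    (hA : ∀ k R, 0 < R → PredictsIn (A k R) n (B k * R)) :
    PredictsIn (learner program n L B ℓ A T) n
      (∑ j ∈ range (N * (n + 1)), extendZero B (j / (n + 1)) * radius n j) := by
  have hnn : ∀ j ∈ range (N * (n + 1)), 0 ≤ extendZero B (j / (n + 1)) * radius n j := by
    intro j _
    refine mul_nonneg ?_ (by linarith [one_le_radius n j])
    rw [extendZero]
    split_ifs
    · exact hB _
    · exact le_rfl
  intro past x hlen v hv
  rcases Nat.lt_or_ge n 2 with hn | hn
  · rw [learner_eq_of_lt_two hn] at hv
    simp only [PMF.support_pure, Set.mem_singleton_iff] at hv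
    rw [hv, abs_zero]
    exact sum_nonneg hnn
  · rw [learner_eq hn, predictionLaw, PMF.mem_support_bind_iff] at hv
    obtain ⟨W, -, hv⟩ := hv
    refine mixture_support _ (Q := fun v => |v| ≤ ∑ j ∈ range (N * (n + 1)),
      extendZero B (j / (n + 1)) * radius n j) (by simpa using sum_nonneg hnn) ?_ v hv
    intro j hj v hv
    exact (expertLaw_oracleAt_support hA le_rfl hlen hj hv).trans
      (single_le_sum (f := fun j => extendZero B (j / (n + 1)) * radius n j) hnn
        (mem_range.2 hj))

/-- A bound for the learner's regret, given a bound `R` that holds along every sequence of contexts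
and outcomes for the regret of expert `k * (n + 1) + i` (if `a = 1`) or of the prediction `0`
(if `a = 0`). -/
theorem expectedRegret_learner_le (hn : 2 ≤ n) (hL : 0 < L) (hLB : ∀ k, 1 ≤ L * B k)
    (hℓ : ∀ y u v, |ℓ u y - ℓ v y| ≤ L * |u - v|)
    (hA : ∀ k R, 0 < R → PredictsIn (A k R) n (B k * R)) (k : Fin N) {i : ℕ} (hi : i < n + 1)
    {a : ℝ} (ha0 : 0 ≤ a) (ha1 : a ≤ 1) (ν : Nature X Y) {f : X → ℝ} {F : ℝ}
    (hf : ∀ x, |f x| ≤ F) {R : ℝ}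
    (hR : ∀ path : List (X × Y), path.length = n → pathSum (fun past z =>
      a * expect (A k (2 ^ i) past z.1) (fun v => ℓ v z.2 - ℓ 0 z.2) -
        (ℓ (f z.1) z.2 - ℓ 0 z.2)) [] path ≤ R) :
    expectedRegret ℓ (learner program n L B ℓ A T) ν f n ≤
      potential (N * (n + 1)) (scale n L (extendZero B)) (rate n L (extendZero B))
        (k * (n + 1) + i) a n (fun j => if j < N * (n + 1) then prior n j else 0) + R := by
  have hb : ∀ k < N, 1 ≤ L * extendZero B k := fun k hk => by
    rw [extendZero, dif_pos hk]
    exact hLB _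
  have hB : ∀ k, 0 ≤ B k := fun k => by
    by_contra h
    have := mul_neg_of_pos_of_neg hL (not_le.1 h)
    linarith [hLB k]
  have hP := learner_predictsIn (ℓ := ℓ) (L := L) (T := T) hB hA
  have hj := index_lt k.2 hi
  set G : List (X × Y) → X × Y → ℝ := fun past z =>
    a * expect (A k (2 ^ i) past z.1) (fun v => ℓ v z.2 - ℓ 0 z.2) -
      (ℓ (f z.1) z.2 - ℓ 0 z.2) with hG
  set Φ := potential (N * (n + 1)) (scale n L (extendZero B)) (rate n L (extendZero B))
    (k * (n + 1) + i) a with hΦ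
  set x₀ := ν.ctx []
  have key : ∀ (m : ℕ) (h : List (X × Y × ℝ)), h.length + m = n →
      regretFrom ℓ (learner program n L B ℓ A T) ν f m h ≤
        expect (wealthLaw n N L (extendZero B)
          (oracleAt ℓ A T (h.map fun z => (z.1, z.2.1)) x₀) h.length) (Φ m) +
        (R - pathSum G [] (h.map fun z => (z.1, z.2.1))) := by
    intro m
    induction m with
    | zero =>
      intro h hlen
      have hO : ∀ s < h.length, LossesBounded n N L (extendZero B)
          (oracleAt ℓ A T (h.map fun z => (z.1, z.2.1)) x₀) s := fun s hs =>
        lossesBounded_oracleAt hL hℓ hA (by simpa using hs) (by omega)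
      have h1 := expect_mono (BddOn.const _ 0) (bddOn_wealthLaw_potential hn hb hO hj a 0)
        fun W hW => potential_zero_nonneg (c := scale n L (extendZero B)) hj (rate_pos hn hb hj)
          ha0 ha1 fun j hj => wealthLaw_pos hn hb hO hW hj
      rw [expect_const] at h1
      have h2 := hR (h.map fun z => (z.1, z.2.1)) (by simpa using hlen)
      simp only [regretFrom]
      linarith
    | succ m ih =>
      intro h hlen
      rw [regretFrom_succ]
      set past := h.map fun z => (z.1, z.2.1) with hpast
      set x := ν.ctx h
      set q := learner program n L B ℓ A T past x with hq
      set y := ν.out h x q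
      have hplen : past.length = h.length := by simp [hpast]
      set O := oracleAt ℓ A T (past ++ [(x, y)]) x₀ with hOdef
      have hqP : ∀ v ∈ q.support, |v| ≤ _ := hP past x (by omega)
      have hbl := bddOn_loss hL.le hℓ hqP y
      -- the regret in the later rounds
      set c₀ := -(ℓ (f x) y - ℓ 0 y) + (expect (wealthLaw n N L (extendZero B) O
        (h.length + 1)) (Φ m) + (R - pathSum G [] (past ++ [(x, y)]))) with hc₀
      have hstep : expect q (fun v => ℓ v y - ℓ (f x) y +
          regretFrom ℓ (learner program n L B ℓ A T) ν f m (h ++ [(x, y, v)])) ≤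
          expect q (fun v => (ℓ v y - ℓ 0 y) + c₀) := by
        refine expect_mono ?_ (hbl.add (BddOn.const _ _)) fun v _ => ?_
        · have h1 : BddOn q fun v =>
              regretFrom ℓ (learner program n L B ℓ A T) ν f m (h ++ [(x, y, v)]) :=
            ⟨_, fun v _ => abs_regretFrom_le hL.le hℓ hP ν hf m _ (by simp; omega)⟩
          have h2 := (hbl.add (BddOn.const _ (-(ℓ (f x) y - ℓ 0 y)))).add h1
          obtain ⟨M, hM⟩ := h2
          refine ⟨M, fun v hv => ?_⟩
          convert hM v hv using 2
          ring
        · have h1 := ih (h ++ [(x, y, v)]) (by simp; omega)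
          have h2 : (h ++ [(x, y, v)]).map (fun z => (z.1, z.2.1)) = past ++ [(x, y)] := by
            simp [hpast]
          rw [h2, List.length_append, List.length_singleton] at h1
          linarith
      refine hstep.trans ?_
      rw [expect_add hbl (BddOn.const _ _), expect_const]
      have hO : ∀ s < h.length + 1, LossesBounded n N L (extendZero B) O s := fun s hs =>
        lossesBounded_oracleAt hL hℓ hA (by simp; omega) (by omega)
      have hsub : ∀ s ≤ past.length, ∀ k R, (oracleAt ℓ A T past x).sub k R s = O.sub k R s :=
        fun s hs k R => oracleAt_sub_append (z := (x, y)) rfl hs k R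
      have hloss : ∀ s < past.length, ∀ v, (oracleAt ℓ A T past x).loss v s = O.loss v s :=
        fun s hs v => oracleAt_loss_append hs v
      have h1 := expect_predictionLaw_add_le (t := h.length) hn hb hO hj ha0 ha1 m
      have h2 : predictionLaw n N L (extendZero B) O h.length = q := by
        rw [hq, learner_eq hn, hplen]
        exact (predictionLaw_congr (fun s hs => hsub s (by omega))
          fun s hs => hloss s (by omega)).symm
      have h3 : wealthLaw n N L (extendZero B) O h.length =
          wealthLaw n N L (extendZero B) (oracleAt ℓ A T past x₀) h.length := by
        -- the context of the current round does not matter here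
        have e1 := wealthLaw_congr (n := n) (N := N) (L := L) (b := extendZero B)
          (O := oracleAt ℓ A T past x) (O' := O) (t := h.length)
          (fun s hs => hsub s (by omega)) fun s hs => hloss s (by omega)
        rw [← e1]
        refine wealthLaw_congr (fun s hs k R => ?_) fun s hs v => rfl
        have hs' : s < past.length := by omega
        simp only [oracleAt, dif_pos hs']
      have h4 : expertLaw O n h.length (k * (n + 1) + i) = A k (2 ^ i) past x := by
        rw [expertLaw, radius, index_div hi, index_mod hi, ← hplen, hOdef,
          ← oracleAt_sub_append (x := x) rfl le_rfl, oracleAt_sub_self]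
      have h5 : (fun v => O.loss v h.length - O.loss 0 h.length) = fun v => ℓ v y - ℓ 0 y := by
        funext v
        rw [← hplen, hOdef, oracleAt_loss_last, oracleAt_loss_last]
      rw [h2, h3, h4, h5] at h1
      have h6 : pathSum G [] (past ++ [(x, y)]) = pathSum G [] past +
          (a * expect (A k (2 ^ i) past x) (fun v => ℓ v y - ℓ 0 y) -
            (ℓ (f x) y - ℓ 0 y)) := by
        rw [pathSum_append, List.nil_append]
      rw [hc₀, h6]
      linarith
  have h1 := key n [] (by simp)
  simp only [List.map_nil, List.length_nil, pathSum, sub_zero, wealthLaw, iterLaw,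
    expect_pure] at h1
  exact h1

end Regret

/-! ### The oracle inequality -/

/-- Evaluation at `x` is bounded by the norm times the square root of the kernel at `(x, x)`. -/
theorem abs_apply_le {X H : Type*} [NormedAddCommGroup H] [InnerProductSpace ℝ H] [CompleteSpace H]
    [RKHS ℝ H X ℝ] {b : ℝ} (hb : ∀ x, √(RKHS.kernel H x x 1) ≤ b) (f : H) (x : X) :
    |f x| ≤ b * ‖f‖ := by
  have h1 : |f x| ≤ ‖RKHS.kerFun H x (1 : ℝ)‖ * ‖f‖ := by
    have h2 := abs_real_inner_le_norm (RKHS.kerFun H x (1 : ℝ)) f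
    rw [RKHS.kerFun_inner] at h2
    simpa using h2
  have h3 : ‖RKHS.kerFun H x (1 : ℝ)‖ = √(RKHS.kernel H x x 1) := by
    have h4 := RKHS.kernel_inner H x x (1 : ℝ) (1 : ℝ)
    rw [real_inner_self_eq_norm_sq] at h4
    have h5 : RKHS.kernel H x x (1 : ℝ) = ‖RKHS.kerFun H x (1 : ℝ)‖ ^ 2 := by
      rw [← h4]; simp
    rw [h5, Real.sqrt_sq (norm_nonneg _)]
  rw [h3] at h1
  exact h1.trans (mul_le_mul_of_nonneg_right (hb x) (norm_nonneg f))

/-- The potential at the start, with a rate `r / (4 * c)` for which `r ^ 2 = Λ / (n + Λ)`. The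
prior wealth `1 / p` is not too small in comparison with `D = exp Λ`. -/
theorem neg_log_div_add_le {n c p D : ℝ} (hn : 1 ≤ n) (hc : 1 ≤ c) (hp : 0 < p) (hD : 2 ≤ D)
    (hpD : p * (16 * c * n) ≤ 32 * D ^ 2) (hΛn : Real.log D ≤ n) :
    -Real.log (1 / p * (√(Real.log D / (n + Real.log D)) / (4 * c))) /
        (√(Real.log D / (n + Real.log D)) / (4 * c)) -
        1 / (√(Real.log D / (n + Real.log D)) / (4 * c)) +
        n * (8 * (√(Real.log D / (n + Real.log D)) / (4 * c)) * c ^ 2) ≤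
      58 * c * √(n * Real.log D) := by
  set Λ := Real.log D with hΛ
  have hΛ0 : 1 / 2 < Λ := by
    have h1 := Real.log_le_log two_pos hD
    have h2 := Real.log_two_gt_d9
    linarith
  set r := √(Λ / (n + Λ)) with hr
  set S := √(n * Λ) with hS
  have hr2 : r ^ 2 * (n + Λ) = Λ := by
    rw [hr, Real.sq_sqrt (div_nonneg (by linarith) (by linarith)),
      div_mul_cancel₀ _ (by linarith)]
  have hr0 : 0 < r := Real.sqrt_pos.2 (div_pos (by linarith) (by linarith))
  have hS2 : S ^ 2 = n * Λ := Real.sq_sqrt (mul_nonneg (by linarith) (by linarith))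
  have hS0 : 0 < S := Real.sqrt_pos.2 (mul_pos (by linarith) (by linarith))
  -- `n * r ≤ S` and `Λ / r ≤ 2 * S`
  have h1 : n * r ≤ S := by
    refine Real.le_sqrt_of_sq_le ?_
    have : r ^ 2 * n ≤ Λ := by nlinarith [sq_nonneg r]
    nlinarith
  have h2 : Λ ≤ 2 * S * r := by
    refine le_of_sq_le_sq ?_ (by positivity)
    have h3 : Λ ≤ 2 * n * r ^ 2 := by nlinarith [sq_nonneg r]
    have h4 : (2 * S * r) ^ 2 = 4 * (n * r ^ 2) * Λ := by
      rw [mul_pow, mul_pow, hS2]; ring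
    rw [h4]
    nlinarith [mul_nonneg (by linarith : (0 : ℝ) ≤ n) (sq_nonneg r)]
  have h3 : S ≤ n := by
    refine Real.sqrt_le_iff.2 ⟨by linarith, ?_⟩
    nlinarith
  have h4 : 1 ≤ 4 * n * r := by nlinarith
  -- the logarithm of the initial stake
  have h5 : -Real.log (1 / p * (r / (4 * c))) ≤ 7 * Λ := by
    rw [← Real.log_inv, hΛ, ← Real.log_rpow (by linarith)]
    refine Real.log_le_log (by positivity) ?_
    have e1 : (1 / p * (r / (4 * c)))⁻¹ = p * (4 * c) / r := by field_simp
    have e2 : D ^ (7 : ℝ) = D ^ 2 * D ^ 5 := by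
      rw [← pow_add, ← Real.rpow_natCast]; norm_num
    have e3 : (32 : ℝ) ≤ D ^ 5 := by
      calc (32 : ℝ) = 2 ^ 5 := by norm_num
        _ ≤ D ^ 5 := pow_le_pow_left₀ (by norm_num) hD 5
    rw [e1, e2, div_le_iff₀ hr0]
    have e4 : p * (16 * c * n) ≤ D ^ 2 * D ^ 5 := by nlinarith [sq_nonneg D]
    have e5 : p * (4 * c) * 1 ≤ p * (4 * c) * (4 * n * r) :=
      mul_le_mul_of_nonneg_left h4 (by positivity)
    have e6 := mul_le_mul_of_nonneg_right e4 hr0.le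
    linarith
  have h6 : -Real.log (1 / p * (r / (4 * c))) / (r / (4 * c)) ≤ 56 * c * S := by
    rw [div_le_iff₀ (by positivity)]
    have : 56 * c * S * (r / (4 * c)) = 7 * (2 * S * r) := by field_simp; ring
    rw [this]
    linarith
  have h7 : 0 < 1 / (r / (4 * c)) := by positivity
  have h8 : n * (8 * (r / (4 * c)) * c ^ 2) = 2 * c * (n * r) := by field_simp; ring
  have h9 := mul_le_mul_of_nonneg_left h1 (by linarith : 0 ≤ 2 * c)
  rw [h8]
  linarith

/-- The smallest power of two above `F` is at most `2 * (F + 1)`. -/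
theorem exists_two_pow {F : ℝ} {n : ℕ} (hF : 0 ≤ F) (hFn : F ≤ 2 ^ n) :
    ∃ i ≤ n, F ≤ 2 ^ i ∧ (2 : ℝ) ^ i ≤ 2 * (F + 1) := by
  classical
  have hex : ∃ i : ℕ, F ≤ 2 ^ i := ⟨n, hFn⟩
  refine ⟨Nat.find hex, Nat.find_min' hex hFn, Nat.find_spec hex, ?_⟩
  rcases h : Nat.find hex with _ | i
  · rw [pow_zero]; linarith
  · have := not_le.1 (Nat.find_min hex (m := i) (by omega))
    rw [pow_succ]
    linarith

/-- With a single round, the prediction `0` is good enough. -/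
theorem le_mul_sqrt_log {F Q : ℝ} (hF : 0 ≤ F) (hQ : F + 1 ≤ Q) :
    F ≤ (F + 1) * √(Real.log Q) := by
  have h0 : 0 < F + 1 := by linarith
  have h1 : F / (F + 1) ≤ Real.log Q := by
    have h2 := Real.one_sub_inv_le_log_of_pos h0
    have h3 := Real.log_le_log h0 hQ
    have h4 : F / (F + 1) = 1 - (F + 1)⁻¹ := by field_simp; ring
    linarith
  have h5 : F / (F + 1) ≤ √(Real.log Q) := by
    refine Real.le_sqrt_of_sq_le ((?_ : _ ≤ F / (F + 1)).trans h1)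
    have h6 : F / (F + 1) ≤ 1 := div_le_one_of_le₀ (by linarith) h0.le
    have h7 : 0 ≤ F / (F + 1) := div_nonneg hF h0.le
    nlinarith
  calc F = (F + 1) * (F / (F + 1)) := (mul_div_cancel₀ _ h0.ne').symm
    _ ≤ _ := mul_le_mul_of_nonneg_left h5 h0.le

section Main

variable {X Y : Type*} {n N T : ℕ} {ℓ : ℝ → Y → ℝ} {L : ℝ} {B : Fin N → ℝ}
  {A : Fin N → ℝ → Strategy X Y}

theorem sum_initial_wealth_le (n N : ℕ) :
    ∑ j ∈ range (N * (n + 1)), (if j < N * (n + 1) then prior n j else 0) ≤ 2 := by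
  rw [sum_congr rfl fun j hj => if_pos (mem_range.1 hj)]
  have h1 := sum_prior_le n N
  have h2 : (0 : ℝ) ≤ 1 / (N + 1) := by positivity
  linarith

/-- The regret with respect to a bounded function, by comparison with the prediction `0`. -/
theorem expectedRegret_learner_le_of_abs_le (hn : 2 ≤ n) (hL : 0 < L) (hLB : ∀ k, 1 ≤ L * B k)
    (hℓ : ∀ y u v, |ℓ u y - ℓ v y| ≤ L * |u - v|)
    (hA : ∀ k R, 0 < R → PredictsIn (A k R) n (B k * R)) (k : Fin N) (ν : Nature X Y)
    {f : X → ℝ} {F : ℝ} (hf : ∀ x, |f x| ≤ F) :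
    expectedRegret ℓ (learner program n L B ℓ A T) ν f n ≤ 2 + n * (L * F) := by
  have h1 := expectedRegret_learner_le (T := T) hn hL hLB hℓ hA k (Nat.succ_pos n) le_rfl
    zero_le_one ν hf (R := n * (L * F)) fun path hlen => by
      rw [← hlen]
      refine pathSum_le_length_mul _ (fun past z => ?_) _ _
      have h2 := hℓ z.2 0 (f z.1)
      have h3 := mul_le_mul_of_nonneg_left (hf z.1) hL.le
      rw [zero_sub, abs_neg] at h2
      have h4 := le_abs_self (ℓ 0 z.2 - ℓ (f z.1) z.2)
      linarith
  rw [potential, zero_mul, add_zero] at h1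
  linarith [sum_initial_wealth_le n N]

/-- The regret with respect to `f` in the ball of radius `2 ^ i`, by comparison with the
sub-algorithm for this ball. -/
theorem expectedRegret_learner_le_of_regret_le (hn : 2 ≤ n) (hL : 0 < L) (hLB : ∀ k, 1 ≤ L * B k)
    (hℓ : ∀ y u v, |ℓ u y - ℓ v y| ≤ L * |u - v|)
    (hA : ∀ k R, 0 < R → PredictsIn (A k R) n (B k * R)) (k : Fin N) (ν : Nature X Y)
    {f : X → ℝ} {F : ℝ} (hf : ∀ x, |f x| ≤ F) {i : ℕ} (hi : i < n + 1) {R : ℝ}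
    (hR : ∀ ν : Nature X Y, expectedRegret ℓ (A k (2 ^ i)) ν f n ≤ R)
    (hlog : Real.log (L * (B k * 2 ^ i) * ((k : ℕ) + 1) * n) ≤ n) :
    expectedRegret ℓ (learner program n L B ℓ A T) ν f n ≤
      2 + 58 * (L * (B k * 2 ^ i)) *
        √(n * Real.log (L * (B k * 2 ^ i) * ((k : ℕ) + 1) * n)) + R := by
  have hb : ∀ k < N, 1 ≤ L * extendZero B k := fun k hk => by
    rw [extendZero, dif_pos hk]
    exact hLB _
  have hj := index_lt k.2 hi
  have d : X × Y := ⟨ν.ctx [], ν.out [] (ν.ctx []) (PMF.pure 0)⟩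
  have h1 := expectedRegret_learner_le (T := T) hn hL hLB hℓ hA k hi zero_le_one le_rfl ν hf
    (R := R) fun path hlen => by
      simp only [one_mul]
      exact pathSum_le_of_expectedRegret_le hL.le hℓ (hA k (2 ^ i) (by positivity)) d f hR path
        hlen
  refine h1.trans (add_le_add_left ?_ R)
  rw [potential, one_mul, if_pos hj]
  refine add_le_add (sum_initial_wealth_le n N) ?_
  have e1 : scale n L (extendZero B) (k * (n + 1) + i) = L * (B k * 2 ^ i) := by
    rw [scale, radius, index_div hi, index_mod hi, extendZero_fin]
  have h2 := two_le_complexity_arg hn hb hj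
  have h3 := (one_le_radius n _).trans (radius_le_scale hb hj)
  have h4 := radius_le_scale hb hj
  rw [index_div hi, e1] at h2
  rw [e1] at h3 h4
  rw [radius, index_mod hi] at h4
  rw [rate, complexity, prior, radius, e1, index_div hi, index_mod hi]
  have hn1 : (1 : ℝ) ≤ n := by exact_mod_cast (by omega : 1 ≤ n)
  have hk0 : (0 : ℝ) ≤ ((k : ℕ) : ℝ) := Nat.cast_nonneg _
  refine neg_log_div_add_le hn1 h3 (by positivity) h2 ?_ hlog
  -- `(k + 1) * (k + 2) * 2 ^ i * n ≤ 2 * (k + 1) ^ 2 * c * n ^ 2`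
  set c := L * (B k * 2 ^ i)
  have g1 : (((k : ℕ) : ℝ) + 1) * ((k : ℕ) + 2) ≤ 2 * (((k : ℕ) : ℝ) + 1) ^ 2 := by nlinarith
  have g2 : (2 : ℝ) ^ i * n ≤ c * n ^ 2 := by
    have : (n : ℝ) ≤ n ^ 2 := by nlinarith
    exact mul_le_mul h4 this (by linarith) (by linarith)
  have g3 := mul_le_mul g1 g2 (by positivity) (by positivity)
  have g4 := mul_le_mul_of_nonneg_left g3 (by linarith : 0 ≤ 16 * c)
  linarith

/-- The regret in the first round, when the learner predicts `0`. -/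
theorem expectedRegret_learner_one_le (hn : n = 1) (hL : 0 < L)
    (hℓ : ∀ y u v, |ℓ u y - ℓ v y| ≤ L * |u - v|) (ν : Nature X Y)
    {f : X → ℝ} {F : ℝ} (hf : ∀ x, |f x| ≤ F) :
    expectedRegret ℓ (learner program n L B ℓ A T) ν f n ≤ L * F := by
  subst hn
  rw [expectedRegret, regretFrom_succ, learner_eq_of_lt_two (by norm_num), expect_pure]
  simp only [regretFrom, add_zero]
  refine (le_abs_self _).trans ((hℓ _ _ _).trans ?_)
  rw [zero_sub, abs_neg]
  exact mul_le_mul_of_nonneg_left (hf _) hL.le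

/-- The oracle inequality for one class and one function in it. -/
theorem oracle_inequality {C₀ : ℝ} (hL : 0 < L) (hLB : ∀ k, 1 ≤ L * B k)
    (hℓ : ∀ y u v, |ℓ u y - ℓ v y| ≤ L * |u - v|)
    (hA : ∀ k R, 0 < R → PredictsIn (A k R) n (B k * R)) (k : Fin N) (ν : Nature X Y)
    {f : X → ℝ} {F : ℝ} (hF : 0 ≤ F) (hf : ∀ x, |f x| ≤ B k * F)
    (hR : ∀ R, 0 < R → F ≤ R → ∀ ν : Nature X Y,
      expectedRegret ℓ (A k R) ν f n ≤ C₀ * (L * (B k * R) * √n)) :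
    expectedRegret ℓ (learner program n L B ℓ A T) ν f n ≤ (200 + 4 * |C₀|) *
      (L * B k * (F + 1) * √(n * Real.log (L * B k * ((k : ℕ) + 1 : ℝ) * n * (F + 1)))) := by
  have hk0 : (0 : ℝ) ≤ ((k : ℕ) : ℝ) := Nat.cast_nonneg _
  have hLBk := hLB k
  have hC : 200 ≤ 200 + 4 * |C₀| := by linarith [abs_nonneg C₀]
  rcases (by omega : n = 0 ∨ n = 1 ∨ 2 ≤ n) with hn | hn | hn
  · subst hn
    simp [expectedRegret, regretFrom]
  · have h1 := expectedRegret_learner_one_le (T := T) (B := B) (A := A) hn hL hℓ ν hf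
    have h2 : F ≤ (F + 1) * √(Real.log (L * B k * ((k : ℕ) + 1 : ℝ) * n * (F + 1))) := by
      refine le_mul_sqrt_log hF ?_
      rw [hn, Nat.cast_one, mul_one]
      have : 1 ≤ L * B k * (((k : ℕ) : ℝ) + 1) :=
        one_le_mul_of_one_le_of_one_le hLBk (by linarith)
      nlinarith
    have h3 : L * (B k * F) ≤ L * B k * (F + 1) *
        √(n * Real.log (L * B k * ((k : ℕ) + 1 : ℝ) * n * (F + 1))) := by
      have := mul_le_mul_of_nonneg_left h2 (by linarith : 0 ≤ L * B k)
      rw [hn, Nat.cast_one, one_mul] at *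
      linarith
    have h4 : 0 ≤ L * B k * (F + 1) *
        √(n * Real.log (L * B k * ((k : ℕ) + 1 : ℝ) * n * (F + 1))) := by positivity
    nlinarith
  · have hn2 : (2 : ℝ) ≤ n := by exact_mod_cast hn
    set Q := L * B k * ((k : ℕ) + 1 : ℝ) * n * (F + 1) with hQ
    have hQF : 2 * (F + 1) ≤ Q := by
      have h1 : 1 ≤ L * B k * (((k : ℕ) : ℝ) + 1) :=
        one_le_mul_of_one_le_of_one_le hLBk (by linarith)
      have h2 : 2 ≤ L * B k * (((k : ℕ) : ℝ) + 1) * n := by nlinarith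
      exact mul_le_mul_of_nonneg_right h2 (by linarith)
    have hQ2 : 2 ≤ Q := by linarith
    have hlog2 := Real.log_two_gt_d9
    have hlogQ : Real.log 2 ≤ Real.log Q := Real.log_le_log two_pos hQ2
    set Λ := Real.log Q with hΛ
    set S := √(n * Λ) with hS
    have hS2 : S ^ 2 = n * Λ := Real.sq_sqrt (mul_nonneg (by linarith) (by linarith))
    have hS1 : 1 ≤ S := Real.le_sqrt_of_sq_le (by nlinarith)
    set M := L * B k * (F + 1) with hM
    have hM1 : 1 ≤ M := one_le_mul_of_one_le_of_one_le hLBk (by linarith)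
    have hMS : 1 ≤ M * S := one_le_mul_of_one_le_of_one_le hM1 hS1
    rcases le_or_gt (n : ℝ) (2 * Λ) with hcase | hcase
    · -- the horizon is so short that the trivial bound suffices
      have h1 := expectedRegret_learner_le_of_abs_le (T := T) hn hL hLB hℓ hA k ν hf
      have h2 : (n : ℝ) ≤ 2 * S := by
        refine le_of_sq_le_sq ?_ (by linarith)
        rw [mul_pow, hS2]
        nlinarith
      have h3 : L * (B k * F) ≤ M := by
        rw [hM]; linarith
      have h4 : (n : ℝ) * (L * (B k * F)) ≤ 2 * S * M :=
        mul_le_mul h2 h3 (by rw [← mul_assoc]; positivity) (by linarith)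
      nlinarith
    · -- otherwise, the norm of `f` is below the largest radius
      have hF2 : F ≤ 2 ^ n := by
        have h1 : Λ < Real.log (2 ^ n) := by
          rw [Real.log_pow]
          nlinarith
        have h2 := (Real.log_lt_log_iff (by linarith) (by positivity)).1 h1
        linarith
      obtain ⟨i, hin, hi1, hi2⟩ := exists_two_pow hF hF2
      have hpow : (0 : ℝ) < 2 ^ i := by positivity
      set c := L * (B k * 2 ^ i) with hc
      have hcM : c ≤ 2 * M := by
        have := mul_le_mul_of_nonneg_left hi2 (by linarith : 0 ≤ L * B k)
        rw [hc, hM]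
        linarith
      have hc0 : 0 < c := by rw [hc, ← mul_assoc]; positivity
      have hD : Real.log (c * ((k : ℕ) + 1) * n) ≤ 2 * Λ := by
        have h1 : c * ((k : ℕ) + 1) * n ≤ 2 * Q := by
          have h2 := mul_le_mul_of_nonneg_right hcM
            (by positivity : 0 ≤ (((k : ℕ) : ℝ) + 1) * n)
          rw [hM] at h2
          rw [hQ]
          linarith
        have h2 := Real.log_le_log (by positivity) h1
        rw [Real.log_mul two_ne_zero (by linarith)] at h2
        linarith
      have h1 := expectedRegret_learner_le_of_regret_le (T := T) hn hL hLB hℓ hA k ν hf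
        (by omega : i < n + 1) (hR (2 ^ i) hpow hi1) (hD.trans hcase.le)
      rw [← hc] at h1
      have h2 : √(n * Real.log (c * ((k : ℕ) + 1) * n)) ≤ 3 / 2 * S := by
        refine Real.sqrt_le_iff.2 ⟨by linarith, ?_⟩
        rw [mul_pow, hS2]
        nlinarith
      have h3 : √(n : ℝ) ≤ 2 * S := by
        refine Real.sqrt_le_iff.2 ⟨by linarith, ?_⟩
        rw [mul_pow, hS2]
        nlinarith
      have h4 : 58 * c * √(n * Real.log (c * ((k : ℕ) + 1) * n)) ≤ 58 * (2 * M) * (3 / 2 * S) :=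
        mul_le_mul (by linarith) h2 (Real.sqrt_nonneg _) (by linarith)
      have h5 : C₀ * (c * √(n : ℝ)) ≤ |C₀| * (2 * M * (2 * S)) :=
        mul_le_mul (le_abs_self _) (mul_le_mul hcM h3 (Real.sqrt_nonneg _) (by linarith))
          (mul_nonneg hc0.le (Real.sqrt_nonneg _)) (abs_nonneg _)
      linarith

end Main

/-- The program runs in polynomial time. -/
theorem exists_roundRun_steps_le : ∃ d : ℕ, ∀ {X Y : Type*} {n N T : ℕ} (B : Fin N → ℝ) (L : ℝ)
    (ℓ : ℝ → Y → ℝ) (A : Fin N → ℝ → Strategy X Y) (past : List (X × Y)) (x : X),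
    past.length < n → ∀ σ ∈ (roundRun program n L B ℓ A T past x).support,
      σ.steps ≤ (n + N + 2) ^ d * (T + 1) := by
  obtain ⟨d, hd⟩ := program_protected.exists_steps_le
  refine ⟨2 * d, fun {X Y n N T} B L ℓ A past x hlen σ hσ => ?_⟩
  have h1 := hd (oracleAt ℓ A T past x) (initState n past.length L B) σ hσ
  have h2 : (initState n past.length L B).inputSize ≤ (n + N + 2) ^ 2 := by
    simp only [State.inputSize, initState]
    norm_num
    nlinarith
  have h3 := Nat.mul_le_mul_right (T + 1) (Nat.pow_le_pow_left h2 d)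
  rw [← pow_mul] at h3
  change σ.steps ≤ 0 + _ * (T + 1) at h1
  omega

end OnlineLearning

end

theorem theorem9 :
    ∃ (P : OnlineLearning.Cmd) (d : ℕ), ∀ C₀ : ℝ, ∃ C : ℝ,
      ∀ (X : Type*) (Y : Type*) (n N T : ℕ) (H : Fin N → Type*)
        [∀ k, NormedAddCommGroup (H k)] [∀ k, InnerProductSpace ℝ (H k)]
        [∀ k, CompleteSpace (H k)] [∀ k, RKHS ℝ (H k) X ℝ]
        (B : Fin N → ℝ) (L : ℝ) (ℓ : ℝ → Y → ℝ)
        (A : Fin N → ℝ → OnlineLearning.Strategy X Y),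
        -- the kernels are bounded
        (∀ k x, √(RKHS.kernel (H k) x x 1) ≤ B k) →
        0 < L → (∀ k, 1 ≤ L * B k) →
        -- the loss is Lipschitz in the prediction
        (∀ y u v, |ℓ u y - ℓ v y| ≤ L * |u - v|) →
        -- `A k R` is an algorithm for the ball of radius `R` in `H k`
        (∀ k R, 0 < R → OnlineLearning.PredictsIn (A k R) n (B k * R) ∧
          ∀ (ν : OnlineLearning.Nature X Y) (f : H k), ‖f‖ ≤ R →
            OnlineLearning.expectedRegret ℓ (A k R) ν f n ≤ C₀ * (L * (B k * R) * √n)) →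
        -- the running time per round, if each call of a sub-algorithm takes time `T`
        (∀ (past : List (X × Y)) (x : X), past.length < n →
          ∀ σ ∈ (OnlineLearning.roundRun P n L B ℓ A T past x).support,
            σ.steps ≤ (n + N + 2) ^ d * (T + 1)) ∧
        -- predictions are bounded, so that all expectations exist
        (∃ M : ℝ, OnlineLearning.PredictsIn (OnlineLearning.learner P n L B ℓ A T) n M) ∧
        -- the oracle inequality
        ∀ (ν : OnlineLearning.Nature X Y) (k : Fin N) (f : H k),
          OnlineLearning.expectedRegret ℓ (OnlineLearning.learner P n L B ℓ A T) ν f n ≤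
            C * (L * B k * (‖f‖ + 1) *
              √(n * Real.log (L * B k * ((k : ℕ) + 1 : ℝ) * n * (‖f‖ + 1)))) := by
  obtain ⟨d, hd⟩ := OnlineLearning.exists_roundRun_steps_le
  refine ⟨OnlineLearning.program, d, fun C₀ => ⟨200 + 4 * |C₀|, ?_⟩⟩
  intro X Y n N T H _ _ _ _ B L ℓ A hK hL hLB hℓ hA
  have hB : ∀ k, 0 ≤ B k := fun k =>
    (pos_of_mul_pos_right (zero_lt_one.trans_le (hLB k)) hL.le).le
  have hP := fun k R hR => (hA k R hR).1
  refine ⟨hd B L ℓ A, ⟨_, OnlineLearning.learner_predictsIn hB hP⟩, fun ν k f => ?_⟩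
  exact OnlineLearning.oracle_inequality hL hLB hℓ hP k ν (norm_nonneg f)
    (OnlineLearning.abs_apply_le (hK k) f) fun R hR hfR ν => (hA k R hR).2 ν f hfR
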